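/- Let $a<0<b$ and let $\lambda:\mathbb R\to[0,\infty)$ be continuously differentiable with $\lambda(y)=0$ for $y\in[-1,1]$, $\lambda(y)>0$ for $y\notin[-1,1]$, and $$\int_{-1-\varepsilon}^{-1}\frac{dy}{\lambda(y)}=\int_{1}^{1+\varepsilon}\frac{dy}{\lambda(y)}=\infty\qquad\text{for all }\varepsilon>0 .$$ Put $S^1=\mathbb R/2\pi\mathbb Z$ and let $\mathfrak C$ be the cylinder $S^1\times[a,b]$ with all points of $S^1\times\{0\}$ identified to a single point $\mathfrak o$, with the quotient topology; let $C(\mathfrak C)$ be the space of real continuous functions on $\mathfrak C$ with the supremum norm. Put $u(y)=\int_0^y\lambda(s)\,ds$, $v(y)=2u(y)$, and, for $h\in\{u,v,\lambda\}$, let $\tilde h(y)=h(y-1)$ for $y<0$, $\tilde h(y)=h(y+1)$ for $y>0$, and $\tilde h(0)=0$. For a strictly increasing continuous function $w$ write $D_w g(y)=\lim_{z\to y}\frac{g(z)-g(y)}{w(z)-w(y)}$. For $\theta\in S^1$ and $y\in(a,0)\cup(0,b)$ put $$Af(\theta,y)=D_{\tilde u}D_{\tilde v}f(\theta,y)+\frac1{\tilde\lambda(y)^2}\,\frac{\partial^2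 f}{\partial\theta^2}(\theta,y),$$ where $D_{\tilde u},D_{\tilde v}$ act in the variable $y$. Let $D(A)$ be the set of all $f\in C(\mathfrak C)$ such that the derivatives in $Af$ exist and they and $Af$ are continuous on $S^1\times((a,0)\cup(0,b))$, and 1. for every $\theta\in S^1$ the finite limits $L_\pm(\theta)=\lim_{\theta'\to\theta,\ y\to0\pm}D_{\tilde u}f(\theta',y)$ exist; 2. for every $\theta\in S^1$ the finite limit $\lim_{\theta'\to\theta,\ y\to0}Af(\theta',y)$ exists, and it does not depend on $\theta$; 3. $\lim_{\theta'\to\theta,\ y\to a}Af(\theta',y)=\lim_{\theta'\to\theta,\ y\to b}Af(\theta',y)=0$ for every $\theta\in S^1$; 4. $\int_0^{2\pi}L_-(\theta)\,d\theta=\int_0^{2\pi}L_+(\theta)\,d\theta$. For $f\in D(A)$ define $Af(\mathfrak o)$ as the limit in 2 and $Af(\theta,a)=Af(\theta,b)=0$; thus $A:D(A)\to C(\mathfrak C)$ is a linear operator. **Lemma.** The operator $A$ with domain $D(A)$ is closable, and its closure $\overline A$ is the infinitesimal operator of a Markov semigroup on $C(\mathfrak C)$: there are bounded linear operators $T_t$,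 $t\ge0$, on $C(\mathfrak C)$ with $T_0=I$, $T_{s+t}=T_sT_t$, $T_tf\to f$ in norm as $t\downarrow0$ for every $f$, $T_tf\ge0$ whenever $f\ge0$, and $T_t1=1$, such that $f\in D(\overline A)$ and $\overline Af=g$ if and only if $(T_tf-f)/t\to g$ in norm as $t\downarrow0$. -/

import Mathlib

open Filter Topology Set

noncomputable section

namespace VanishingFriction

/-! ### The glued cylinder -/

/-- The cylinder `S¹ × [a, b]`, with `S¹ = ℝ / 2πℤ`. -/
abbrev Cyl (a b : ℝ) : Type := AddCircle (2 * Real.pi) × Icc a b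

/-- Two points of the cylinder are identified iff they are equal or both lie on `S¹ × {0}`. -/
def glueSetoid (a b : ℝ) : Setoid (Cyl a b) where
  r p q := p = q ∨ ((p.2 : ℝ) = 0 ∧ (q.2 : ℝ) = 0)
  iseqv :=
    { refl := fun _ => Or.inl rfl
      symm := by
        rintro p q (h | h)
        · exact Or.inl h.symm
        · exact Or.inr ⟨h.2, h.1⟩
      trans := by
        rintro p q r (rfl | h) (rfl | h')
        · exact Or.inl rfl
        · exact Or.inr h'
        · exact Or.inr h
        · exact Or.inr ⟨h.1, h'.2⟩ }

/-- The glued cylinder: `S¹ × [a, b]` with the circle `S¹ × {0}` collapsed to one point,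
with the quotient topology. -/
def Glued (a b : ℝ) : Type := Quotient (glueSetoid a b)

instance (a b : ℝ) : TopologicalSpace (Glued a b) :=
  inferInstanceAs (TopologicalSpace (Quotient (glueSetoid a b)))

instance (a b : ℝ) : CompactSpace (Glued a b) :=
  haveI : Fact (0 < 2 * Real.pi) := ⟨Real.two_pi_pos⟩
  inferInstanceAs (CompactSpace (Quotient (glueSetoid a b)))

/-- The point of the glued cylinder with angle `θ` and height `y`. -/
def pt {a b : ℝ} (θ : ℝ) (y : Icc a b) : Glued a b :=
  Quotient.mk (glueSetoid a b) ((θ : AddCircle (2 * Real.pi)), y)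

open Classical in
/-- A function on the glued cylinder in the coordinates `(θ, y)`, with `θ ∈ ℝ` (so it is
`2π`-periodic in `θ`) and `y ∈ [a, b]`. The value `0` for `y ∉ [a, b]` is never used. -/
def coord {a b : ℝ} (f : C(Glued a b, ℝ)) (θ y : ℝ) : ℝ :=
  if h : y ∈ Icc a b then f (pt θ ⟨y, h⟩) else 0

/-! ### Differentiation with respect to a monotone function -/

/-- `D_w g (y) = L`: the quotients `(g z - g y) / (w z - w y)` tend to `L` as `z → y`. -/
def HasDerivWrt (w g : ℝ → ℝ) (L y : ℝ) : Prop :=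
  Tendsto (fun z => (g z - g y) / (w z - w y)) (𝓝[≠] y) (𝓝 L)

/-- The derivative `D_w g (y)` exists as a finite limit. -/
def DiffWrt (w g : ℝ → ℝ) (y : ℝ) : Prop := ∃ L, HasDerivWrt w g L y

/-- The derivative `D_w g (y)`; meaningful where `DiffWrt w g y` holds. -/
def derivWrt (w g : ℝ → ℝ) (y : ℝ) : ℝ :=
  limUnder (𝓝[≠] y) (fun z => (g z - g y) / (w z - w y))

/-! ### The functions built from the friction coefficient -/

/-- Shift of a function of `y ∈ ℝ ∖ [-1, 1]` to the glued coordinate: `h (y - 1)` for `y < 0`,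
`h (y + 1)` for `y > 0`, and `0` at `y = 0`. -/
def shift (h : ℝ → ℝ) (y : ℝ) : ℝ :=
  if y < 0 then h (y - 1) else if 0 < y then h (y + 1) else 0

/-- The shift of `u(y) = ∫₀^y lam`. -/
def uTilde (lam : ℝ → ℝ) : ℝ → ℝ := shift (fun y => ∫ s in (0 : ℝ)..y, lam s)

/-- The shift of `v(y) = 2 ∫₀^y lam`. -/
def vTilde (lam : ℝ → ℝ) : ℝ → ℝ := shift (fun y => 2 * ∫ s in (0 : ℝ)..y, lam s)

/-- The shift of `lam`. -/
def lamTilde (lam : ℝ → ℝ) : ℝ → ℝ := shift lam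

/-! ### The differential expression and the domain -/

/-- Heights at which the differential expression is evaluated: `a < y < b`, `y ≠ 0`. -/
def Inner (a b : ℝ) : Set ℝ := Ioo a b \ {0}

/-- `D_u D_v f + lam⁻² ∂²f/∂θ²` at the point `(θ, y)`. -/
def expr {a b : ℝ} (lam : ℝ → ℝ) (f : C(Glued a b, ℝ)) (θ y : ℝ) : ℝ :=
  derivWrt (uTilde lam) (derivWrt (vTilde lam) (coord f θ)) y
    + 1 / (lamTilde lam y) ^ 2 * iteratedDeriv 2 (fun t => coord f t y) θ

/-- The domain of the operator. -/
structure MemDom {a b : ℝ} (lam : ℝ → ℝ) (f : C(Glued a b, ℝ)) : Prop where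
  /-- the derivatives in the differential expression exist away from `y = 0` -/
  diff_v : ∀ θ, ∀ y ∈ Inner a b, DiffWrt (vTilde lam) (coord f θ) y
  diff_uv : ∀ θ, ∀ y ∈ Inner a b,
    DiffWrt (uTilde lam) (derivWrt (vTilde lam) (coord f θ)) y
  diff_θ : ∀ y ∈ Inner a b, ContDiff ℝ 2 (fun t => coord f t y)
  /-- these derivatives and the expression itself are continuous away from `y = 0` -/
  cont_v : ContinuousOn (fun p : ℝ × ℝ => derivWrt (vTilde lam) (coord f p.1) p.2)
    (univ ×ˢ Inner a b)
  cont_uv : ContinuousOn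
    (fun p : ℝ × ℝ => derivWrt (uTilde lam) (derivWrt (vTilde lam) (coord f p.1)) p.2)
    (univ ×ˢ Inner a b)
  cont_θ : ContinuousOn (fun p : ℝ × ℝ => deriv (fun t => coord f t p.2) p.1)
    (univ ×ˢ Inner a b)
  cont_θθ : ContinuousOn (fun p : ℝ × ℝ => iteratedDeriv 2 (fun t => coord f t p.2) p.1)
    (univ ×ˢ Inner a b)
  cont_expr : ContinuousOn (fun p : ℝ × ℝ => expr lam f p.1 p.2) (univ ×ˢ Inner a b)
  /-- the one-sided limits of `D_u f` at `y = 0` exist for every `θ`, and their integrals over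
  the circle coincide -/
  glue : ∃ Lm Lp : ℝ → ℝ,
    (∀ θ, Tendsto (fun p : ℝ × ℝ => derivWrt (uTilde lam) (coord f p.1) p.2)
      (𝓝 θ ×ˢ 𝓝[<] 0) (𝓝 (Lm θ))) ∧
    (∀ θ, Tendsto (fun p : ℝ × ℝ => derivWrt (uTilde lam) (coord f p.1) p.2)
      (𝓝 θ ×ˢ 𝓝[>] 0) (𝓝 (Lp θ))) ∧
    ∫ θ in (0 : ℝ)..(2 * Real.pi), Lm θ = ∫ θ in (0 : ℝ)..(2 * Real.pi), Lp θ
  /-- the expression has a limit at `y = 0` that does not depend on `θ` -/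
  lim_zero : ∃ l : ℝ, ∀ θ, Tendsto (fun p : ℝ × ℝ => expr lam f p.1 p.2)
    (𝓝 θ ×ˢ 𝓝[≠] 0) (𝓝 l)
  /-- the expression tends to `0` at both ends of the cylinder -/
  lim_left : ∀ θ, Tendsto (fun p : ℝ × ℝ => expr lam f p.1 p.2) (𝓝 θ ×ˢ 𝓝[>] a) (𝓝 0)
  lim_right : ∀ θ, Tendsto (fun p : ℝ × ℝ => expr lam f p.1 p.2) (𝓝 θ ×ˢ 𝓝[<] b) (𝓝 0)

/-! ### Linearity -/

variable {a b : ℝ} {lam : ℝ → ℝ}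

theorem HasDerivWrt.derivWrt {w g : ℝ → ℝ} {L y : ℝ} (h : HasDerivWrt w g L y) :
    derivWrt w g y = L := Tendsto.limUnder_eq h

theorem DiffWrt.has {w g : ℝ → ℝ} {y : ℝ} (h : DiffWrt w g y) :
    HasDerivWrt w g (VanishingFriction.derivWrt w g y) y := by
  obtain ⟨L, hL⟩ := h
  rwa [hL.derivWrt]

theorem HasDerivWrt.comb {w g h : ℝ → ℝ} {L M y : ℝ} (c : ℝ) (hg : HasDerivWrt w g L y)
    (hh : HasDerivWrt w h M y) : HasDerivWrt w (fun z => c * g z + h z) (c * L + M) y := by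
  unfold HasDerivWrt at *
  refine ((hg.const_mul c).add hh).congr fun z => ?_
  ring

theorem HasDerivWrt.congr {w g h : ℝ → ℝ} {L y : ℝ} {s : Set ℝ} (hs : IsOpen s) (hy : y ∈ s)
    (e : ∀ z ∈ s, h z = g z) (hg : HasDerivWrt w g L y) : HasDerivWrt w h L y := by
  unfold HasDerivWrt at *
  refine hg.congr' ?_
  filter_upwards [mem_nhdsWithin_of_mem_nhds (hs.mem_nhds hy)] with z hz
  rw [e z hz, e y hy]

theorem isOpen_inner : IsOpen (Inner a b) := isOpen_Ioo.sdiff isClosed_singleton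

theorem coord_comb (c : ℝ) (f g : C(Glued a b, ℝ)) (θ y : ℝ) :
    coord (c • f + g) θ y = c * coord f θ y + coord g θ y := by
  unfold coord
  split_ifs <;> simp

theorem coord_periodic (f : C(Glued a b, ℝ)) (y : ℝ) :
    Function.Periodic (fun θ => coord f θ y) (2 * Real.pi) := by
  intro θ
  simp [coord, pt]

theorem diffWrt_u {w g : ℝ → ℝ} {y : ℝ} (h : DiffWrt (fun z => 2 * w z) g y) :
    DiffWrt w g y := by
  obtain ⟨L, hL⟩ := h
  refine ⟨2 * L, ?_⟩
  unfold HasDerivWrt at *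
  refine (hL.const_mul 2).congr fun z => ?_
  rw [← mul_sub, div_mul_eq_div_div, ← mul_div_assoc, mul_div_assoc', mul_div_cancel_left₀]
  norm_num

theorem vTilde_eq : vTilde lam = fun y => 2 * uTilde lam y := by
  funext y
  unfold vTilde uTilde shift
  split_ifs <;> simp

theorem MemDom.diff_u {f : C(Glued a b, ℝ)} (hf : MemDom lam f) (θ : ℝ) {y : ℝ}
    (hy : y ∈ Inner a b) : DiffWrt (uTilde lam) (coord f θ) y := by
  have := hf.diff_v θ y hy
  rw [vTilde_eq] at this
  exact diffWrt_u this

theorem MemDom.u_comb {f g : C(Glued a b, ℝ)} (hf : MemDom lam f) (hg : MemDom lam g) (c : ℝ)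
    (θ : ℝ) {y : ℝ} (hy : y ∈ Inner a b) :
    derivWrt (uTilde lam) (coord (c • f + g) θ) y
      = c * derivWrt (uTilde lam) (coord f θ) y + derivWrt (uTilde lam) (coord g θ) y := by
  rw [show coord (c • f + g) θ = fun z => c * coord f θ z + coord g θ z from
    funext fun z => coord_comb c f g θ z]
  exact ((hf.diff_u θ hy).has.comb c (hg.diff_u θ hy).has).derivWrt

theorem MemDom.has_v_comb {f g : C(Glued a b, ℝ)} (hf : MemDom lam f) (hg : MemDom lam g) (c : ℝ)
    (θ : ℝ) {y : ℝ} (hy : y ∈ Inner a b) :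
    HasDerivWrt (vTilde lam) (coord (c • f + g) θ)
      (c * derivWrt (vTilde lam) (coord f θ) y + derivWrt (vTilde lam) (coord g θ) y) y := by
  rw [show coord (c • f + g) θ = fun z => c * coord f θ z + coord g θ z from
    funext fun z => coord_comb c f g θ z]
  exact (hf.diff_v θ y hy).has.comb c (hg.diff_v θ y hy).has

theorem MemDom.has_uv_comb {f g : C(Glued a b, ℝ)} (hf : MemDom lam f) (hg : MemDom lam g)
    (c : ℝ) (θ : ℝ) {y : ℝ} (hy : y ∈ Inner a b) :
    HasDerivWrt (uTilde lam) (derivWrt (vTilde lam) (coord (c • f + g) θ))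
      (c * derivWrt (uTilde lam) (derivWrt (vTilde lam) (coord f θ)) y
        + derivWrt (uTilde lam) (derivWrt (vTilde lam) (coord g θ)) y) y :=
  ((hf.diff_uv θ y hy).has.comb c (hg.diff_uv θ y hy).has).congr isOpen_inner hy
    fun _ hz => (hf.has_v_comb hg c θ hz).derivWrt

theorem MemDom.deriv_comb {f g : C(Glued a b, ℝ)} (hf : MemDom lam f) (hg : MemDom lam g)
    (c : ℝ) (θ : ℝ) {y : ℝ} (hy : y ∈ Inner a b) :
    deriv (fun t => coord (c • f + g) t y) θ
      = c * deriv (fun t => coord f t y) θ + deriv (fun t => coord g t y) θ := by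
  simp only [coord_comb]
  have h1 := ((hf.diff_θ y hy).differentiable (by norm_num)) θ
  have h2 := ((hg.diff_θ y hy).differentiable (by norm_num)) θ
  exact ((h1.hasDerivAt.const_mul c).add h2.hasDerivAt).deriv

theorem MemDom.deriv2_comb {f g : C(Glued a b, ℝ)} (hf : MemDom lam f) (hg : MemDom lam g)
    (c : ℝ) (θ : ℝ) {y : ℝ} (hy : y ∈ Inner a b) :
    iteratedDeriv 2 (fun t => coord (c • f + g) t y) θ
      = c * iteratedDeriv 2 (fun t => coord f t y) θ
        + iteratedDeriv 2 (fun t => coord g t y) θ := by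
  have e : deriv (fun t => coord (c • f + g) t y) = fun θ =>
      c * deriv (fun t => coord f t y) θ + deriv (fun t => coord g t y) θ :=
    funext fun θ => hf.deriv_comb hg c θ hy
  have key : ∀ {k : C(Glued a b, ℝ)}, MemDom lam k →
      DifferentiableAt ℝ (deriv (fun t => coord k t y)) θ := fun {k} hk =>
    (((contDiff_succ_iff_deriv (n := 1)).1
      (by simpa [one_add_one_eq_two] using hk.diff_θ y hy)).2.2.differentiable (by norm_num)) θ
  simp only [iteratedDeriv_succ, iteratedDeriv_zero]
  rw [e]
  exact (((key hf).hasDerivAt.const_mul c).add (key hg).hasDerivAt).deriv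

theorem MemDom.expr_comb {f g : C(Glued a b, ℝ)} (hf : MemDom lam f) (hg : MemDom lam g)
    (c : ℝ) (θ : ℝ) {y : ℝ} (hy : y ∈ Inner a b) :
    expr lam (c • f + g) θ y = c * expr lam f θ y + expr lam g θ y := by
  unfold expr
  rw [hf.deriv2_comb hg c θ hy, (hf.has_uv_comb hg c θ hy).derivWrt]
  ring

theorem inner_zero (ha : a < 0) (hb : 0 < b) : Inner a b ∈ 𝓝[≠] (0 : ℝ) := by
  filter_upwards [mem_nhdsWithin_of_mem_nhds (Ioo_mem_nhds ha hb), self_mem_nhdsWithin]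
    with y h1 h2 using ⟨h1, h2⟩

theorem inner_left (ha : a < 0) (hb : 0 < b) : Inner a b ∈ 𝓝[>] a := by
  filter_upwards [Ioo_mem_nhdsGT ha] with y hy
  exact ⟨⟨hy.1, hy.2.trans hb⟩, hy.2.ne⟩

theorem inner_right (ha : a < 0) (hb : 0 < b) : Inner a b ∈ 𝓝[<] b := by
  filter_upwards [Ioo_mem_nhdsLT hb] with y hy
  exact ⟨⟨ha.trans hy.1, hy.2⟩, hy.1.ne'⟩

theorem tendsto_comb {F G H : ℝ × ℝ → ℝ} {θ c l m : ℝ} {φ : Filter ℝ} (hφ : Inner a b ∈ φ)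
    (e : ∀ θ, ∀ y ∈ Inner a b, H (θ, y) = c * F (θ, y) + G (θ, y))
    (hF : Tendsto F (𝓝 θ ×ˢ φ) (𝓝 l)) (hG : Tendsto G (𝓝 θ ×ˢ φ) (𝓝 m)) :
    Tendsto H (𝓝 θ ×ˢ φ) (𝓝 (c * l + m)) := by
  refine ((hF.const_mul c).add hG).congr' ?_
  filter_upwards [prod_mem_prod univ_mem hφ] with p hp using (e p.1 p.2 hp.2).symm

theorem continuousOn_comb {F G H : ℝ × ℝ → ℝ} {c : ℝ}
    (e : ∀ θ, ∀ y ∈ Inner a b, H (θ, y) = c * F (θ, y) + G (θ, y))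
    (hF : ContinuousOn F (univ ×ˢ Inner a b)) (hG : ContinuousOn G (univ ×ˢ Inner a b)) :
    ContinuousOn H (univ ×ˢ Inner a b) :=
  ((hF.const_mul c).add hG).congr fun p hp => e p.1 p.2 hp.2

/-- A joint limit along `θ' → θ` at every `θ` depends continuously on `θ`. -/
theorem continuous_lim {F : ℝ × ℝ → ℝ} {L : ℝ → ℝ} {φ : Filter ℝ} [φ.NeBot]
    (h : ∀ θ, Tendsto F (𝓝 θ ×ˢ φ) (𝓝 (L θ))) : Continuous L := by
  rw [continuous_iff_continuousAt]
  intro θ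
  rw [ContinuousAt, (closed_nhds_basis (L θ)).tendsto_right_iff]
  rintro s ⟨hs, hsc⟩
  obtain ⟨U, hU, V, hV, hUV⟩ := mem_prod_iff.1 (h θ hs)
  filter_upwards [eventually_mem_nhds_iff.2 hU] with t ht
  refine hsc.mem_of_tendsto (h t) ?_
  filter_upwards [prod_mem_prod ht hV] with p hp using hUV hp

theorem MemDom.comb (ha : a < 0) (hb : 0 < b) {f g : C(Glued a b, ℝ)} (hf : MemDom lam f)
    (hg : MemDom lam g) (c : ℝ) : MemDom lam (c • f + g) where
  diff_v θ y hy := ⟨_, hf.has_v_comb hg c θ hy⟩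
  diff_uv θ y hy := ⟨_, hf.has_uv_comb hg c θ hy⟩
  diff_θ y hy := by
    simp only [coord_comb]
    exact (contDiff_const.mul (hf.diff_θ y hy)).add (hg.diff_θ y hy)
  cont_v := continuousOn_comb (fun θ _ hy => (hf.has_v_comb hg c θ hy).derivWrt)
    hf.cont_v hg.cont_v
  cont_uv := continuousOn_comb (fun θ _ hy => (hf.has_uv_comb hg c θ hy).derivWrt)
    hf.cont_uv hg.cont_uv
  cont_θ := continuousOn_comb (fun θ _ hy => hf.deriv_comb hg c θ hy) hf.cont_θ hg.cont_θ
  cont_θθ := continuousOn_comb (fun θ _ hy => hf.deriv2_comb hg c θ hy) hf.cont_θθ hg.cont_θθ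
  cont_expr := continuousOn_comb (fun θ _ hy => hf.expr_comb hg c θ hy)
    hf.cont_expr hg.cont_expr
  glue := by
    obtain ⟨Lm, Lp, h1, h2, h3⟩ := hf.glue
    obtain ⟨Mm, Mp, k1, k2, k3⟩ := hg.glue
    refine ⟨fun θ => c * Lm θ + Mm θ, fun θ => c * Lp θ + Mp θ, fun θ => ?_, fun θ => ?_, ?_⟩
    · exact tendsto_comb (nhdsWithin_mono _ (fun _ h => ne_of_lt h) (inner_zero ha hb))
        (fun θ _ hy => hf.u_comb hg c θ hy) (h1 θ) (k1 θ)
    · exact tendsto_comb (nhdsWithin_mono _ (fun _ h => ne_of_gt h) (inner_zero ha hb))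
        (fun θ _ hy => hf.u_comb hg c θ hy) (h2 θ) (k2 θ)
    · have i1 := (continuous_lim h1).intervalIntegrable (μ := MeasureTheory.volume) 0 (2 * Real.pi)
      have i2 := (continuous_lim h2).intervalIntegrable (μ := MeasureTheory.volume) 0 (2 * Real.pi)
      have j1 := (continuous_lim k1).intervalIntegrable (μ := MeasureTheory.volume) 0 (2 * Real.pi)
      have j2 := (continuous_lim k2).intervalIntegrable (μ := MeasureTheory.volume) 0 (2 * Real.pi)
      rw [intervalIntegral.integral_add (i1.const_mul c) j1,
        intervalIntegral.integral_add (i2.const_mul c) j2,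
        intervalIntegral.integral_const_mul, intervalIntegral.integral_const_mul, h3, k3]
  lim_zero := by
    obtain ⟨l, hl⟩ := hf.lim_zero
    obtain ⟨m, hm⟩ := hg.lim_zero
    exact ⟨c * l + m, fun θ => tendsto_comb (inner_zero ha hb)
      (fun θ _ hy => hf.expr_comb hg c θ hy) (hl θ) (hm θ)⟩
  lim_left θ := by
    simpa using tendsto_comb (inner_left ha hb)
      (fun θ _ hy => hf.expr_comb hg c θ hy) (hf.lim_left θ) (hg.lim_left θ)
  lim_right θ := by
    simpa using tendsto_comb (inner_right ha hb)
      (fun θ _ hy => hf.expr_comb hg c θ hy) (hf.lim_right θ) (hg.lim_right θ)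

theorem memDom_zero : MemDom lam (0 : C(Glued a b, ℝ)) := by
  have h0 : ∀ θ y, coord (0 : C(Glued a b, ℝ)) θ y = 0 := fun θ y => by simp [coord]
  have h1 : ∀ θ, coord (0 : C(Glued a b, ℝ)) θ = fun _ => 0 := fun θ => funext (h0 θ)
  have d : ∀ (w : ℝ → ℝ) y, HasDerivWrt w (fun _ => 0) 0 y := fun w y => by
    simp [HasDerivWrt]
  have d' : ∀ w : ℝ → ℝ, derivWrt w (fun _ => 0) = fun _ => 0 := fun w =>
    funext fun y => (d w y).derivWrt
  have e : ∀ θ y, expr lam (0 : C(Glued a b, ℝ)) θ y = 0 := fun θ y => by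
    simp [expr, h1, h0, d']
  constructor
  · intro θ y _; rw [h1]; exact ⟨0, d _ _⟩
  · intro θ y _; rw [h1, d']; exact ⟨0, d _ _⟩
  · intro y _; simp only [h0]; exact contDiff_const
  · simp only [h1, d']; exact continuousOn_const
  · simp only [h1, d']; exact continuousOn_const
  · simp only [h0, deriv_const]; exact continuousOn_const
  · simp only [h0, iteratedDeriv_const]; exact continuousOn_const
  · simp only [e]; exact continuousOn_const
  · refine ⟨fun _ => 0, fun _ => 0, fun θ => ?_, fun θ => ?_, rfl⟩ <;>
      (simp only [h1, d']; exact tendsto_const_nhds)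
  · refine ⟨0, fun θ => ?_⟩
    simp only [e]; exact tendsto_const_nhds
  · intro θ; simp only [e]; exact tendsto_const_nhds
  · intro θ; simp only [e]; exact tendsto_const_nhds

/-- The domain is a linear subspace. -/
def dom (lam : ℝ → ℝ) (ha : a < 0) (hb : 0 < b) : Submodule ℝ C(Glued a b, ℝ) where
  carrier := {f | MemDom lam f}
  zero_mem' := memDom_zero
  add_mem' {f g} hf hg := by simpa using MemDom.comb ha hb hf hg 1
  smul_mem' c f hf := by simpa using MemDom.comb ha hb hf memDom_zero c

/-! ### The operator -/

theorem expr_periodic (f : C(Glued a b, ℝ)) (θ y : ℝ) (n : ℤ) :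
    expr lam f (θ + n * (2 * Real.pi)) y = expr lam f θ y := by
  have h1 : coord f (θ + n * (2 * Real.pi)) = coord f θ :=
    funext fun y => (coord_periodic f y).int_mul n θ
  have h2 : iteratedDeriv 2 (fun t => coord f t y) (θ + n * (2 * Real.pi))
      = iteratedDeriv 2 (fun t => coord f t y) θ := by
    have h := congrFun (iteratedDeriv_comp_add_const 2 (fun t => coord f t y)
      (n * (2 * Real.pi))) θ
    rw [← h]
    congr 1
    exact funext fun t => (coord_periodic f y).int_mul n t
  simp only [expr, h1, h2]

theorem isQuotientMap_pt :
    IsQuotientMap (fun p : ℝ × Icc a b => (pt p.1 p.2 : Glued a b)) := by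
  have h1 : IsOpenQuotientMap (fun t : ℝ => (t : AddCircle (2 * Real.pi))) :=
    QuotientAddGroup.isOpenQuotientMap_mk
  have h2 := (h1.prodMap (IsOpenQuotientMap.id (X := Icc a b))).isQuotientMap
  exact (isQuotientMap_quotient_mk' (s := glueSetoid a b)).comp h2

/-- A continuous function on the glued cylinder is determined by its values at heights in
`Inner a b`. -/
theorem ext_inner (ha : a < 0) (hb : 0 < b) {g h : C(Glued a b, ℝ)}
    (e : ∀ θ, ∀ y ∈ Inner a b, coord g θ y = coord h θ y) : g = h := by
  have hc : ∀ (k : C(Glued a b, ℝ)) θ, ContinuousOn (coord k θ) (Icc a b) := by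
    intro k θ
    rw [continuousOn_iff_continuous_domRestrict]
    have e : (Icc a b).domRestrict (coord k θ) = fun y : Icc a b => k (pt θ y) :=
      funext fun y => dif_pos y.2
    rw [e]
    exact k.continuous.comp (isQuotientMap_pt.continuous.comp (Continuous.prodMk_right θ))
  have key : ∀ θ, ∀ y ∈ Icc a b, coord g θ y = coord h θ y := by
    intro θ y hy
    have lim : ∀ φ : Filter ℝ, φ.NeBot → φ ≤ 𝓝 y → Inner a b ∈ φ →
        coord g θ y = coord h θ y := by
      intro φ _ hle hφ
      have hle' : φ ≤ 𝓝[Icc a b] y := le_inf hle (le_principal_iff.2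
        (mem_of_superset hφ fun z hz => Ioo_subset_Icc_self hz.1))
      refine tendsto_nhds_unique ((hc g θ y hy).mono_left hle')
        (((hc h θ y hy).mono_left hle').congr' ?_)
      filter_upwards [hφ] with z hz using (e θ z hz).symm
    rcases eq_or_ne y 0 with rfl | h0
    · exact lim (𝓝[≠] 0) inferInstance nhdsWithin_le_nhds (inner_zero ha hb)
    rcases eq_or_ne y a with rfl | h1
    · exact lim (𝓝[>] y) inferInstance nhdsWithin_le_nhds (inner_left ha hb)
    rcases eq_or_ne y b with rfl | h2
    · exact lim (𝓝[<] y) inferInstance nhdsWithin_le_nhds (inner_right ha hb)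
    · exact e θ y ⟨⟨lt_of_le_of_ne hy.1 h1.symm, lt_of_le_of_ne hy.2 h2⟩, h0⟩
  ext x
  obtain ⟨⟨θ, y⟩, rfl⟩ := isQuotientMap_pt.surjective x
  have := key θ y y.2
  simpa [coord, y.2.1, y.2.2] using this

theorem continuousWithinAt_ext {H F : ℝ × ℝ → ℝ} {θ y L : ℝ} {φ : Filter ℝ}
    (hφ : Inner a b ∈ φ) (hle : 𝓝[Icc a b] y ≤ pure y ⊔ φ)
    (e : ∀ θ, ∀ z ∈ Inner a b, H (θ, z) = F (θ, z)) (hy : ∀ t, H (t, y) = L)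
    (hF : Tendsto F (𝓝 θ ×ˢ φ) (𝓝 L)) :
    ContinuousWithinAt H (univ ×ˢ Icc a b) (θ, y) := by
  rw [ContinuousWithinAt, nhdsWithin_prod_eq, nhdsWithin_univ, hy θ]
  refine Tendsto.mono_left ?_ (prod_mono_right _ hle)
  rw [prod_sup]
  refine Tendsto.sup ?_ ?_
  · rw [prod_pure, tendsto_map'_iff]
    exact tendsto_const_nhds.congr fun t => (hy t).symm
  · refine hF.congr' ?_
    filter_upwards [prod_mem_prod univ_mem hφ] with p hp using (e p.1 p.2 hp.2).symm

/-- For `f` in the domain, the differential expression extends to a continuous function on the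
glued cylinder. -/
theorem exists_ext (ha : a < 0) (hb : 0 < b) {f : C(Glued a b, ℝ)} (hf : MemDom lam f) :
    ∃ g : C(Glued a b, ℝ), ∀ θ, ∀ y ∈ Inner a b, coord g θ y = expr lam f θ y := by
  classical
  obtain ⟨l, hl⟩ := hf.lim_zero
  let H : ℝ × ℝ → ℝ := fun p =>
    if p.2 = 0 then l else if p.2 ∈ Inner a b then expr lam f p.1 p.2 else 0
  have e : ∀ θ, ∀ z ∈ Inner a b, H (θ, z) = expr lam f θ z := fun θ z hz => by
    have : z ≠ 0 := hz.2
    simp only [H, if_neg this, if_pos hz]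
  have hcont : ContinuousOn H (univ ×ˢ Icc a b) := by
    rintro ⟨θ, y⟩ ⟨-, hy⟩
    rcases eq_or_ne y 0 with rfl | h0
    · refine continuousWithinAt_ext (inner_zero ha hb) ?_ e (fun t => by simp [H]) (hl θ)
      rw [pure_sup_nhdsNE]
      exact nhdsWithin_le_nhds
    rcases eq_or_ne y a with rfl | h1
    · refine continuousWithinAt_ext (inner_left ha hb) ?_ e
        (fun t => by simp [H, h0, Inner]) (hf.lim_left θ)
      rw [← nhdsWithin_insert]
      exact nhdsWithin_mono _ fun z hz => hz.1.eq_or_lt.imp Eq.symm id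
    rcases eq_or_ne y b with rfl | h2
    · refine continuousWithinAt_ext (inner_right ha hb) ?_ e
        (fun t => by simp [H, h0, Inner]) (hf.lim_right θ)
      rw [← nhdsWithin_insert]
      exact nhdsWithin_mono _ fun z hz => hz.2.eq_or_lt
    · have hy' : y ∈ Inner a b :=
        ⟨⟨lt_of_le_of_ne hy.1 h1.symm, lt_of_le_of_ne hy.2 h2⟩, h0⟩
      have ho : (univ ×ˢ Inner a b : Set (ℝ × ℝ)) ∈ 𝓝 (θ, y) :=
        (isOpen_univ.prod isOpen_inner).mem_nhds ⟨mem_univ _, hy'⟩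
      refine ContinuousAt.continuousWithinAt ?_
      refine (hf.cont_expr.continuousAt ho).congr ?_
      filter_upwards [ho] with p hp using (e p.1 p.2 hp.2).symm
  have hK : Continuous (fun p : ℝ × Icc a b => H (p.1, p.2)) :=
    hcont.comp_continuous (by fun_prop) fun p => ⟨mem_univ _, p.2.2⟩
  have hfac : Function.FactorsThrough (fun p : ℝ × Icc a b => H (p.1, p.2))
      (fun p : ℝ × Icc a b => (pt p.1 p.2 : Glued a b)) := by
    rintro ⟨θ, y⟩ ⟨θ', y'⟩ h
    rcases (Quotient.exact h : (glueSetoid a b).r _ _) with h | h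
    · obtain ⟨h1, rfl⟩ := Prod.mk.inj h
      obtain ⟨n, hn⟩ := QuotientAddGroup.eq.1 h1
      have hn' : θ' = θ + n * (2 * Real.pi) := by
        simp only [zsmul_eq_mul] at hn
        linarith
      simp only [H, hn', expr_periodic]
    · have h1 : (y : ℝ) = 0 := h.1
      have h2 : (y' : ℝ) = 0 := h.2
      simp only [H, h1, h2, if_true]
  let P : C(ℝ × Icc a b, Glued a b) := ⟨_, isQuotientMap_pt.continuous⟩
  have hP : IsQuotientMap P := isQuotientMap_pt
  refine ⟨hP.lift ⟨_, hK⟩ hfac, fun θ y hy => ?_⟩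
  have hy' : y ∈ Icc a b := Ioo_subset_Icc_self hy.1
  rw [← e θ y hy, coord, dif_pos hy']
  exact congrArg (fun k : C(ℝ × Icc a b, ℝ) => k (θ, ⟨y, hy'⟩))
    (hP.lift_comp ⟨_, hK⟩ hfac)

/-- `A f`: the differential expression for `a < y < b`, `y ≠ 0`, extended by its limits to
`y = a`, `y = 0`, `y = b`; that is, the unique continuous function on the glued cylinder that
agrees with the expression where the latter is defined. -/
def ext (ha : a < 0) (hb : 0 < b) {f : C(Glued a b, ℝ)} (hf : MemDom lam f) : C(Glued a b, ℝ) :=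
  (exists_ext ha hb hf).choose

theorem coord_ext (ha : a < 0) (hb : 0 < b) {f : C(Glued a b, ℝ)} (hf : MemDom lam f) (θ : ℝ)
    {y : ℝ} (hy : y ∈ Inner a b) : coord (ext ha hb hf) θ y = expr lam f θ y :=
  (exists_ext ha hb hf).choose_spec θ y hy

theorem ext_comb (ha : a < 0) (hb : 0 < b) {f g k : C(Glued a b, ℝ)} (hf : MemDom lam f)
    (hg : MemDom lam g) (hk : MemDom lam k) (c : ℝ) (h : k = c • f + g) :
    ext ha hb hk = c • ext ha hb hf + ext ha hb hg := by
  subst h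
  refine ext_inner ha hb fun θ y hy => ?_
  rw [coord_comb, coord_ext _ _ _ _ hy, coord_ext _ _ _ _ hy, coord_ext _ _ _ _ hy,
    hf.expr_comb hg c θ hy]

theorem ext_zero (ha : a < 0) (hb : 0 < b) :
    ext ha hb (memDom_zero (lam := lam)) = 0 := by
  simpa using ext_comb ha hb (memDom_zero (lam := lam)) memDom_zero memDom_zero 1 (by simp)

/-- The operator `A` with its domain. -/
def opA (lam : ℝ → ℝ) (ha : a < 0) (hb : 0 < b) : C(Glued a b, ℝ) →ₗ.[ℝ] C(Glued a b, ℝ) where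
  domain := dom lam ha hb
  toFun :=
    { toFun := fun f => ext ha hb (f := f.1) f.2
      map_add' := fun f g => by
        simpa using ext_comb ha hb f.2 g.2 (f + g).2 1 (by simp)
      map_smul' := fun c f => by
        simpa [ext_zero] using ext_comb ha hb f.2 memDom_zero (c • f).2 c (by simp) }

/-! ### Markov semigroups -/

/-- A Markov (Feller) semigroup on `C(X)`, `X` compact: a strongly continuous one-parameter
semigroup of positive bounded operators that fix the constant function `1`. -/
structure IsMarkovSemigroup {X : Type*} [TopologicalSpace X] [CompactSpace X]
    (T : NNReal → C(X, ℝ) →L[ℝ] C(X, ℝ)) : Prop where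
  zero : T 0 = ContinuousLinearMap.id ℝ C(X, ℝ)
  add : ∀ s t, T (s + t) = (T s).comp (T t)
  strong_cont : ∀ f, Tendsto (fun t => T t f) (𝓝[>] 0) (𝓝 f)
  nonneg : ∀ t f, 0 ≤ f → 0 ≤ T t f
  one : ∀ t, T t 1 = 1

/-- `B` is the infinitesimal operator of `T`: `f ∈ D(B)` with `B f = g` iff
`(T t f - f) / t → g` in norm as `t ↓ 0`. -/
def IsInfinitesimalOperator {X : Type*} [TopologicalSpace X] [CompactSpace X]
    (T : NNReal → C(X, ℝ) →L[ℝ] C(X, ℝ)) (B : C(X, ℝ) →ₗ.[ℝ] C(X, ℝ)) : Prop :=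
  ∀ f g : C(X, ℝ), (f, g) ∈ B.graph ↔
    Tendsto (fun t : NNReal => (t : ℝ)⁻¹ • (T t f - f)) (𝓝[>] 0) (𝓝 g)

end VanishingFriction

end

/-! The proof is Hille–Yosida generation, with separation of variables for the analytic input. By
`exists_markovSemigroup`, four facts suffice: the minimum principle (`Af ≥ 0` at a global minimum of
`f`), `A1 = 0`, density of `D(A)`, and density of the range of `μ - A` for every `μ > 0`. The
minimum principle makes `A` dissipative, hence closable. The closure is then m-dissipative, and
Yosida approximation produces a contraction semigroup; positivity comes from dissipativity together
with `A1 = 0`.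

Minimum principle (`opA_min`). Away from the centre and the ends it is the second derivative test in
each variable, and at the ends `Af = 0`. At `𝔬` the term `λ̃⁻² ∂²f/∂θ²` is singular, so `f` is
averaged over the circle. Periodicity kills the angular term, the gluing condition makes the
`u`-derivative of the average agree from both sides, and `Af(𝔬) < 0` would make the average strictly
concave in `u` near `0`, so that it drops below its value at `0`.

Density and range. Consider the modes `H(ũ(y)) cos(kθ + φ)` with `H` of class `C²`, and with `H = 0`
near `0` if `k ≠ 0`. Their span is an algebra that separates points, hence dense by
Stone–Weierstrass. Each mode becomes an element of `D(A)` after an arbitrarily small correction near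
the two ends. Each mode is also exactly in the range of `μ - A`, because the resolvent equation
reduces to an ordinary differential equation for the profile. For `k = 0` this equation has constant
coefficients in `ũ` and is solved across the centre. For `k ≠ 0` the two sides decouple: each is
solved with value `0` at the centre, and the gluing condition is automatic since `cos(kθ + φ)` has
mean zero. What has to be shown there is that the solution vanishing at the singular point has a
finite `u`-derivative at it (`exists_fundamental_system`). -/

noncomputable section

namespace VanishingFriction

/-! ### Uniformly continuous contraction semigroups `exp(tμ(J - 1))`. -/

section Poisson

variable {E : Type*} [NormedAddCommGroup E] [NormedSpace ℝ E]

/-- The semigroup generated by `μ (J - 1)`. -/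
def poisson (J : E →L[ℝ] E) (μ t : ℝ) : E →L[ℝ] E :=
  Real.exp (-(μ * t)) • NormedSpace.exp ((μ * t) • J)

variable {J K : E →L[ℝ] E} {μ ν s t : ℝ}

theorem poisson_zero : poisson J μ 0 = 1 := by simp [poisson]

theorem commute_poisson_right (h : Commute J K) : Commute (poisson J μ s) K := by
  unfold poisson
  exact ((h.smul_left _).exp_left).smul_left _

variable [CompleteSpace E]

theorem poisson_add : poisson J μ (s + t) = poisson J μ s * poisson J μ t := by
  let +nondep : NormedAlgebra ℚ (E →L[ℝ] E) := .restrictScalars ℚ ℝ _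
  unfold poisson
  rw [mul_add, neg_add, Real.exp_add, add_smul,
    NormedSpace.exp_add_of_commute (((Commute.refl J).smul_left _).smul_right _),
    smul_mul_smul_comm]

theorem hasDerivAt_poisson (t : ℝ) :
    HasDerivAt (poisson J μ) (poisson J μ t * (μ • (J - 1))) t := by
  have h1 : HasDerivAt (fun t : ℝ => Real.exp (-(μ * t))) (Real.exp (-(μ * t)) * (-μ)) t := by
    have := ((hasDerivAt_id t).const_mul μ).neg.exp
    simpa using this
  have h2 := hasDerivAt_exp_smul_const (𝕂 := ℝ) (μ • J) t
  have h3 := h1.smul h2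
  have e : poisson J μ = fun t : ℝ =>
      Real.exp (-(μ * t)) • NormedSpace.exp (t • μ • J) := by
    funext t
    rw [poisson, smul_smul, mul_comm t μ]
  rw [e]
  refine h3.congr_deriv ?_
  simp only [smul_sub, mul_sub, smul_mul_assoc, mul_smul_comm, mul_one]
  module

theorem norm_poisson_le (hJ : ‖J‖ ≤ 1) (hμ : 0 ≤ μ) (ht : 0 ≤ t) : ‖poisson J μ t‖ ≤ 1 := by
  have h0 : 0 ≤ μ * t := mul_nonneg hμ ht
  have hs := NormedSpace.exp_series_hasSum_exp' (𝕂 := ℝ) ((μ * t) • J)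
  have hr := NormedSpace.exp_series_hasSum_exp' (𝕂 := ℝ) (μ * t)
  have hb : ∀ n : ℕ, ‖((n.factorial : ℝ)⁻¹) • ((μ * t) • J) ^ n‖
      ≤ ((n.factorial : ℝ)⁻¹) • (μ * t) ^ n := by
    intro n
    rw [smul_pow, norm_smul, norm_smul, Real.norm_of_nonneg (by positivity),
      Real.norm_of_nonneg (by positivity), smul_eq_mul]
    have : ‖J ^ n‖ ≤ 1 := by
      rcases Nat.eq_zero_or_pos n with rfl | hn
      · rw [pow_zero]; exact ContinuousLinearMap.norm_id_le
      · exact (norm_pow_le' J hn).trans (pow_le_one₀ (norm_nonneg _) hJ)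
    have h1 : (μ * t) ^ n * ‖J ^ n‖ ≤ (μ * t) ^ n := mul_le_of_le_one_right (by positivity) this
    gcongr
  have h1 := tsum_of_norm_bounded hr hb
  rw [hs.tsum_eq, ← Real.exp_eq_exp_ℝ] at h1
  unfold poisson
  rw [norm_smul, Real.norm_of_nonneg (Real.exp_pos _).le]
  calc _ ≤ Real.exp (-(μ * t)) * Real.exp (μ * t) := by gcongr
    _ = 1 := by rw [← Real.exp_add]; simp

/-- The exponential series has nonnegative coefficients, so its partial sums preserve any convex
cone that `J` preserves; closedness passes this to the limit. -/
theorem poisson_mem {C : Set E} (hC : _root_.IsClosed C) (h0 : (0 : E) ∈ C)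
    (hadd : ∀ f ∈ C, ∀ g ∈ C, f + g ∈ C) (hsmul : ∀ c : ℝ, 0 ≤ c → ∀ f ∈ C, c • f ∈ C)
    (hJ : ∀ f ∈ C, J f ∈ C) (hμ : 0 ≤ μ) (ht : 0 ≤ t) {f : E} (hf : f ∈ C) :
    poisson J μ t f ∈ C := by
  have h := NormedSpace.exp_series_hasSum_exp' (𝕂 := ℝ) ((μ * t) • J)
  have h' := (ContinuousLinearMap.apply ℝ E f).hasSum h
  unfold poisson
  refine hsmul _ (Real.exp_pos _).le _ (hC.mem_of_tendsto h' (Eventually.of_forall fun s => ?_))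
  have hp : ∀ n : ℕ, (J ^ n) f ∈ C := by
    intro n
    induction n with
    | zero => simpa using hf
    | succ n ih => rw [pow_succ']; exact hJ _ ih
  refine Finset.sum_induction _ (· ∈ C) (fun a b ha hb => hadd a ha b hb) h0 fun n _ => ?_
  simp only [ContinuousLinearMap.apply_apply, smul_pow]
  exact hsmul _ (by positivity) _ (hsmul _ (by positivity) _ (hp n))

/-- Interpolation between the two semigroups along `s ↦ exp((t-s)ν(K-1)) exp(sμ(J-1)) f`: since
everything commutes, its derivative is a contraction applied to the difference of the generators at
`f`. -/
theorem norm_poisson_sub_le (h : Commute J K) (hJ : ‖J‖ ≤ 1) (hK : ‖K‖ ≤ 1) (hμ : 0 ≤ μ)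
    (hν : 0 ≤ ν) (ht : 0 ≤ t) (f : E) :
    ‖poisson J μ t f - poisson K ν t f‖ ≤ t * ‖μ • (J f - f) - ν • (K f - f)‖ := by
  set D : E := μ • (J f - f) - ν • (K f - f) with hD
  have hd : ∀ s ∈ Icc 0 t, HasDerivWithinAt
      (fun s => (poisson K ν (t - s) * poisson J μ s) f)
      ((poisson K ν (t - s) * poisson J μ s) D) (Icc 0 t) s := by
    intro s _
    have h1 := hasDerivAt_poisson (J := J) (μ := μ) s
    have h2 : HasDerivAt (fun s => poisson K ν (t - s))
        (-(poisson K ν (t - s) * (ν • (K - 1)))) s := by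
      have := (hasDerivAt_poisson (J := K) (μ := ν) (t - s)).scomp s
        ((hasDerivAt_id s).const_sub t)
      exact this.congr_deriv (by simp)
    have h3 := (h2.mul h1).hasDerivWithinAt (s := Icc 0 t)
    have h4 := (ContinuousLinearMap.apply ℝ E f).hasFDerivAt.comp_hasDerivWithinAt s h3
    refine h4.congr_deriv ?_
    have c1 : Commute (poisson J μ s) (ν • (K - 1)) :=
      ((commute_poisson_right h).sub_right (Commute.one_right _)).smul_right _
    have c2 : -(poisson K ν (t - s) * (ν • (K - 1))) * poisson J μ s
        + poisson K ν (t - s) * (poisson J μ s * (μ • (J - 1)))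
        = poisson K ν (t - s) * poisson J μ s * (μ • (J - 1) - ν • (K - 1)) := by
      rw [neg_mul, mul_assoc, ← c1.eq]
      noncomm_ring
    rw [c2]
    rfl
  have hb : ∀ s ∈ Ico 0 t, ‖(poisson K ν (t - s) * poisson J μ s) D‖ ≤ ‖D‖ := by
    intro s hs
    have h1 := norm_poisson_le (t := s) hJ hμ hs.1
    have h2 := norm_poisson_le (t := t - s) hK hν (sub_nonneg.2 hs.2.le)
    calc _ ≤ ‖poisson K ν (t - s)‖ * (‖poisson J μ s‖ * ‖D‖) :=
          (ContinuousLinearMap.le_opNorm _ _).trans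
            (mul_le_mul_of_nonneg_left (ContinuousLinearMap.le_opNorm _ _) (norm_nonneg _))
      _ ≤ 1 * (1 * ‖D‖) := by gcongr
      _ = ‖D‖ := by ring
  have := norm_image_sub_le_of_norm_deriv_le_segment' hd hb t (right_mem_Icc.2 ht)
  simp only [sub_self, sub_zero, poisson_zero, mul_one, one_mul] at this
  rw [mul_comm]
  exact this

theorem norm_poisson_sub_self_le (hJ : ‖J‖ ≤ 1) (hμ : 0 ≤ μ) (ht : 0 ≤ t) (f : E) :
    ‖poisson J μ t f - f‖ ≤ t * ‖μ • (J f - f)‖ := by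
  -- With `K = 0` and rate `ν = 0` the comparison semigroup is the identity.
  have h := norm_poisson_sub_le (J := J) (K := 0) (μ := μ) (ν := 0) (Commute.zero_right J) hJ
    (by simp) hμ le_rfl ht f
  simpa [poisson] using h

theorem norm_poisson_taylor_le (ht : 0 ≤ t) {f : E} {C : ℝ}
    (hC : ∀ s ∈ Icc 0 t, ‖poisson J μ s (μ • (J f - f)) - μ • (J f - f)‖ ≤ C) :
    ‖poisson J μ t f - f - t • μ • (J f - f)‖ ≤ t * C := by
  have hd : ∀ s ∈ Icc 0 t, HasDerivWithinAt (fun s => poisson J μ s f - s • μ • (J f - f))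
      (poisson J μ s (μ • (J f - f)) - μ • (J f - f)) (Icc 0 t) s := by
    intro s _
    have h1 := (ContinuousLinearMap.apply ℝ E f).hasFDerivAt.comp_hasDerivAt s
      (hasDerivAt_poisson (J := J) (μ := μ) s)
    have h2 := (hasDerivAt_id s).smul_const (μ • (J f - f))
    refine ((h1.sub h2).congr_deriv ?_).hasDerivWithinAt
    simp
  have := norm_image_sub_le_of_norm_deriv_le_segment' hd (fun s hs => hC s ⟨hs.1, hs.2.le⟩) t
    (right_mem_Icc.2 ht)
  simp only [poisson_zero, sub_zero, zero_smul] at this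
  rw [mul_comm]
  convert this using 2
  simp only [one_apply_eq_self]
  abel

end Poisson

/-! ### The Hille–Yosida construction for m-dissipative operators given by their graphs. -/

section HilleYosida

variable {E : Type*} [NormedAddCommGroup E] [NormedSpace ℝ E]

/-- The graph of a densely defined closed dissipative operator `B` for which all `μ - B`, `μ > 0`,
are onto. -/
structure IsMDissipative (Γ : Submodule ℝ (E × E)) : Prop where
  isClosed : _root_.IsClosed (Γ : Set (E × E))
  dissip : ∀ p ∈ Γ, ∀ μ : ℝ, 0 < μ → μ * ‖p.1‖ ≤ ‖μ • p.1 - p.2‖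
  dense : Dense (Prod.fst '' (Γ : Set (E × E)))
  surj : ∀ μ : ℝ, 0 < μ → ∀ h : E, ∃ p ∈ Γ, μ • p.1 - p.2 = h

variable {Γ : Submodule ℝ (E × E)}

theorem IsMDissipative.inj (hΓ : IsMDissipative Γ) {μ : ℝ} (hμ : 0 < μ) {p q : E × E}
    (hp : p ∈ Γ) (hq : q ∈ Γ) (h : μ • p.1 - p.2 = μ • q.1 - q.2) : p.1 = q.1 := by
  have h1 := hΓ.dissip (p - q) (Γ.sub_mem hp hq) μ hμ
  have h2 : μ • (p - q).1 - (p - q).2 = 0 := by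
    simp only [Prod.fst_sub, Prod.snd_sub, smul_sub]
    rw [sub_sub_sub_comm, h, sub_self]
  rw [h2, norm_zero] at h1
  have h3 : ‖(p - q).1‖ ≤ 0 := by
    by_contra! h
    exact absurd (mul_pos hμ h) (not_lt.2 h1)
  exact sub_eq_zero.1 (norm_le_zero_iff.1 h3)

/-- The operator `μ (μ - B)⁻¹`. -/
theorem IsMDissipative.exists_resolvent (hΓ : IsMDissipative Γ) {μ : ℝ} (hμ : 0 < μ) :
    ∃ J : E →L[ℝ] E, ‖J‖ ≤ 1 ∧ (∀ h, (J h, μ • (J h - h)) ∈ Γ) ∧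
      ∀ p ∈ Γ, J p.1 - p.1 = μ⁻¹ • J p.2 := by
  choose q hq hqe using hΓ.surj μ hμ
  have huniq : ∀ p ∈ Γ, (q (μ • p.1 - p.2)).1 = p.1 := fun p hp =>
    hΓ.inj hμ (hq _) hp (hqe _)
  have hsnd : ∀ h, (q h).2 = μ • (q h).1 - h := fun h => by
    nth_rw 3 [← hqe h]; abel
  let R : E →ₗ[ℝ] E :=
    { toFun := fun h => (q h).1
      map_add' := fun g h => by
        have := huniq (q g + q h) (Γ.add_mem (hq g) (hq h))
        rw [show μ • (q g + q h).1 - (q g + q h).2 = g + h by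
          simp only [Prod.fst_add, Prod.snd_add, hsnd, smul_add]; abel] at this
        exact this
      map_smul' := fun c h => by
        have := huniq (c • q h) (Γ.smul_mem c (hq h))
        rw [show μ • (c • q h).1 - (c • q h).2 = c • h by
          simp only [Prod.smul_fst, Prod.smul_snd, hsnd, smul_sub, smul_comm c μ]; abel] at this
        exact this }
  have hR : ∀ h, ‖(μ • R) h‖ ≤ 1 * ‖h‖ := fun h => by
    have := hΓ.dissip (q h) (hq h) μ hμ
    rw [hqe] at this
    rw [LinearMap.smul_apply, norm_smul, Real.norm_of_nonneg hμ.le, one_mul]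
    exact this
  refine ⟨(μ • R).mkContinuous 1 hR, LinearMap.mkContinuous_norm_le _ zero_le_one _,
    fun h => ?_, fun p hp => ?_⟩
  · have : ((μ • R).mkContinuous 1 hR h, μ • ((μ • R).mkContinuous 1 hR h - h)) = μ • q h := by
      ext
      · rfl
      · change μ • (μ • (q h).1 - h) = μ • (q h).2
        rw [hsnd]
    rw [this]
    exact Γ.smul_mem _ (hq h)
  · have h1 : R (μ • p.1 - p.2) = p.1 := huniq p hp
    change μ • R p.1 - p.1 = μ⁻¹ • μ • R p.2
    rw [inv_smul_smul₀ hμ.ne', sub_eq_iff_eq_add, ← sub_eq_iff_eq_add', ← map_smul, ← map_sub, h1]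

/-- The operators `μ (μ - B)⁻¹` for `μ = n + 1`. -/
def yosida (hΓ : IsMDissipative Γ) (n : ℕ) : E →L[ℝ] E :=
  (hΓ.exists_resolvent (n.cast_add_one_pos (α := ℝ))).choose

variable (hΓ : IsMDissipative Γ)

theorem norm_yosida_le (n : ℕ) : ‖yosida hΓ n‖ ≤ 1 :=
  (hΓ.exists_resolvent (n.cast_add_one_pos (α := ℝ))).choose_spec.1

theorem yosida_mem (n : ℕ) (h : E) :
    (yosida hΓ n h, ((n : ℝ) + 1) • (yosida hΓ n h - h)) ∈ Γ :=
  (hΓ.exists_resolvent (n.cast_add_one_pos (α := ℝ))).choose_spec.2.1 h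

theorem yosida_sub (n : ℕ) {p : E × E} (hp : p ∈ Γ) :
    yosida hΓ n p.1 - p.1 = ((n : ℝ) + 1)⁻¹ • yosida hΓ n p.2 :=
  (hΓ.exists_resolvent (n.cast_add_one_pos (α := ℝ))).choose_spec.2.2 p hp

theorem smul_yosida_sub (n : ℕ) {p : E × E} (hp : p ∈ Γ) :
    ((n : ℝ) + 1) • (yosida hΓ n p.1 - p.1) = yosida hΓ n p.2 := by
  rw [yosida_sub hΓ n hp, smul_inv_smul₀ (n.cast_add_one_pos (α := ℝ)).ne']

theorem norm_yosida_apply_le (n : ℕ) (f : E) : ‖yosida hΓ n f‖ ≤ ‖f‖ := by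
  simpa using ContinuousLinearMap.le_of_opNorm_le _ (norm_yosida_le hΓ n) f

theorem yosida_maps (n : ℕ) {p : E × E} (hp : p ∈ Γ) :
    (yosida hΓ n p.1, yosida hΓ n p.2) ∈ Γ := by
  have := yosida_mem hΓ n p.1
  rwa [smul_yosida_sub hΓ n hp] at this

/-- Resolvents preserve the graph, so both products applied to `h` are first components of graph
elements with the same image under `n + 1 - B`; dissipativity makes such an element unique. -/
theorem commute_yosida (m n : ℕ) : Commute (yosida hΓ m) (yosida hΓ n) := by
  ext h
  have hμ := n.cast_add_one_pos (α := ℝ)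
  have h1 := yosida_maps hΓ m (yosida_mem hΓ n h)
  have h2 := yosida_mem hΓ n (yosida hΓ m h)
  refine hΓ.inj hμ h1 h2 ?_
  simp only [map_smul, map_sub, smul_sub]
  abel

theorem tendsto_of_dense {F : ℕ → E →L[ℝ] E} (hF : ∀ n f, ‖F n f‖ ≤ ‖f‖) {S : Set E}
    (hS : Dense S) (h : ∀ f ∈ S, Tendsto (fun n => F n f) atTop (𝓝 f)) (f : E) :
    Tendsto (fun n => F n f) atTop (𝓝 f) := by
  rw [Metric.tendsto_atTop]
  intro ε hε
  obtain ⟨g, hg, hfg⟩ := Metric.mem_closure_iff.1 (hS f) (ε / 3) (by positivity)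
  obtain ⟨N, hN⟩ := Metric.tendsto_atTop.1 (h g hg) (ε / 3) (by positivity)
  refine ⟨N, fun n hn => ?_⟩
  have h1 := hN n hn
  have h2 := hF n (f - g)
  rw [dist_eq_norm] at *
  calc ‖F n f - f‖ = ‖F n (f - g) + (F n g - g) - (f - g)‖ := by
        rw [map_sub]; congr 1; abel
    _ ≤ ‖F n (f - g)‖ + ‖F n g - g‖ + ‖f - g‖ :=
        (norm_sub_le _ _).trans (add_le_add_left (norm_add_le _ _) _)
    _ < ε := by linarith

theorem tendsto_yosida (f : E) : Tendsto (fun n => yosida hΓ n f) atTop (𝓝 f) := by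
  refine tendsto_of_dense (norm_yosida_apply_le hΓ) hΓ.dense ?_ f
  rintro f ⟨p, hp, rfl⟩
  rw [tendsto_iff_norm_sub_tendsto_zero]
  have h0 : Tendsto (fun n : ℕ => (1 / ((n : ℝ) + 1)) * ‖p.2‖) atTop (𝓝 0) := by
    simpa using tendsto_one_div_add_atTop_nhds_zero_nat.mul_const ‖p.2‖
  refine squeeze_zero (fun _ => norm_nonneg _) (fun n => ?_) h0
  rw [yosida_sub hΓ n hp, norm_smul, one_div,
    Real.norm_of_nonneg (inv_nonneg.2 (n.cast_add_one_pos (α := ℝ)).le)]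
  gcongr
  exact norm_yosida_apply_le hΓ n _

variable [CompleteSpace E]

/-- The approximating semigroups. -/
def approx (n : ℕ) (t : ℝ) : E →L[ℝ] E := poisson (yosida hΓ n) ((n : ℝ) + 1) t

variable {t : ℝ}

theorem norm_approx_apply_le (ht : 0 ≤ t) (n : ℕ) (f : E) : ‖approx hΓ n t f‖ ≤ ‖f‖ := by
  have := ContinuousLinearMap.le_of_opNorm_le _
    (norm_poisson_le (norm_yosida_le hΓ n) (n.cast_add_one_pos (α := ℝ)).le ht) f
  rwa [one_mul] at this

/-- On the domain, `norm_poisson_sub_le` bounds the difference of two approximations by `t ‖J_m Bf -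
J_n Bf‖`, where `J_n f → f`; contractivity extends the Cauchy property to all vectors. -/
theorem cauchySeq_approx (ht : 0 ≤ t) (f : E) : CauchySeq (fun n => approx hΓ n t f) := by
  rw [Metric.cauchySeq_iff]
  intro ε hε
  obtain ⟨_, ⟨p, hp, rfl⟩, hfg⟩ := Metric.mem_closure_iff.1 (hΓ.dense f) (ε / 4) (by positivity)
  obtain ⟨N, hN⟩ := Metric.cauchySeq_iff.1 (tendsto_yosida hΓ p.2).cauchySeq
    (ε / (4 * (t + 1))) (by positivity)
  refine ⟨N, fun m hm n hn => ?_⟩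
  have h1 := norm_poisson_sub_le (commute_yosida hΓ m n) (norm_yosida_le hΓ m)
    (norm_yosida_le hΓ n) (m.cast_add_one_pos (α := ℝ)).le (n.cast_add_one_pos (α := ℝ)).le ht p.1
  rw [smul_yosida_sub hΓ m hp, smul_yosida_sub hΓ n hp] at h1
  have h2 := hN m hm n hn
  rw [dist_eq_norm] at h2 hfg ⊢
  have h3 : t * ‖yosida hΓ m p.2 - yosida hΓ n p.2‖ ≤ ε / 4 := by
    calc _ ≤ (t + 1) * (ε / (4 * (t + 1))) := by gcongr; linarith
      _ = ε / 4 := by field_simp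
  have h4 := norm_approx_apply_le hΓ ht m (f - p.1)
  have h5 := norm_approx_apply_le hΓ ht n (f - p.1)
  calc ‖approx hΓ m t f - approx hΓ n t f‖
      = ‖approx hΓ m t (f - p.1) + (approx hΓ m t p.1 - approx hΓ n t p.1)
          - approx hΓ n t (f - p.1)‖ := by
        rw [map_sub, map_sub]; congr 1; abel
    _ ≤ ‖approx hΓ m t (f - p.1)‖ + ‖approx hΓ m t p.1 - approx hΓ n t p.1‖
          + ‖approx hΓ n t (f - p.1)‖ :=
        (norm_sub_le _ _).trans (add_le_add_left (norm_add_le _ _) _)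
    _ ≤ ε / 4 + ε / 4 + ε / 4 := by
        refine add_le_add (add_le_add (h4.trans hfg.le) (h1.trans h3)) (h5.trans hfg.le)
    _ < ε := by linarith

theorem exists_semigroup : ∃ T : NNReal → E →L[ℝ] E, ∀ (t : NNReal) (f : E),
    Tendsto (fun n => approx hΓ n t f) atTop (𝓝 (T t f)) := by
  have h : ∀ (t : NNReal) (f : E), ∃ g, Tendsto (fun n => approx hΓ n t f) atTop (𝓝 g) :=
    fun t f => cauchySeq_tendsto_of_complete (cauchySeq_approx hΓ t.2 f)
  choose T hT using h
  exact ⟨fun t => continuousLinearMapOfTendsto (fun n => approx hΓ n t)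
    (tendsto_pi_nhds.2 (hT t)), hT⟩

/-- The semigroup generated by an m-dissipative operator. -/
def semigroup (t : NNReal) : E →L[ℝ] E := (exists_semigroup hΓ).choose t

theorem tendsto_approx (t : NNReal) (f : E) :
    Tendsto (fun n => approx hΓ n t f) atTop (𝓝 (semigroup hΓ t f)) :=
  (exists_semigroup hΓ).choose_spec t f

theorem norm_semigroup_le (t : NNReal) (f : E) : ‖semigroup hΓ t f‖ ≤ ‖f‖ :=
  le_of_tendsto (tendsto_approx hΓ t f).norm
    (Eventually.of_forall fun n => norm_approx_apply_le hΓ t.2 n f)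

theorem semigroup_zero : semigroup hΓ 0 = ContinuousLinearMap.id ℝ E := by
  ext f
  refine tendsto_nhds_unique (tendsto_approx hΓ 0 f) ?_
  simp [approx, poisson_zero]

theorem semigroup_add (s t : NNReal) :
    semigroup hΓ (s + t) = (semigroup hΓ s).comp (semigroup hΓ t) := by
  ext f
  refine tendsto_nhds_unique (tendsto_approx hΓ (s + t) f) ?_
  have h1 : ∀ n, approx hΓ n (s + t : NNReal) f
      = approx hΓ n s (approx hΓ n t f - semigroup hΓ t f) + approx hΓ n s (semigroup hΓ t f) := by
    intro n
    rw [← map_add, sub_add_cancel, NNReal.coe_add, approx, poisson_add]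
    rfl
  simp only [h1]
  have h2 : Tendsto (fun n => approx hΓ n s (approx hΓ n t f - semigroup hΓ t f)) atTop (𝓝 0) := by
    have h3 := tendsto_iff_norm_sub_tendsto_zero.1 (tendsto_approx hΓ t f)
    exact squeeze_zero_norm (fun n => norm_approx_apply_le hΓ s.2 n _) h3
  simpa using h2.add (tendsto_approx hΓ s (semigroup hΓ t f))

theorem norm_semigroup_sub_le (t : NNReal) {p : E × E} (hp : p ∈ Γ) :
    ‖semigroup hΓ t p.1 - p.1‖ ≤ t * ‖p.2‖ := by
  refine le_of_tendsto ((tendsto_approx hΓ t p.1).sub_const p.1).norm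
    (Eventually.of_forall fun n => ?_)
  have := norm_poisson_sub_self_le (norm_yosida_le hΓ n) (n.cast_add_one_pos (α := ℝ)).le t.2 p.1
  rw [smul_yosida_sub hΓ n hp] at this
  exact this.trans (mul_le_mul_of_nonneg_left (norm_yosida_apply_le hΓ n _) t.2)

theorem tendsto_semigroup (f : E) : Tendsto (fun t => semigroup hΓ t f) (𝓝[>] 0) (𝓝 f) := by
  refine Tendsto.mono_left ?_ nhdsWithin_le_nhds
  rw [Metric.tendsto_nhds]
  intro ε hε
  obtain ⟨_, ⟨p, hp, rfl⟩, hfg⟩ := Metric.mem_closure_iff.1 (hΓ.dense f) (ε / 3) (by positivity)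
  have h0 : Tendsto (fun t : NNReal => (t : ℝ) * ‖p.2‖) (𝓝 0) (𝓝 0) := by
    have : Continuous fun t : NNReal => (t : ℝ) * ‖p.2‖ := by fun_prop
    simpa using this.tendsto 0
  filter_upwards [h0.eventually (gt_mem_nhds (show 0 < ε / 3 by positivity))] with t ht
  have h1 := norm_semigroup_sub_le hΓ t hp
  have h2 := norm_semigroup_le hΓ t (f - p.1)
  rw [dist_eq_norm] at *
  calc ‖semigroup hΓ t f - f‖
      = ‖semigroup hΓ t (f - p.1) + (semigroup hΓ t p.1 - p.1) - (f - p.1)‖ := by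
        rw [map_sub]; congr 1; abel
    _ ≤ ‖semigroup hΓ t (f - p.1)‖ + ‖semigroup hΓ t p.1 - p.1‖ + ‖f - p.1‖ :=
        (norm_sub_le _ _).trans (add_le_add_left (norm_add_le _ _) _)
    _ < ε := by linarith

/-- The vector `p.2 = Bp.1` need not lie in the domain, so it is compared with a domain vector
`q.1`, which the semigroup moves by at most `t ‖q.2‖`. -/
theorem norm_semigroup_taylor_le (t : NNReal) {p q : E × E} (hp : p ∈ Γ) (hq : q ∈ Γ) :
    ‖semigroup hΓ t p.1 - p.1 - (t : ℝ) • p.2‖ ≤ t * (t * ‖q.2‖ + 2 * ‖p.2 - q.1‖) := by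
  have h1 : Tendsto (fun n => ‖approx hΓ n t p.1 - p.1 - (t : ℝ) • yosida hΓ n p.2‖) atTop
      (𝓝 ‖semigroup hΓ t p.1 - p.1 - (t : ℝ) • p.2‖) :=
    (((tendsto_approx hΓ t p.1).sub_const p.1).sub
      ((tendsto_yosida hΓ p.2).const_smul (t : ℝ))).norm
  have h2 : Tendsto (fun n => (t : ℝ) * (t * ‖q.2‖ + 2 * ‖yosida hΓ n p.2 - q.1‖)) atTop
      (𝓝 (t * (t * ‖q.2‖ + 2 * ‖p.2 - q.1‖))) :=
    ((((tendsto_yosida hΓ p.2).sub_const q.1).norm.const_mul 2).const_add _).const_mul _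
  refine le_of_tendsto_of_tendsto' h1 h2 fun n => ?_
  have hμ := (n.cast_add_one_pos (α := ℝ)).le
  rw [← smul_yosida_sub hΓ n hp]
  refine norm_poisson_taylor_le t.2 fun s hs => ?_
  rw [smul_yosida_sub hΓ n hp]
  have h3 := norm_poisson_sub_self_le (norm_yosida_le hΓ n) hμ hs.1 q.1
  rw [smul_yosida_sub hΓ n hq] at h3
  have h4 := norm_approx_apply_le hΓ hs.1 n (yosida hΓ n p.2 - q.1)
  have h5 := norm_yosida_apply_le hΓ n q.2
  have h6 : s * ‖yosida hΓ n q.2‖ ≤ t * ‖q.2‖ :=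
    mul_le_mul hs.2 h5 (norm_nonneg _) t.2
  change ‖approx hΓ n s (yosida hΓ n p.2) - yosida hΓ n p.2‖ ≤ _
  change ‖approx hΓ n s q.1 - q.1‖ ≤ _ at h3
  calc ‖approx hΓ n s (yosida hΓ n p.2) - yosida hΓ n p.2‖
      = ‖approx hΓ n s (yosida hΓ n p.2 - q.1) + (approx hΓ n s q.1 - q.1)
          - (yosida hΓ n p.2 - q.1)‖ := by
        rw [map_sub]; congr 1; abel
    _ ≤ ‖approx hΓ n s (yosida hΓ n p.2 - q.1)‖ + ‖approx hΓ n s q.1 - q.1‖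
          + ‖yosida hΓ n p.2 - q.1‖ :=
        (norm_sub_le _ _).trans (add_le_add_left (norm_add_le _ _) _)
    _ ≤ _ := by linarith

theorem tendsto_generator {p : E × E} (hp : p ∈ Γ) :
    Tendsto (fun t : NNReal => (t : ℝ)⁻¹ • (semigroup hΓ t p.1 - p.1)) (𝓝[>] 0) (𝓝 p.2) := by
  rw [Metric.tendsto_nhds]
  intro ε hε
  obtain ⟨_, ⟨q, hq, rfl⟩, hpq⟩ := Metric.mem_closure_iff.1 (hΓ.dense p.2) (ε / 4) (by positivity)
  have h0 : Tendsto (fun t : NNReal => (t : ℝ) * ‖q.2‖) (𝓝[>] 0) (𝓝 0) := by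
    have : Continuous fun t : NNReal => (t : ℝ) * ‖q.2‖ := by fun_prop
    exact Tendsto.mono_left (by simpa using this.tendsto 0) nhdsWithin_le_nhds
  filter_upwards [h0.eventually (gt_mem_nhds (show 0 < ε / 2 by positivity)),
    self_mem_nhdsWithin] with t ht ht0
  have ht0' : (0 : ℝ) < t := ht0
  have h1 := norm_semigroup_taylor_le hΓ t hp hq
  rw [dist_eq_norm] at *
  have h2 : (t : ℝ)⁻¹ • (semigroup hΓ t p.1 - p.1) - p.2
      = (t : ℝ)⁻¹ • (semigroup hΓ t p.1 - p.1 - (t : ℝ) • p.2) := by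
    rw [smul_sub _ _ ((t : ℝ) • p.2), inv_smul_smul₀ ht0'.ne']
  rw [h2, norm_smul, norm_inv, Real.norm_of_nonneg ht0'.le, inv_mul_lt_iff₀ ht0']
  refine h1.trans_lt (mul_lt_mul_of_pos_left ?_ ht0')
  linarith

/-- The generator cannot properly extend `B`. Surjectivity of `1 - B` gives `p` in the graph with
`p.1 - p.2 = f - g`, so the generator sends `w = f - p.1` to `w` itself. A contraction semigroup
satisfies `‖(1 + t)w - S_t w‖ ≥ t‖w‖`, and letting `t ↓ 0` gives `w = 0`. -/
theorem mem_of_tendsto_generator {f g : E}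
    (h : Tendsto (fun t : NNReal => (t : ℝ)⁻¹ • (semigroup hΓ t f - f)) (𝓝[>] 0) (𝓝 g)) :
    (f, g) ∈ Γ := by
  obtain ⟨p, hp, he⟩ := hΓ.surj 1 one_pos (f - g)
  rw [one_smul] at he
  have h1 := h.sub (tendsto_generator hΓ hp)
  have hw : g - p.2 = f - p.1 := by
    rw [sub_eq_sub_iff_add_eq_add] at he ⊢
    rw [add_comm g, he, add_comm]
  set w := f - p.1 with hwd
  have h2 : Tendsto (fun t : NNReal => (t : ℝ)⁻¹ • (semigroup hΓ t w - w)) (𝓝[>] 0) (𝓝 w) := by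
    rw [← hw]
    refine h1.congr fun t => ?_
    rw [← smul_sub, hw, hwd, map_sub]
    congr 1
    abel
  have h3 : ‖w‖ ≤ ‖w - w‖ := by
    refine ge_of_tendsto (h2.sub_const w).norm ?_
    filter_upwards [self_mem_nhdsWithin] with t ht
    have ht' : (0 : ℝ) < t := ht
    have e : (t : ℝ)⁻¹ • (semigroup hΓ t w - w) - w
        = (t : ℝ)⁻¹ • (semigroup hΓ t w - (1 + (t : ℝ)) • w) := by
      rw [add_smul, one_smul, ← sub_sub, smul_sub _ _ ((t : ℝ) • w), inv_smul_smul₀ ht'.ne']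
    rw [e, norm_smul, norm_inv, Real.norm_of_nonneg ht'.le, le_inv_mul_iff₀ ht']
    have h4 := norm_sub_norm_le ((1 + (t : ℝ)) • w) (semigroup hΓ t w)
    rw [norm_smul, Real.norm_of_nonneg (by positivity), 
      norm_sub_rev _ (semigroup hΓ t w)] at h4
    have := norm_semigroup_le hΓ t w
    linarith
  rw [sub_self, norm_zero, norm_le_zero_iff] at h3
  have hf : f = p.1 := sub_eq_zero.1 h3
  have hg : g = p.2 := sub_eq_zero.1 (hw.trans h3)
  rw [hf, hg]
  exact hp

theorem semigroup_mem {C : Set E} (hC : _root_.IsClosed C) (h0 : (0 : E) ∈ C)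
    (hadd : ∀ f ∈ C, ∀ g ∈ C, f + g ∈ C) (hsmul : ∀ c : ℝ, 0 ≤ c → ∀ f ∈ C, c • f ∈ C)
    (hres : ∀ μ : ℝ, 0 < μ → ∀ p ∈ Γ, μ • p.1 - p.2 ∈ C → p.1 ∈ C) (t : NNReal) {f : E}
    (hf : f ∈ C) : semigroup hΓ t f ∈ C := by
  refine hC.mem_of_tendsto (tendsto_approx hΓ t f) (Eventually.of_forall fun n => ?_)
  have hμ := n.cast_add_one_pos (α := ℝ)
  refine poisson_mem hC h0 hadd hsmul (fun g hg => ?_) hμ.le t.2 hf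
  refine hres _ hμ _ (yosida_mem hΓ n g) ?_
  rw [smul_sub, sub_sub_cancel]
  exact hsmul _ hμ.le _ hg

end HilleYosida

/-! ### From dissipativity, dense domain and dense range to Markov semigroups on `C(X)`. -/

section Generation

/-- The estimate is a closed condition, so it passes to the closure of the graph. There it makes `μ
- B` bounded below for the graph norm; on a complete graph this forces a closed range, and a closed
dense range is everything. -/
theorem isMDissipative_topologicalClosure {E : Type*} [NormedAddCommGroup E] [NormedSpace ℝ E]
    [CompleteSpace E] {G : Submodule ℝ (E × E)}
    (hdiss : ∀ p ∈ G, ∀ μ : ℝ, 0 < μ → μ * ‖p.1‖ ≤ ‖μ • p.1 - p.2‖)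
    (hdense : Dense (Prod.fst '' (G : Set (E × E))))
    (hrange : ∀ μ : ℝ, 0 < μ → Dense ((fun p : E × E => μ • p.1 - p.2) '' (G : Set (E × E)))) :
    IsMDissipative G.topologicalClosure := by
  have hsub : (G : Set (E × E)) ⊆ G.topologicalClosure := G.le_topologicalClosure
  have hdiss' : ∀ p ∈ G.topologicalClosure, ∀ μ : ℝ, 0 < μ → μ * ‖p.1‖ ≤ ‖μ • p.1 - p.2‖ := by
    intro p hp μ hμ
    have hc : _root_.IsClosed {p : E × E | μ * ‖p.1‖ ≤ ‖μ • p.1 - p.2‖} :=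
      isClosed_le (by fun_prop) (by fun_prop)
    exact closure_minimal (fun q hq => hdiss q hq μ hμ) hc hp
  refine ⟨G.isClosed_topologicalClosure, hdiss', hdense.mono (image_mono hsub),
    fun μ hμ h => ?_⟩
  let Φ : E × E →L[ℝ] E := μ • ContinuousLinearMap.fst ℝ E E - ContinuousLinearMap.snd ℝ E E
  let Ψ : G.topologicalClosure →L[ℝ] E := Φ.comp G.topologicalClosure.subtypeL
  -- For `N = ‖μ p.1 - p.2‖`, dissipativity gives `‖p.1‖ ≤ μ⁻¹N` and hence `‖p.2‖ ≤ 2N`; the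
  -- constant covers both.
  have hΨ : AntilipschitzWith (Real.toNNReal (2 + μ⁻¹)) Ψ := by
    refine ContinuousLinearMap.antilipschitz_of_bound _ fun p => ?_
    have h1 : μ * ‖p.1.1‖ ≤ ‖Ψ p‖ := hdiss' p.1 p.2 μ hμ
    have h2 : p.1.2 = μ • p.1.1 - Ψ p := by
      change p.1.2 = μ • p.1.1 - (μ • p.1.1 - p.1.2)
      abel
    have h3 : ‖p.1.2‖ ≤ μ * ‖p.1.1‖ + ‖Ψ p‖ := by
      conv_lhs => rw [h2]
      refine (norm_sub_le _ _).trans ?_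
      rw [norm_smul, Real.norm_of_nonneg hμ.le]
    rw [Real.coe_toNNReal _ (by positivity), Submodule.coe_norm, Prod.norm_def]
    have h4 : 0 ≤ μ⁻¹ * ‖Ψ p‖ := by positivity
    refine max_le ?_ ?_
    · have : ‖p.1.1‖ ≤ μ⁻¹ * ‖Ψ p‖ := by rwa [le_inv_mul_iff₀ hμ]
      nlinarith [norm_nonneg (Ψ p)]
    · nlinarith [norm_nonneg (Ψ p)]
  have : CompleteSpace G.topologicalClosure := G.isClosed_topologicalClosure.completeSpace_coe
  have hcl : _root_.IsClosed (range Ψ) := hΨ.isClosed_range Ψ.uniformContinuous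
  have hden : Dense (range Ψ) := by
    refine (hrange μ hμ).mono ?_
    rintro _ ⟨p, hp, rfl⟩
    exact ⟨⟨p, hsub hp⟩, rfl⟩
  have : h ∈ range Ψ := by
    rw [← hcl.closure_eq]
    exact hden h
  obtain ⟨p, rfl⟩ := this
  exact ⟨p.1, p.2, rfl⟩

/-- This is closability. Dissipativity of `q + μp`, divided by `μ` as `μ → ∞`, gives `‖q.1‖ ≤ ‖q.1 -
p.2‖` for every `q` in the graph; by density `q.1` may be replaced by `p.2`. -/
theorem IsMDissipative.snd_eq_zero {E : Type*} [NormedAddCommGroup E] [NormedSpace ℝ E]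
    {Γ : Submodule ℝ (E × E)} (hΓ : IsMDissipative Γ) {p : E × E} (hp : p ∈ Γ) (h0 : p.1 = 0) :
    p.2 = 0 := by
  have key : ∀ q ∈ Γ, ‖q.1‖ ≤ ‖q.1 - p.2‖ := by
    intro q hq
    have h1 : ∀ μ : ℝ, 0 < μ → ‖q.1‖ ≤ ‖q.1 - p.2 - μ⁻¹ • q.2‖ := by
      intro μ hμ
      have := hΓ.dissip (q + μ • p) (Γ.add_mem hq (Γ.smul_mem μ hp)) μ hμ
      simp only [Prod.fst_add, Prod.smul_fst, Prod.snd_add, Prod.smul_snd, h0, smul_zero,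
        add_zero] at this
      have e : μ • q.1 - (q.2 + μ • p.2) = μ • (q.1 - p.2 - μ⁻¹ • q.2) := by
        rw [smul_sub, smul_sub, smul_inv_smul₀ hμ.ne']; abel
      rw [e, norm_smul, Real.norm_of_nonneg hμ.le] at this
      exact le_of_mul_le_mul_left this hμ
    have h2 : Tendsto (fun μ : ℝ => ‖q.1 - p.2 - μ⁻¹ • q.2‖) atTop (𝓝 ‖q.1 - p.2‖) := by
      have := ((tendsto_inv_atTop_zero (𝕜 := ℝ)).smul_const q.2).const_sub (q.1 - p.2)
      simpa using this.norm
    exact ge_of_tendsto h2 ((eventually_gt_atTop 0).mono h1)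
  have hc : _root_.IsClosed {f : E | ‖f‖ ≤ ‖f - p.2‖} := isClosed_le (by fun_prop) (by fun_prop)
  have h3 : p.2 ∈ {f : E | ‖f‖ ≤ ‖f - p.2‖} := by
    refine closure_minimal ?_ hc (hΓ.dense p.2)
    rintro _ ⟨q, hq, rfl⟩
    exact key q hq
  simpa using h3

variable {X : Type*} [TopologicalSpace X] [CompactSpace X]

/-- At a minimum of `f` one has `μf ≥ μf - g`, and at a maximum `μf ≤ μf - g`; so the extreme values
of `μf` are controlled by `‖μf - g‖`. -/
theorem dissipative_of_min {f g : C(X, ℝ)} {μ : ℝ} (hμ : 0 < μ)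
    (h1 : ∀ x, (∀ y, f x ≤ f y) → 0 ≤ g x) (h2 : ∀ x, (∀ y, f y ≤ f x) → g x ≤ 0) :
    μ * ‖f‖ ≤ ‖μ • f - g‖ := by
  have hN : ∀ x, |μ * f x - g x| ≤ ‖μ • f - g‖ := fun x => (μ • f - g).norm_coe_le_norm x
  rw [← Real.norm_of_nonneg hμ.le, ← norm_smul, Real.norm_of_nonneg hμ.le,
    ContinuousMap.norm_le _ (norm_nonneg _)]
  intro x
  have : Nonempty X := ⟨x⟩
  obtain ⟨y, -, hy⟩ := isCompact_univ.exists_isMinOn univ_nonempty f.continuous.continuousOn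
  obtain ⟨z, -, hz⟩ := isCompact_univ.exists_isMaxOn univ_nonempty f.continuous.continuousOn
  have hy' : ∀ w, f y ≤ f w := fun w => hy (mem_univ w)
  have hz' : ∀ w, f w ≤ f z := fun w => hz (mem_univ w)
  have k1 := abs_le.1 (hN y)
  have k2 := abs_le.1 (hN z)
  have k3 := h1 y hy'
  have k4 := h2 z hz'
  have k5 := mul_le_mul_of_nonneg_left (hy' x) hμ.le
  have k6 := mul_le_mul_of_nonneg_left (hz' x) hμ.le
  rw [ContinuousMap.smul_apply, smul_eq_mul, Real.norm_eq_abs, abs_le]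
  constructor <;> linarith

/-- Let `h = μp.1 - p.2 ≥ 0` and `N = ‖h‖`. Since `1` has image `0`, `μ - B` sends `N - μp.1` to
`μ(N - h)`, whose norm is at most `μN`. Dissipativity gives `‖N - μp.1‖ ≤ N`, which forces `p.1 ≥
0`. -/
theorem nonneg_of_dissipative {Γ : Submodule ℝ (C(X, ℝ) × C(X, ℝ))} (hΓ : IsMDissipative Γ)
    (hone : ((1 : C(X, ℝ)), (0 : C(X, ℝ))) ∈ Γ) {μ : ℝ} (hμ : 0 < μ) {p : C(X, ℝ) × C(X, ℝ)}
    (hp : p ∈ Γ) (h : ∀ x, 0 ≤ (μ • p.1 - p.2) x) (x : X) : 0 ≤ p.1 x := by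
  set N := ‖μ • p.1 - p.2‖
  have h1 := hΓ.dissip (N • (1, 0) - μ • p) (Γ.sub_mem (Γ.smul_mem _ hone) (Γ.smul_mem _ hp)) μ hμ
  have h2 : ‖μ • (N • ((1 : C(X, ℝ)), (0 : C(X, ℝ))) - μ • p).1
      - (N • ((1 : C(X, ℝ)), (0 : C(X, ℝ))) - μ • p).2‖ ≤ μ * N := by
    rw [ContinuousMap.norm_le _ (by positivity)]
    intro y
    have k1 := h y
    have k2 := (abs_le.1 ((μ • p.1 - p.2).norm_coe_le_norm y)).2
    change (μ * p.1 y - p.2 y) ≤ N at k2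
    change 0 ≤ μ * p.1 y - p.2 y at k1
    change |μ * (N * 1 - μ * p.1 y) - (N * 0 - μ * p.2 y)| ≤ μ * N
    have e : μ * (N * 1 - μ * p.1 y) - (N * 0 - μ * p.2 y)
        = μ * (N - (μ * p.1 y - p.2 y)) := by ring
    rw [e, abs_of_nonneg (mul_nonneg hμ.le (by linarith))]
    gcongr
    linarith
  have h3 := le_of_mul_le_mul_left (h1.trans h2) hμ
  have h4 := (abs_le.1 ((ContinuousMap.norm_coe_le_norm _ x).trans h3)).2
  change N * 1 - μ * p.1 x ≤ N at h4
  by_contra! h5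
  have := mul_neg_of_pos_of_neg hμ h5
  linarith

/-- Generation of Markov semigroups: a densely defined operator that satisfies the minimum
principle, kills constants, and for which all `μ - A`, `μ > 0`, have dense range is closable, and
its closure generates a Markov semigroup. -/
theorem exists_markovSemigroup (A : C(X, ℝ) →ₗ.[ℝ] C(X, ℝ))
    (hmin : ∀ (f : A.domain) (x : X), (∀ y, (f : C(X, ℝ)) x ≤ (f : C(X, ℝ)) y) → 0 ≤ A f x)
    (hone : ((1 : C(X, ℝ)), (0 : C(X, ℝ))) ∈ A.graph)
    (hdense : Dense (A.domain : Set C(X, ℝ)))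
    (hrange : ∀ μ : ℝ, 0 < μ → Dense (range fun f : A.domain => μ • (f : C(X, ℝ)) - A f)) :
    A.IsClosable ∧ ∃ T : NNReal → C(X, ℝ) →L[ℝ] C(X, ℝ),
      IsMarkovSemigroup T ∧ IsInfinitesimalOperator T A.closure := by
  have hΓ : IsMDissipative A.graph.topologicalClosure := by
    refine isMDissipative_topologicalClosure ?_ ?_ ?_
    · intro p hp μ hμ
      obtain ⟨f, hf1, hf2⟩ := LinearPMap.mem_graph_iff A |>.1 hp
      rw [← hf1, ← hf2]
      refine dissipative_of_min hμ (hmin f) fun x hx => ?_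
      have := hmin (-f) x fun y => neg_le_neg (hx y)
      rw [LinearPMap.map_neg] at this
      exact neg_nonneg.1 this
    · refine hdense.mono ?_
      intro f hf
      exact ⟨_, LinearPMap.mem_graph A ⟨f, hf⟩, rfl⟩
    · intro μ hμ
      refine (hrange μ hμ).mono ?_
      rintro _ ⟨f, rfl⟩
      exact ⟨_, LinearPMap.mem_graph A f, rfl⟩
  have hcl : A.IsClosable :=
    ⟨A.graph.topologicalClosure.toLinearPMap,
      (Submodule.toLinearPMap_graph_eq _ fun p hp h0 => hΓ.snd_eq_zero hp h0).symm⟩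
  have hone' := A.graph.le_topologicalClosure hone
  refine ⟨hcl, semigroup hΓ, ⟨semigroup_zero hΓ, semigroup_add hΓ, tendsto_semigroup hΓ,
    fun t f hf => ?_, fun t => ?_⟩, fun f g => ?_⟩
  · have hC : _root_.IsClosed {f : C(X, ℝ) | ∀ x, 0 ≤ f x} := by
      simp only [Set.ofPred_forall]
      exact isClosed_iInter fun x => isClosed_le continuous_const (continuous_eval_const x)
    exact semigroup_mem hΓ hC (fun x => le_rfl) (fun f hf g hg x => add_nonneg (hf x) (hg x))
      (fun c hc f hf x => mul_nonneg hc (hf x))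
      (fun μ hμ p hp h => nonneg_of_dissipative hΓ hone' hμ hp h) t hf
  · have := norm_semigroup_sub_le hΓ t hone'
    rw [norm_zero, mul_zero, norm_le_zero_iff] at this
    exact sub_eq_zero.1 this
  · rw [← hcl.graph_closure_eq_closure_graph]
    exact ⟨fun h => tendsto_generator hΓ (p := (f, g)) h, fun h => mem_of_tendsto_generator hΓ h⟩

end Generation

/-! ### The glued scale `ũ` as a `C¹` coordinate, and derivatives with respect to it. -/

section Friction

/-- A continuous friction coefficient that vanishes exactly on `[-1, 1]`. -/
structure IsFriction (lam : ℝ → ℝ) : Prop where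
  cont : Continuous lam
  zero : ∀ y ∈ Icc (-1 : ℝ) 1, lam y = 0
  pos : ∀ y, y ∉ Icc (-1 : ℝ) 1 → 0 < lam y

variable {lam : ℝ → ℝ}

theorem IsFriction.continuous_lamTilde (h : IsFriction lam) : Continuous (lamTilde lam) := by
  have hc := h.cont
  -- The shift glues continuously because `λ(-1) = λ(1) = 0`: on either side of the centre one of
  -- the two summands vanishes.
  have e : lamTilde lam = fun y => lam (min y 0 - 1) + lam (max y 0 + 1) := by
    funext y
    have h1 : lam (-1) = 0 := h.zero _ (by norm_num)
    have h2 : lam 1 = 0 := h.zero _ (by norm_num)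
    rcases lt_trichotomy y 0 with hy | rfl | hy
    · simp [lamTilde, shift, hy, hy.le, h2]
    · simp [lamTilde, shift, h1, h2]
    · simp [lamTilde, shift, hy, hy.le, hy.not_gt, h1]
  rw [e]
  fun_prop

theorem IsFriction.lamTilde_pos (h : IsFriction lam) {y : ℝ} (hy : y ≠ 0) : 0 < lamTilde lam y := by
  rcases lt_or_gt_of_ne hy with hy | hy
  · simp only [lamTilde, shift, hy, if_true]
    exact h.pos _ fun h => by linarith [h.1]
  · simp only [lamTilde, shift, hy, hy.not_gt, if_true, if_false]
    exact h.pos _ fun h => by linarith [h.2]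

/-- Since `λ` vanishes on `[-1, 1]`, removing that interval does not change the integral. Hence `ũ`
is `C¹` with derivative `λ̃`, positive except at `0`. -/
theorem IsFriction.uTilde_eq (h : IsFriction lam) (y : ℝ) : uTilde lam y = ∫ s in (0 : ℝ)..y, lamTilde lam s := by
  have hi : ∀ c d : ℝ, IntervalIntegrable lam MeasureTheory.volume c d := fun c d =>
    h.cont.intervalIntegrable c d
  rcases lt_trichotomy y 0 with hy | rfl | hy
  · simp only [uTilde, shift, hy, if_true]
    have h0 : ∫ s in (0 : ℝ)..(-1), lam s = 0 :=
      intervalIntegral.integral_zero_ae (Eventually.of_forall fun s hs => by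
        rw [uIoc_of_ge (by norm_num)] at hs
        exact h.zero s ⟨hs.1.le, hs.2.trans zero_le_one⟩)
    rw [← intervalIntegral.integral_add_adjacent_intervals (hi 0 (-1)) (hi (-1) (y - 1)), h0,
      zero_add]
    have := intervalIntegral.integral_comp_sub_right (a := 0) (b := y) lam 1
    rw [zero_sub] at this
    rw [← this]
    refine intervalIntegral.integral_congr_ae ?_
    have h0 : ∀ᵐ s : ℝ, s ≠ 0 := by simp [MeasureTheory.ae_iff]
    filter_upwards [h0] with s hs0 hs
    rw [uIoc_of_ge hy.le] at hs
    simp [lamTilde, shift, lt_of_le_of_ne hs.2 hs0]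
  · simp [uTilde, shift]
  · simp only [uTilde, shift, hy, hy.not_gt, if_true, if_false]
    have h0 : ∫ s in (0 : ℝ)..1, lam s = 0 :=
      intervalIntegral.integral_zero_ae (Eventually.of_forall fun s hs => by
        rw [uIoc_of_le (by norm_num)] at hs
        exact h.zero s ⟨by linarith [hs.1], hs.2⟩)
    rw [← intervalIntegral.integral_add_adjacent_intervals (hi 0 1) (hi 1 (y + 1)), h0,
      zero_add]
    have := intervalIntegral.integral_comp_add_right (a := 0) (b := y) lam 1
    rw [zero_add] at this
    rw [← this]
    refine intervalIntegral.integral_congr_ae (Eventually.of_forall fun s hs => ?_)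
    rw [uIoc_of_le hy.le] at hs
    simp [lamTilde, shift, hs.1, hs.1.not_gt]

theorem IsFriction.hasDerivAt_uTilde (h : IsFriction lam) (y : ℝ) :
    HasDerivAt (uTilde lam) (lamTilde lam y) y := by
  rw [show uTilde lam = fun y => ∫ s in (0 : ℝ)..y, lamTilde lam s from funext h.uTilde_eq]
  exact intervalIntegral.integral_hasDerivAt_right
    (h.continuous_lamTilde.intervalIntegrable _ _)
    (h.continuous_lamTilde.stronglyMeasurableAtFilter _ _) h.continuous_lamTilde.continuousAt

theorem IsFriction.strictMono_uTilde (h : IsFriction lam) : StrictMono (uTilde lam) := by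
  have hc : Continuous (uTilde lam) :=
    continuous_iff_continuousAt.2 fun y => (h.hasDerivAt_uTilde y).continuousAt
  refine StrictMonoOn.Iic_union_Ici (a := 0)
    (strictMonoOn_of_deriv_pos (convex_Iic 0) hc.continuousOn fun y hy => ?_)
    (strictMonoOn_of_deriv_pos (convex_Ici 0) hc.continuousOn fun y hy => ?_)
  · rw [interior_Iic] at hy
    rw [(h.hasDerivAt_uTilde y).deriv]
    exact h.lamTilde_pos (ne_of_lt hy)
  · rw [interior_Ici] at hy
    rw [(h.hasDerivAt_uTilde y).deriv]
    exact h.lamTilde_pos (ne_of_gt hy)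

theorem IsFriction.continuous_uTilde (h : IsFriction lam) : Continuous (uTilde lam) :=
  continuous_iff_continuousAt.2 fun y => (h.hasDerivAt_uTilde y).continuousAt

theorem uTilde_zero : uTilde lam 0 = 0 := by simp [uTilde, shift]

/-- The quotients `Δg/Δw` and `Δg/Δy` differ by the factor `Δw/Δy → w' ≠ 0`. Away from the centre
this turns `D_ũ` and `D_ṽ` into ordinary derivatives. -/
theorem hasDerivWrt_iff {w g : ℝ → ℝ} {w' L y : ℝ} (hw : HasDerivAt w w' y) (h0 : w' ≠ 0)
    (hinj : Function.Injective w) : HasDerivWrt w g L y ↔ HasDerivAt g (L * w') y := by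
  have hw' := hasDerivAt_iff_tendsto_slope.1 hw
  rw [hasDerivAt_iff_tendsto_slope]
  unfold HasDerivWrt
  constructor
  · intro hg
    refine (hg.mul hw').congr' ?_
    filter_upwards [self_mem_nhdsWithin] with z hz
    have h1 : w z - w y ≠ 0 := sub_ne_zero.2 (hinj.ne hz)
    rw [slope_def_field, slope_def_field]
    field_simp
  · intro hg
    have := hg.div hw' h0
    rw [mul_div_cancel_right₀ _ h0] at this
    refine this.congr' ?_
    filter_upwards [self_mem_nhdsWithin] with z hz
    have h1 : w z - w y ≠ 0 := sub_ne_zero.2 (hinj.ne hz)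
    have h2 : z - y ≠ 0 := sub_ne_zero.2 hz
    rw [Pi.div_apply]
    rw [slope_def_field, slope_def_field]
    field_simp

theorem IsFriction.hasDerivWrt_u (h : IsFriction lam) {g : ℝ → ℝ} {L y : ℝ} (hy : y ≠ 0) :
    HasDerivWrt (uTilde lam) g L y ↔ HasDerivAt g (L * lamTilde lam y) y :=
  hasDerivWrt_iff (h.hasDerivAt_uTilde y) (h.lamTilde_pos hy).ne' h.strictMono_uTilde.injective

theorem IsFriction.hasDerivWrt_v (h : IsFriction lam) {g : ℝ → ℝ} {L y : ℝ} (hy : y ≠ 0) :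
    HasDerivWrt (vTilde lam) g L y ↔ HasDerivAt g (2 * L * lamTilde lam y) y := by
  rw [vTilde_eq, hasDerivWrt_iff ((h.hasDerivAt_uTilde y).const_mul 2)
    (mul_ne_zero two_ne_zero (h.lamTilde_pos hy).ne')
    fun x z hxz => h.strictMono_uTilde.injective (mul_left_cancel₀ two_ne_zero hxz)]
  ring_nf

end Friction

/-! ### One-dimensional minimum arguments and averaging over the circle. -/

section OneDim

/-- Second order necessary condition at a local minimum, for the operator `w⁻¹ d/dy`. -/
theorem nonneg_of_isLocalMin {g p w : ℝ → ℝ} {y r : ℝ}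
    (hg : ∀ᶠ z in 𝓝 y, HasDerivAt g (p z * w z) z ∧ 0 < w z) (hp : HasDerivAt p r y)
    (hmin : IsLocalMin g y) : 0 ≤ r := by
  -- If `r < 0`, then `p` vanishes at `y` and is negative just to its right, so `g` strictly
  -- decreases there.
  by_contra! hr
  have hp0 : p y = 0 := by
    have h1 := hmin.hasDerivAt_eq_zero hg.self_of_nhds.1
    exact (mul_eq_zero.1 h1).resolve_right hg.self_of_nhds.2.ne'
  have h1 : ∀ᶠ z in 𝓝[>] y, p z < 0 := by
    have h2 := (hasDerivAt_iff_tendsto_slope.1 hp).eventually (gt_mem_nhds hr)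
    filter_upwards [h2.filter_mono (nhdsWithin_mono _ fun z hz => ne_of_gt hz),
      self_mem_nhdsWithin] with z hz hzy
    rw [slope_def_field, hp0, sub_zero] at hz
    have : 0 < z - y := sub_pos.2 hzy
    by_contra! h
    exact absurd (div_nonneg h this.le) (not_le.2 hz)
  obtain ⟨ε, hε, hball⟩ := Metric.eventually_nhds_iff.1 (hg.and hmin)
  obtain ⟨d, hd, hd1⟩ := (mem_nhdsGT_iff_exists_Ioo_subset).1 h1
  set e := min ((d - y) / 2) (ε / 2)
  have he : 0 < e := lt_min (half_pos (sub_pos.2 hd)) (half_pos hε)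
  have he1 : e < d - y := (min_le_left _ _).trans_lt (half_lt_self (sub_pos.2 hd))
  have he2 : e < ε := (min_le_right _ _).trans_lt (half_lt_self hε)
  have hz : ∀ z ∈ Icc y (y + e), dist z y < ε := fun z hz => by
    rw [Real.dist_eq, abs_of_nonneg (sub_nonneg.2 hz.1)]
    linarith [hz.2]
  have hanti : StrictAntiOn g (Icc y (y + e)) := by
    refine strictAntiOn_of_deriv_neg (convex_Icc _ _)
      (fun z h => (hball (hz z h)).1.1.continuousAt.continuousWithinAt) fun z h => ?_
    rw [interior_Icc] at h
    have h2 := (hball (hz z (Ioo_subset_Icc_self h))).1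
    rw [h2.1.deriv]
    exact mul_neg_of_neg_of_pos (hd1 ⟨h.1, by linarith [h.2]⟩) h2.2
  have h3 := hanti (left_mem_Icc.2 (by linarith)) (right_mem_Icc.2 (by linarith))
    (by linarith : y < y + e)
  exact absurd (hball (hz _ (right_mem_Icc.2 (by linarith)))).2 (not_le.2 h3)

/-- No minimum at a point where the `w`-derivatives from both sides agree and the second
`w`-derivative is negative nearby. -/
theorem exists_lt_of_second_neg {F P r w : ℝ → ℝ} {δ P₀ : ℝ} (hδ : 0 < δ)
    (hF : ContinuousOn F (Ioo (-δ) δ)) (hw : ∀ y, y ≠ 0 → 0 < w y)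
    (hF' : ∀ y ∈ Ioo (-δ) δ, y ≠ 0 → HasDerivAt F (P y * w y) y)
    (hP' : ∀ y ∈ Ioo (-δ) δ, y ≠ 0 → HasDerivAt P (r y * w y) y)
    (hr : ∀ y ∈ Ioo (-δ) δ, y ≠ 0 → r y < 0)
    (hm : Tendsto P (𝓝[<] 0) (𝓝 P₀)) (hp : Tendsto P (𝓝[>] 0) (𝓝 P₀)) :
    ∃ y ∈ Ioo (-δ) δ, F y < F 0 := by
  have a1 : StrictAntiOn P (Ioo 0 δ) := by
    have hI : ∀ y ∈ Ioo 0 δ, y ∈ Ioo (-δ) δ ∧ y ≠ 0 := fun y hy =>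
      ⟨⟨by linarith [hy.1], hy.2⟩, hy.1.ne'⟩
    refine strictAntiOn_of_deriv_neg (convex_Ioo _ _)
      (fun y hy => (hP' y (hI y hy).1 (hI y hy).2).continuousAt.continuousWithinAt) fun y hy => ?_
    rw [interior_Ioo] at hy
    rw [(hP' y (hI y hy).1 (hI y hy).2).deriv]
    exact mul_neg_of_neg_of_pos (hr y (hI y hy).1 (hI y hy).2) (hw y (hI y hy).2)
  have a2 : StrictAntiOn P (Ioo (-δ) 0) := by
    have hI : ∀ y ∈ Ioo (-δ) 0, y ∈ Ioo (-δ) δ ∧ y ≠ 0 := fun y hy =>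
      ⟨⟨hy.1, by linarith [hy.2]⟩, hy.2.ne⟩
    refine strictAntiOn_of_deriv_neg (convex_Ioo _ _)
      (fun y hy => (hP' y (hI y hy).1 (hI y hy).2).continuousAt.continuousWithinAt) fun y hy => ?_
    rw [interior_Ioo] at hy
    rw [(hP' y (hI y hy).1 (hI y hy).2).deriv]
    exact mul_neg_of_neg_of_pos (hr y (hI y hy).1 (hI y hy).2) (hw y (hI y hy).2)
  have b1 : ∀ y ∈ Ioo 0 δ, P y < P₀ := fun y hy => by
    have hy2 : y / 2 ∈ Ioo 0 δ := ⟨half_pos hy.1, by linarith [hy.1, hy.2]⟩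
    refine (a1 hy2 hy (half_lt_self hy.1)).trans_le (ge_of_tendsto hp ?_)
    filter_upwards [Ioo_mem_nhdsGT hy2.1] with z hz
    exact (a1 ⟨hz.1, hz.2.trans hy2.2⟩ hy2 hz.2).le
  have b2 : ∀ y ∈ Ioo (-δ) 0, P₀ < P y := fun y hy => by
    have hy2 : y / 2 ∈ Ioo (-δ) 0 := ⟨by linarith [hy.1, hy.2], by linarith [hy.2]⟩
    refine (le_of_tendsto hm ?_).trans_lt (a2 hy hy2 (by linarith [hy.2]))
    filter_upwards [Ioo_mem_nhdsLT hy2.2] with z hz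
    exact (a2 hy2 ⟨hy2.1.trans hz.1, hz.2⟩ hz.1).le
  -- `P` lies below `P₀` on the right and above `P₀` on the left, so the sign of `P₀` tells on which
  -- side `F` falls when moving away from `0`.
  rcases le_or_gt P₀ 0 with h0 | h0
  · refine ⟨δ / 2, ⟨by linarith, by linarith⟩, ?_⟩
    have : StrictAntiOn F (Icc 0 (δ / 2)) := by
      refine strictAntiOn_of_deriv_neg (convex_Icc _ _)
        (hF.mono fun y hy => ⟨by linarith [hy.1], by linarith [hy.2]⟩) fun y hy => ?_
      rw [interior_Icc] at hy
      rw [(hF' y ⟨by linarith [hy.1], by linarith [hy.2]⟩ hy.1.ne').deriv]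
      exact mul_neg_of_neg_of_pos ((b1 y ⟨hy.1, by linarith [hy.2]⟩).trans_le h0)
        (hw y hy.1.ne')
    exact this (left_mem_Icc.2 (by linarith)) (right_mem_Icc.2 (by linarith)) (by linarith)
  · refine ⟨-(δ / 2), ⟨by linarith, by linarith⟩, ?_⟩
    have : StrictMonoOn F (Icc (-(δ / 2)) 0) := by
      refine strictMonoOn_of_deriv_pos (convex_Icc _ _)
        (hF.mono fun y hy => ⟨by linarith [hy.1], by linarith [hy.2]⟩) fun y hy => ?_
      rw [interior_Icc] at hy
      rw [(hF' y ⟨by linarith [hy.1], by linarith [hy.2]⟩ hy.2.ne).deriv]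
      exact mul_pos (h0.trans (b2 y ⟨by linarith [hy.1], hy.2⟩)) (hw y hy.2.ne)
    exact this (left_mem_Icc.2 (by linarith)) (right_mem_Icc.2 (by linarith)) (by linarith)

theorem hasDerivAt_integral_param {G G' : ℝ → ℝ → ℝ} {U : Set ℝ} (hU : IsOpen U) {y : ℝ}
    (hy : y ∈ U) {T : ℝ} (hG : ∀ z ∈ U, Continuous fun θ => G θ z)
    (hd : ∀ θ, ∀ z ∈ U, HasDerivAt (G θ) (G' θ z) z)
    (hc : ContinuousOn (fun p : ℝ × ℝ => G' p.1 p.2) (univ ×ˢ U)) :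
    HasDerivAt (fun z => ∫ θ in (0 : ℝ)..T, G θ z) (∫ θ in (0 : ℝ)..T, G' θ y) y := by
  obtain ⟨ε, hε, hb⟩ := Metric.nhds_basis_closedBall.mem_iff.1 (hU.mem_nhds hy)
  obtain ⟨C, hC⟩ := (isCompact_uIcc.prod (isCompact_closedBall y ε)).exists_bound_of_continuousOn
    (s := uIcc 0 T ×ˢ Metric.closedBall y ε) (hc.mono (prod_mono (subset_univ _) hb))
  have hcθ : ∀ z ∈ U, Continuous fun θ => G' θ z := fun z hz =>
    hc.comp_continuous (f := fun θ : ℝ => (θ, z)) (by fun_prop) fun θ => ⟨mem_univ _, hz⟩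
  refine (intervalIntegral.hasDerivAt_integral_of_dominated_loc_of_deriv_le
    (F := fun z θ => G θ z) (F' := fun z θ => G' θ z) (bound := fun _ => C)
    (Metric.closedBall_mem_nhds y hε) ?_ ?_ ?_ ?_ ?_ ?_).2
  · filter_upwards [hU.mem_nhds hy] with z hz using (hG z hz).aestronglyMeasurable
  · exact (hG y hy).intervalIntegrable _ _
  · exact (hcθ y hy).aestronglyMeasurable
  · exact Eventually.of_forall fun θ hθ z hz => hC (θ, z) ⟨uIoc_subset_uIcc hθ, hz⟩
  · exact intervalIntegrable_const
  · exact Eventually.of_forall fun θ hθ z hz => hd θ z (hb hz)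

theorem tendsto_integral_of_joint {G : ℝ → ℝ → ℝ} {L : ℝ → ℝ} {φ : Filter ℝ} [φ.NeBot]
    [φ.IsCountablyGenerated] {T : ℝ} (hG : ∀ᶠ z in φ, Continuous fun θ => G θ z)
    (h : ∀ θ, Tendsto (fun p : ℝ × ℝ => G p.1 p.2) (𝓝 θ ×ˢ φ) (𝓝 (L θ))) :
    Tendsto (fun z => ∫ θ in (0 : ℝ)..T, G θ z) φ (𝓝 (∫ θ in (0 : ℝ)..T, L θ)) := by
  have hL := continuous_lim h
  obtain ⟨C, hC⟩ := isCompact_uIcc.exists_bound_of_continuousOn (s := uIcc 0 T) hL.continuousOn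
  -- Tube lemma: pointwise joint limits give a bound uniform over the compact circle interval, which
  -- dominates the integrand.
  have hs : {p : ℝ × ℝ | ‖G p.1 p.2‖ < C + 1} ∈ 𝓝ˢ (uIcc 0 T) ×ˢ φ := by
    refine isCompact_uIcc.mem_nhdsSet_prod_of_forall fun θ hθ => ?_
    exact (h θ).norm.eventually (gt_mem_nhds ((hC θ hθ).trans_lt (lt_add_one C)))
  obtain ⟨U, hU, V, hV, hUV⟩ := mem_prod_iff.1 hs
  refine intervalIntegral.tendsto_integral_filter_of_dominated_convergence (fun _ => C + 1)
    ?_ ?_ intervalIntegrable_const ?_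
  · filter_upwards [hG] with z hz using hz.aestronglyMeasurable
  · filter_upwards [hV] with z hz
    refine Eventually.of_forall fun θ hθ => ?_
    exact le_of_lt (hUV (mk_mem_prod (subset_of_mem_nhdsSet hU (uIoc_subset_uIcc hθ)) hz))
  · refine Eventually.of_forall fun θ _ => ?_
    exact (h θ).comp (tendsto_const_nhds.prodMk tendsto_id)

end OneDim

/-! ### The minimum principle on the glued cylinder. -/

section MinPrinciple

variable {a b : ℝ} {lam : ℝ → ℝ}

/-- A function on the glued cylinder in coordinates, extended to all heights by constants. -/
def coordExt (ha : a < 0) (hb : 0 < b) (f : C(Glued a b, ℝ)) (θ y : ℝ) : ℝ :=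
  f (pt θ (projIcc a b (ha.trans hb).le y))

theorem continuous_coordExt (ha : a < 0) (hb : 0 < b) (f : C(Glued a b, ℝ)) :
    Continuous fun p : ℝ × ℝ => coordExt ha hb f p.1 p.2 :=
  f.continuous.comp (isQuotientMap_pt.continuous.comp
    (f := fun p : ℝ × ℝ => (p.1, projIcc a b (ha.trans hb).le p.2)) (continuous_fst.prodMk (continuous_projIcc.comp continuous_snd)))

theorem continuous_coordExt_right (ha : a < 0) (hb : 0 < b) (f : C(Glued a b, ℝ)) (θ : ℝ) :
    Continuous (coordExt ha hb f θ) :=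
  (continuous_coordExt ha hb f).comp (Continuous.prodMk_right θ)

theorem coordExt_eq (ha : a < 0) (hb : 0 < b) (f : C(Glued a b, ℝ)) (θ : ℝ) {y : ℝ}
    (hy : y ∈ Icc a b) : coordExt ha hb f θ y = coord f θ y := by
  rw [coordExt, coord, dif_pos hy, projIcc_of_mem _ hy]

theorem coord_eq (f : C(Glued a b, ℝ)) (θ : ℝ) (y : Icc a b) : coord f θ y = f (pt θ y) := by
  rw [coord, dif_pos y.2]

theorem pt_zero_eq (ha : a < 0) (hb : 0 < b) (θ θ' : ℝ) :
    (pt θ ⟨0, ha.le, hb.le⟩ : Glued a b) = pt θ' ⟨0, ha.le, hb.le⟩ :=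
  Quotient.sound (Or.inr ⟨rfl, rfl⟩)

theorem exists_pt (x : Glued a b) : ∃ (θ : ℝ) (y : Icc a b), pt θ y = x := by
  obtain ⟨p, hp⟩ := isQuotientMap_pt.surjective x
  exact ⟨p.1, p.2, hp⟩

theorem inner_subset : Inner a b ⊆ Icc a b := fun _ hy => Ioo_subset_Icc_self hy.1

/-- The values of `A f` at the ends and at the centre are the limits of the expression. -/
theorem ext_eq_of_tendsto (ha : a < 0) (hb : 0 < b) {f : C(Glued a b, ℝ)} (hf : MemDom lam f)
    (θ : ℝ) {y : ℝ} (hy : y ∈ Icc a b) {φ : Filter ℝ} [φ.NeBot] (hφ : Inner a b ∈ φ)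
    (hle : φ ≤ 𝓝 y) {l : ℝ}
    (hl : Tendsto (fun p : ℝ × ℝ => expr lam f p.1 p.2) (𝓝 θ ×ˢ φ) (𝓝 l)) :
    coord (ext ha hb hf) θ y = l := by
  have h0 : ∀ z ∈ Inner a b, coordExt ha hb (ext ha hb hf) θ z = expr lam f θ z := fun z hz => by
    rw [coordExt_eq ha hb _ θ (inner_subset hz), coord_ext _ _ _ _ hz]
  rw [← coordExt_eq ha hb _ θ hy]
  have h1 := ((continuous_coordExt_right ha hb (ext ha hb hf) θ).tendsto y).mono_left hle
  have h2 : Tendsto (fun z => (θ, z)) φ (𝓝 θ ×ˢ φ) := tendsto_const_nhds.prodMk tendsto_id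
  refine tendsto_nhds_unique h1 ((hl.comp h2).congr' ?_)
  filter_upwards [hφ] with z hz using (h0 z hz).symm

theorem MemDom.hasDerivAt_coord (h : IsFriction lam) {f : C(Glued a b, ℝ)} (hf : MemDom lam f)
    (θ : ℝ) {y : ℝ} (hy : y ∈ Inner a b) :
    HasDerivAt (coord f θ) (derivWrt (uTilde lam) (coord f θ) y * lamTilde lam y) y :=
  (h.hasDerivWrt_u hy.2).1 (hf.diff_u θ hy).has

theorem MemDom.derivWrt_u (h : IsFriction lam) {f : C(Glued a b, ℝ)} (hf : MemDom lam f)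
    (θ : ℝ) {y : ℝ} (hy : y ∈ Inner a b) :
    derivWrt (uTilde lam) (coord f θ) y = 2 * derivWrt (vTilde lam) (coord f θ) y := by
  have h1 := (h.hasDerivWrt_v hy.2).1 (hf.diff_v θ y hy).has
  exact ((h.hasDerivWrt_u hy.2).2 h1).derivWrt

theorem MemDom.hasDerivAt_derivWrt (h : IsFriction lam) {f : C(Glued a b, ℝ)}
    (hf : MemDom lam f) (θ : ℝ) {y : ℝ} (hy : y ∈ Inner a b) :
    HasDerivAt (derivWrt (uTilde lam) (coord f θ))
      (2 * derivWrt (uTilde lam) (derivWrt (vTilde lam) (coord f θ)) y * lamTilde lam y) y := by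
  have h1 := ((h.hasDerivWrt_u hy.2).1 (hf.diff_uv θ y hy).has).const_mul 2
  rw [← mul_assoc] at h1
  refine h1.congr_of_eventuallyEq ?_
  filter_upwards [isOpen_inner.mem_nhds hy] with z hz using hf.derivWrt_u h θ hz

theorem MemDom.hasDerivAt_theta {f : C(Glued a b, ℝ)} (hf : MemDom lam f)
    (θ : ℝ) {y : ℝ} (hy : y ∈ Inner a b) :
    HasDerivAt (fun t => coord f t y) (deriv (fun t => coord f t y) θ) θ ∧
    HasDerivAt (deriv (fun t => coord f t y)) (iteratedDeriv 2 (fun t => coord f t y) θ) θ := by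
  refine ⟨(((hf.diff_θ y hy).differentiable (by norm_num)) θ).hasDerivAt, ?_⟩
  rw [iteratedDeriv_succ, iteratedDeriv_one]
  exact ((((contDiff_succ_iff_deriv (n := 1)).1
    (by simpa [one_add_one_eq_two] using hf.diff_θ y hy)).2.2.differentiable
      (by norm_num)) θ).hasDerivAt

/-- The circle average of the angular second derivative vanishes. -/
theorem MemDom.integral_theta {f : C(Glued a b, ℝ)} (hf : MemDom lam f) {y : ℝ}
    (hy : y ∈ Inner a b) :
    ∫ θ in (0 : ℝ)..(2 * Real.pi), iteratedDeriv 2 (fun t => coord f t y) θ = 0 := by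
  have hc : Continuous fun θ => iteratedDeriv 2 (fun t => coord f t y) θ :=
    (hf.diff_θ y hy).continuous_iteratedDeriv 2 le_rfl
  rw [intervalIntegral.integral_eq_sub_of_hasDerivAt
    (fun θ _ => (hf.hasDerivAt_theta θ hy).2) (hc.intervalIntegrable _ _), sub_eq_zero]
  have h1 := deriv_comp_add_const (f := fun t => coord f t y) (a := 2 * Real.pi) (x := 0)
  rw [show (fun t => coord f (t + 2 * Real.pi) y) = fun t => coord f t y from
    funext fun t => coord_periodic f y t] at h1
  rw [h1, zero_add]

theorem MemDom.min_inner (h : IsFriction lam) {f : C(Glued a b, ℝ)} (hf : MemDom lam f)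
    {θ y : ℝ} (hy : y ∈ Inner a b)
    (hmin : ∀ t, ∀ z ∈ Inner a b, coord f θ y ≤ coord f t z) : 0 ≤ expr lam f θ y := by
  have h1 : 0 ≤ 2 * derivWrt (uTilde lam) (derivWrt (vTilde lam) (coord f θ)) y
      * lamTilde lam y := by
    refine nonneg_of_isLocalMin (g := coord f θ) (w := lamTilde lam) ?_ (hf.hasDerivAt_derivWrt h θ hy) ?_
    · filter_upwards [isOpen_inner.mem_nhds hy] with z hz
      exact ⟨hf.hasDerivAt_coord h θ hz, h.lamTilde_pos hz.2⟩
    · filter_upwards [isOpen_inner.mem_nhds hy] with z hz using hmin θ z hz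
  have h2 : 0 ≤ iteratedDeriv 2 (fun t => coord f t y) θ := by
    refine nonneg_of_isLocalMin (g := fun t => coord f t y) (w := fun _ => 1) (Eventually.of_forall fun t => ?_)
      (hf.hasDerivAt_theta θ hy).2 (Eventually.of_forall fun t => hmin t y hy)
    simpa using (hf.hasDerivAt_theta t hy).1
  have h3 := nonneg_of_mul_nonneg_left h1 (h.lamTilde_pos hy.2)
  unfold expr
  have : 0 ≤ 1 / lamTilde lam y ^ 2 * iteratedDeriv 2 (fun t => coord f t y) θ := by positivity
  linarith

/-- The one-dimensional result `exists_lt_of_second_neg` is applied to the circle average of `f`;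
the gluing condition supplies its common one-sided limit `P₀`. -/
theorem MemDom.min_zero (h : IsFriction lam) (ha : a < 0) (hb : 0 < b) {f : C(Glued a b, ℝ)}
    (hf : MemDom lam f) (hmin : ∀ t, ∀ z ∈ Icc a b, coord f 0 0 ≤ coord f t z) (θ : ℝ) :
    0 ≤ coord (ext ha hb hf) θ 0 := by
  by_contra! hneg
  have h0 : (0 : ℝ) ∈ Icc a b := ⟨ha.le, hb.le⟩
  have hconst : ∀ (k : C(Glued a b, ℝ)) t, coord k t 0 = coord k θ 0 := fun k t => by
    rw [coord, dif_pos h0, coord, dif_pos h0, pt_zero_eq ha hb t θ]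
  set M : ℝ → ℝ := fun y => ∫ t in (0 : ℝ)..(2 * Real.pi), coordExt ha hb (ext ha hb hf) t y
  have hM : Continuous M := by
    refine intervalIntegral.continuous_parametric_intervalIntegral_of_continuous' ?_ _ _
    exact (continuous_coordExt ha hb (ext ha hb hf)).comp continuous_swap
  have hM0 : M 0 < 0 := by
    have : M 0 = 2 * Real.pi * coord (ext ha hb hf) θ 0 := by
      simp only [M, coordExt_eq ha hb _ _ h0, hconst _]
      simp
    rw [this]
    exact mul_neg_of_pos_of_neg Real.two_pi_pos hneg
  obtain ⟨δ₀, hδ₀, hball⟩ := Metric.eventually_nhds_iff.1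
    (hM.continuousAt.eventually (gt_mem_nhds hM0))
  set δ := min δ₀ (min (-a) b)
  have hδ : 0 < δ := lt_min hδ₀ (lt_min (neg_pos.2 ha) hb)
  have hδ1 : δ ≤ δ₀ := min_le_left _ _
  have hδ2 : δ ≤ -a := (min_le_right _ _).trans (min_le_left _ _)
  have hδ3 : δ ≤ b := (min_le_right _ _).trans (min_le_right _ _)
  have hI : ∀ y ∈ Ioo (-δ) δ, y ∈ Icc a b := fun y hy =>
    ⟨by linarith [hy.1], by linarith [hy.2]⟩
  have hI' : ∀ y ∈ Ioo (-δ) δ, y ≠ 0 → y ∈ Inner a b := fun y hy h0 =>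
    ⟨⟨by linarith [hy.1], by linarith [hy.2]⟩, h0⟩
  have hcu : ContinuousOn
      (fun p : ℝ × ℝ => derivWrt (uTilde lam) (coord f p.1) p.2) (univ ×ˢ Inner a b) :=
    (hf.cont_v.const_mul 2).congr fun p hp => hf.derivWrt_u h p.1 hp.2
  have hlamc := h.continuous_lamTilde
  have hcuθ : ∀ y ∈ Inner a b,
      Continuous fun t => derivWrt (uTilde lam) (coord f t) y := fun y hy =>
    hcu.comp_continuous (f := fun t : ℝ => (t, y)) (by fun_prop) fun t => ⟨mem_univ _, hy⟩
  obtain ⟨Lm, Lp, hm, hp, hmp⟩ := hf.glue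
  -- `P` is the average of `D_ũ f`. Since `D_ṽ = D_ũ / 2`, the second `ũ`-derivative of the average
  -- is twice the average `M` of `Af`, hence negative near `0`.
  obtain ⟨y, hy, hlt⟩ := exists_lt_of_second_neg (w := lamTilde lam)
    (F := fun y => ∫ t in (0 : ℝ)..(2 * Real.pi), coordExt ha hb f t y)
    (P := fun y => ∫ t in (0 : ℝ)..(2 * Real.pi), derivWrt (uTilde lam) (coord f t) y)
    (r := fun y => 2 * M y) (P₀ := ∫ t in (0 : ℝ)..(2 * Real.pi), Lp t) hδ
    (by
      refine Continuous.continuousOn ?_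
      refine intervalIntegral.continuous_parametric_intervalIntegral_of_continuous' ?_ _ _
      exact (continuous_coordExt ha hb f).comp continuous_swap)
    (fun y hy => h.lamTilde_pos hy)
    (fun y hy hy0 => by
      rw [← intervalIntegral.integral_mul_const]
      refine hasDerivAt_integral_param isOpen_inner (hI' y hy hy0)
        (G' := fun t z => derivWrt (uTilde lam) (coord f t) z * lamTilde lam z) ?_ ?_ ?_
      · intro z _
        exact (continuous_coordExt ha hb f).comp (Continuous.prodMk_left z)
      · intro t z hz
        refine (hf.hasDerivAt_coord h t hz).congr_of_eventuallyEq ?_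
        filter_upwards [isOpen_inner.mem_nhds hz] with x hx
          using coordExt_eq ha hb f t (inner_subset hx)
      · exact hcu.mul (hlamc.comp continuous_snd).continuousOn)
    (fun y hy hy0 => by
      have h1 := hasDerivAt_integral_param (T := 2 * Real.pi) isOpen_inner (hI' y hy hy0)
        (G' := fun t z => 2 * derivWrt (uTilde lam) (derivWrt (vTilde lam) (coord f t)) z
          * lamTilde lam z) hcuθ (fun t z hz => hf.hasDerivAt_derivWrt h t hz)
        ((hf.cont_uv.const_mul 2).mul (hlamc.comp continuous_snd).continuousOn)
      refine h1.congr_deriv ?_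
      rw [intervalIntegral.integral_mul_const, intervalIntegral.integral_const_mul]
      congr 2
      have hyI := hI' y hy hy0
      have e : ∀ t, coordExt ha hb (ext ha hb hf) t y
          = derivWrt (uTilde lam) (derivWrt (vTilde lam) (coord f t)) y
            + 1 / (lamTilde lam y) ^ 2 * iteratedDeriv 2 (fun t => coord f t y) t := fun t => by
        rw [coordExt_eq ha hb _ t (inner_subset hyI), coord_ext _ _ _ _ hyI, expr]
      simp only [M, e]
      have c1 : Continuous fun t =>
          derivWrt (uTilde lam) (derivWrt (vTilde lam) (coord f t)) y :=
        hf.cont_uv.comp_continuous (f := fun t : ℝ => (t, y)) (by fun_prop)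
          fun t => ⟨mem_univ _, hyI⟩
      have c2 : Continuous fun θ => iteratedDeriv 2 (fun t => coord f t y) θ :=
        (hf.diff_θ y hyI).continuous_iteratedDeriv 2 le_rfl
      rw [intervalIntegral.integral_add (c1.intervalIntegrable _ _)
        ((c2.const_mul _).intervalIntegrable _ _), intervalIntegral.integral_const_mul,
        hf.integral_theta hyI, mul_zero, add_zero])
    (fun y hy _ => by
      have : M y < 0 := hball (by
        rw [Real.dist_eq, sub_zero, abs_lt]
        exact ⟨by linarith [hy.1], by linarith [hy.2]⟩)
      linarith)
    (by
      rw [← hmp]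
      refine tendsto_integral_of_joint ?_ hm
      filter_upwards [nhdsWithin_mono _ (fun _ h => ne_of_lt h) (inner_zero ha hb)]
        with z hz using hcuθ z hz)
    (by
      refine tendsto_integral_of_joint ?_ hp
      filter_upwards [nhdsWithin_mono _ (fun _ h => ne_of_gt h) (inner_zero ha hb)]
        with z hz using hcuθ z hz)
  refine absurd hlt (not_lt.2 (intervalIntegral.integral_mono_on Real.two_pi_pos.le
    (Continuous.intervalIntegrable ?_ _ _) (Continuous.intervalIntegrable ?_ _ _) fun t _ => ?_))
  · exact (continuous_coordExt ha hb f).comp (Continuous.prodMk_left 0)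
  · exact (continuous_coordExt ha hb f).comp (Continuous.prodMk_left y)
  · rw [coordExt_eq ha hb f t h0, coordExt_eq ha hb f t (hI y hy), hconst f t, ← hconst f 0]
    exact hmin t y (hI y hy)

/-- The operator satisfies the minimum principle. -/
theorem opA_min (h : IsFriction lam) (ha : a < 0) (hb : 0 < b) (f : (opA lam ha hb).domain)
    (x : Glued a b) (hx : ∀ y, (f : C(Glued a b, ℝ)) x ≤ (f : C(Glued a b, ℝ)) y) :
    0 ≤ opA lam ha hb f x := by
  have hf : MemDom lam (f : C(Glued a b, ℝ)) := f.2
  change 0 ≤ ext ha hb hf x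
  obtain ⟨θ, y, rfl⟩ := exists_pt x
  rw [← coord_eq]
  have hmin : ∀ t, ∀ z ∈ Icc a b, coord (f : C(Glued a b, ℝ)) θ y ≤ coord (f : C(Glued a b, ℝ)) t z := by
    intro t z hz
    rw [coord_eq, coord_eq (f : C(Glued a b, ℝ)) t ⟨z, hz⟩]
    exact hx _
  obtain ⟨y, hy⟩ := y
  rcases eq_or_ne y 0 with rfl | h0
  · refine hf.min_zero h ha hb (fun t z hz => ?_) θ
    refine le_trans (le_of_eq ?_) (hmin t z hz)
    rw [coord, dif_pos hy, coord, dif_pos hy, pt_zero_eq ha hb 0 θ]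
  rcases eq_or_ne y a with rfl | h1
  · exact (ext_eq_of_tendsto ha hb hf θ hy (inner_left ha hb) nhdsWithin_le_nhds
      (hf.lim_left θ)).ge
  rcases eq_or_ne y b with rfl | h2
  · exact (ext_eq_of_tendsto ha hb hf θ hy (inner_right ha hb) nhdsWithin_le_nhds
      (hf.lim_right θ)).ge
  · have hy' : y ∈ Inner a b :=
      ⟨⟨lt_of_le_of_ne hy.1 h1.symm, lt_of_le_of_ne hy.2 h2⟩, h0⟩
    change 0 ≤ coord _ θ y
    rw [coord_ext _ _ _ _ hy']
    exact hf.min_inner h hy' fun t z hz => hmin t z (inner_subset hz)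

end MinPrinciple

/-! ### Separation of variables: functions `g(y) cos(kθ + φ)`. -/

section Modes

variable {a b : ℝ} {lam : ℝ → ℝ}

/-- `f (θ, y) = g y * cos (k θ + φ)`. -/
def IsMode (f : C(Glued a b, ℝ)) (g : ℝ → ℝ) (k : ℤ) (φ : ℝ) : Prop :=
  ∀ θ, ∀ y ∈ Icc a b, coord f θ y = g y * Real.cos (k * θ + φ)

theorem cos_int_periodic (k : ℤ) (φ θ : ℝ) (n : ℤ) :
    Real.cos (k * (θ + n * (2 * Real.pi)) + φ) = Real.cos (k * θ + φ) := by
  rw [← Real.cos_add_int_mul_two_pi (k * θ + φ) (k * n)]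
  congr 1
  push_cast
  ring

theorem exists_mode {g : ℝ → ℝ} (hg : ContinuousOn g (Icc a b)) (k : ℤ) (φ : ℝ)
    (h0 : k = 0 ∨ g 0 = 0) : ∃ f : C(Glued a b, ℝ), IsMode f g k φ := by
  have hK : Continuous (fun p : ℝ × Icc a b => g p.2 * Real.cos (k * p.1 + φ)) := by
    have h1 : Continuous fun y : Icc a b => g y := continuousOn_iff_continuous_domRestrict.1 hg
    exact (h1.comp continuous_snd).mul (by fun_prop)
  have hfac : Function.FactorsThrough (fun p : ℝ × Icc a b => g p.2 * Real.cos (k * p.1 + φ))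
      (fun p : ℝ × Icc a b => (pt p.1 p.2 : Glued a b)) := by
    rintro ⟨θ, y⟩ ⟨θ', y'⟩ h
    rcases (Quotient.exact h : (glueSetoid a b).r _ _) with h | h
    · obtain ⟨h1, rfl⟩ := Prod.mk.inj h
      obtain ⟨n, hn⟩ := QuotientAddGroup.eq.1 h1
      have hn' : θ' = θ + n * (2 * Real.pi) := by
        simp only [zsmul_eq_mul] at hn
        linarith
      simp only [hn', cos_int_periodic]
    · have h1 : (y : ℝ) = 0 := h.1
      have h2 : (y' : ℝ) = 0 := h.2
      rcases h0 with rfl | h0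
      · simp [h1, h2]
      · simp [h1, h2, h0]
  let P : C(ℝ × Icc a b, Glued a b) := ⟨_, isQuotientMap_pt.continuous⟩
  have hP : IsQuotientMap P := isQuotientMap_pt
  refine ⟨hP.lift ⟨_, hK⟩ hfac, fun θ y hy => ?_⟩
  rw [coord, dif_pos hy]
  exact congrArg (fun k : C(ℝ × Icc a b, ℝ) => k (θ, ⟨y, hy⟩)) (hP.lift_comp ⟨_, hK⟩ hfac)

theorem ext_coord {f g : C(Glued a b, ℝ)}
    (h : ∀ θ, ∀ y ∈ Icc a b, coord f θ y = coord g θ y) : f = g := by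
  ext x
  obtain ⟨θ, y, rfl⟩ := exists_pt x
  rw [← coord_eq, ← coord_eq, h θ y y.2]

theorem hasDerivAt_cos_mode (k φ θ : ℝ) :
    HasDerivAt (fun t => Real.cos (k * t + φ)) (-(k * Real.sin (k * θ + φ))) θ := by
  have h1 : HasDerivAt (fun t => k * t + φ) k θ := by
    simpa using ((hasDerivAt_id θ).const_mul k).add_const φ
  exact h1.cos.congr_deriv (by ring)

theorem hasDerivAt_sin_mode (k φ θ : ℝ) :
    HasDerivAt (fun t => Real.sin (k * t + φ)) (k * Real.cos (k * θ + φ)) θ := by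
  have h1 : HasDerivAt (fun t => k * t + φ) k θ := by
    simpa using ((hasDerivAt_id θ).const_mul k).add_const φ
  exact h1.sin.congr_deriv (by ring)

theorem integral_cos_mode {k : ℤ} (hk : k ≠ 0) (φ : ℝ) :
    ∫ θ in (0 : ℝ)..(2 * Real.pi), Real.cos (k * θ + φ) = 0 := by
  have hk' : (k : ℝ) ≠ 0 := Int.cast_ne_zero.2 hk
  have h1 : ∀ θ ∈ uIcc (0 : ℝ) (2 * Real.pi),
      HasDerivAt (fun t => (k : ℝ)⁻¹ * Real.sin (k * t + φ)) (Real.cos (k * θ + φ)) θ :=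
    fun θ _ => ((hasDerivAt_sin_mode k φ θ).const_mul _).congr_deriv (by field_simp)
  have hc : Continuous fun θ : ℝ => Real.cos (k * θ + φ) := by fun_prop
  rw [intervalIntegral.integral_eq_sub_of_hasDerivAt h1 (hc.intervalIntegrable _ _)]
  have : Real.sin (k * (2 * Real.pi) + φ) = Real.sin (k * 0 + φ) := by
    rw [← Real.sin_add_int_mul_two_pi (k * 0 + φ) k]
    congr 1
    ring
  rw [this, sub_self]

/-- Conditions on the height profile of a mode for the mode to belong to the domain;
`p = D_u g`, `r = D_u D_u g`, and `s` is the profile of the image under `A`. -/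
structure IsProfile (a b : ℝ) (lam : ℝ → ℝ) (k : ℤ) (g p r s : ℝ → ℝ) : Prop where
  deriv_g : ∀ y ∈ Inner a b, HasDerivAt g (p y * lamTilde lam y) y
  deriv_p : ∀ y ∈ Inner a b, HasDerivAt p (r y * lamTilde lam y) y
  cont_r : ContinuousOn r (Inner a b)
  eq_s : ∀ y ∈ Inner a b, s y = r y / 2 - (k : ℝ) ^ 2 / lamTilde lam y ^ 2 * g y
  lim_p : ∃ pm pp, Tendsto p (𝓝[<] 0) (𝓝 pm) ∧ Tendsto p (𝓝[>] 0) (𝓝 pp) ∧ (k = 0 → pm = pp)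
  lim_s : ∃ l, Tendsto s (𝓝[≠] 0) (𝓝 l) ∧ (k ≠ 0 → l = 0)
  lim_left : Tendsto s (𝓝[>] a) (𝓝 0)
  lim_right : Tendsto s (𝓝[<] b) (𝓝 0)

theorem tendsto_mul_cos {H : ℝ × ℝ → ℝ} {q : ℝ → ℝ} {k φ θ l : ℝ} {Φ : Filter ℝ}
    {S : Set ℝ} (hS : S ∈ Φ) (e : ∀ t, ∀ y ∈ S, H (t, y) = q y * Real.cos (k * t + φ))
    (hq : Tendsto q Φ (𝓝 l)) :
    Tendsto H (𝓝 θ ×ˢ Φ) (𝓝 (l * Real.cos (k * θ + φ))) := by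
  have hc : Continuous fun t : ℝ => Real.cos (k * t + φ) := by fun_prop
  refine ((hq.comp tendsto_snd).mul ((hc.tendsto θ).comp tendsto_fst)).congr' ?_
  filter_upwards [prod_mem_prod univ_mem hS] with p hp using (e p.1 p.2 hp.2).symm

theorem continuousOn_mul_cos {H : ℝ × ℝ → ℝ} {q : ℝ → ℝ} {k φ : ℝ} {S : Set ℝ}
    (e : ∀ t, ∀ y ∈ S, H (t, y) = q y * Real.cos (k * t + φ)) (hq : ContinuousOn q S) :
    ContinuousOn H (univ ×ˢ S) := by
  have hc : Continuous fun p : ℝ × ℝ => Real.cos (k * p.1 + φ) := by fun_prop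
  exact ((hq.comp continuousOn_snd fun p hp => hp.2).mul hc.continuousOn).congr
    fun p hp => e p.1 p.2 hp.2

/-- On a mode every derivative acts on the profile alone and the factor `cos(kθ + φ)` persists.
Hence for `k ≠ 0` a `θ`-independent limit at the centre must be `0`, while the gluing condition
holds whatever the one-sided limits are. -/
theorem IsMode.memDom (h : IsFriction lam) (ha : a < 0) (hb : 0 < b) {f : C(Glued a b, ℝ)}
    {g p r s : ℝ → ℝ} {k : ℤ} {φ : ℝ} (hf : IsMode f g k φ) (hg : IsProfile a b lam k g p r s) :
    MemDom lam f ∧ ∀ θ, ∀ y ∈ Inner a b, expr lam f θ y = s y * Real.cos (k * θ + φ) := by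
  have d1 : ∀ θ, ∀ y ∈ Inner a b, HasDerivAt (coord f θ)
      (p y * Real.cos (k * θ + φ) * lamTilde lam y) y := fun θ y hy => by
    refine (((hg.deriv_g y hy).mul_const (Real.cos (k * θ + φ))).congr_deriv
      (by ring)).congr_of_eventuallyEq ?_
    filter_upwards [isOpen_inner.mem_nhds hy] with z hz using hf θ z (inner_subset hz)
  have hu : ∀ θ, ∀ y ∈ Inner a b,
      HasDerivWrt (uTilde lam) (coord f θ) (p y * Real.cos (k * θ + φ)) y := fun θ y hy =>
    (h.hasDerivWrt_u hy.2).2 (d1 θ y hy)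
  have hv : ∀ θ, ∀ y ∈ Inner a b,
      HasDerivWrt (vTilde lam) (coord f θ) (p y / 2 * Real.cos (k * θ + φ)) y := fun θ y hy =>
    (h.hasDerivWrt_v hy.2).2 ((d1 θ y hy).congr_deriv (by ring))
  have huv : ∀ θ, ∀ y ∈ Inner a b, HasDerivWrt (uTilde lam) (derivWrt (vTilde lam) (coord f θ))
      (r y / 2 * Real.cos (k * θ + φ)) y := fun θ y hy => by
    refine (h.hasDerivWrt_u hy.2).2 ?_
    refine (((hg.deriv_p y hy).const_mul (Real.cos (k * θ + φ) / 2)).congr_deriv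
      (by ring)).congr_of_eventuallyEq ?_
    filter_upwards [isOpen_inner.mem_nhds hy] with z hz
    rw [(hv θ z hz).derivWrt]
    ring
  have eθ : ∀ y ∈ Inner a b, (fun t => coord f t y) = fun t => g y * Real.cos (k * t + φ) :=
    fun y hy => funext fun t => hf t y (inner_subset hy)
  have dθ : ∀ y ∈ Inner a b, deriv (fun t => coord f t y)
      = fun t => g y * -(k * Real.sin (k * t + φ)) := fun y hy => by
    rw [eθ y hy]
    exact funext fun t => ((hasDerivAt_cos_mode k φ t).const_mul _).deriv
  have dθθ : ∀ θ, ∀ y ∈ Inner a b, iteratedDeriv 2 (fun t => coord f t y) θ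
      = -(k : ℝ) ^ 2 * g y * Real.cos (k * θ + φ) := fun θ y hy => by
    rw [iteratedDeriv_succ, iteratedDeriv_one, dθ y hy]
    refine HasDerivAt.deriv ?_
    exact (((hasDerivAt_sin_mode k φ θ).const_mul (k : ℝ)).neg.const_mul (g y)).congr_deriv
      (by ring)
  have he : ∀ θ, ∀ y ∈ Inner a b, expr lam f θ y = s y * Real.cos (k * θ + φ) := fun θ y hy => by
    rw [expr, (huv θ y hy).derivWrt, dθθ θ y hy, hg.eq_s y hy]
    ring
  have cg : ContinuousOn g (Inner a b) := fun y hy =>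
    (hg.deriv_g y hy).continuousAt.continuousWithinAt
  have cp : ContinuousOn p (Inner a b) := fun y hy =>
    (hg.deriv_p y hy).continuousAt.continuousWithinAt
  have cl : ContinuousOn (fun y => (k : ℝ) ^ 2 / lamTilde lam y ^ 2) (Inner a b) :=
    continuousOn_const.div (h.continuous_lamTilde.continuousOn.pow 2)
      fun y hy => (pow_pos (h.lamTilde_pos hy.2) 2).ne'
  have cs : ContinuousOn s (Inner a b) :=
    ((hg.cont_r.div_const 2).sub (cl.mul cg)).congr hg.eq_s
  obtain ⟨pm, pp, hpm, hpp, hpe⟩ := hg.lim_p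
  obtain ⟨l, hl, hl0⟩ := hg.lim_s
  refine ⟨?_, he⟩
  constructor
  · exact fun θ y hy => ⟨_, hv θ y hy⟩
  · exact fun θ y hy => ⟨_, huv θ y hy⟩
  · intro y hy
    rw [eθ y hy]
    fun_prop
  · exact continuousOn_mul_cos (fun θ y hy => (hv θ y hy).derivWrt) (cp.div_const 2)
  · exact continuousOn_mul_cos (fun θ y hy => (huv θ y hy).derivWrt) (hg.cont_r.div_const 2)
  · refine ContinuousOn.congr (f := fun q : ℝ × ℝ => g q.2 * -(k * Real.sin (k * q.1 + φ))) ?_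
      fun q hq => congrFun (dθ q.2 hq.2) q.1
    exact (cg.comp continuousOn_snd fun q hq => hq.2).mul (by fun_prop)
  · exact continuousOn_mul_cos dθθ (cg.const_mul _)
  · exact continuousOn_mul_cos he cs
  · refine ⟨fun θ => pm * Real.cos (k * θ + φ), fun θ => pp * Real.cos (k * θ + φ),
      fun θ => ?_, fun θ => ?_, ?_⟩
    · exact tendsto_mul_cos (nhdsWithin_mono _ (fun _ h => ne_of_lt h) (inner_zero ha hb))
        (fun t y hy => (hu t y hy).derivWrt) hpm
    · exact tendsto_mul_cos (nhdsWithin_mono _ (fun _ h => ne_of_gt h) (inner_zero ha hb))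
        (fun t y hy => (hu t y hy).derivWrt) hpp
    · rw [intervalIntegral.integral_const_mul, intervalIntegral.integral_const_mul]
      rcases eq_or_ne k 0 with hk | hk
      · rw [hpe hk]
      · rw [integral_cos_mode hk, mul_zero, mul_zero]
  · rcases eq_or_ne k 0 with hk | hk
    · refine ⟨l * Real.cos φ, fun θ => ?_⟩
      have := tendsto_mul_cos (H := fun p => expr lam f p.1 p.2) (θ := θ) (inner_zero ha hb) he hl
      simpa [hk] using this
    · refine ⟨0, fun θ => ?_⟩
      have := tendsto_mul_cos (H := fun p => expr lam f p.1 p.2) (θ := θ) (inner_zero ha hb) he hl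
      rwa [hl0 hk, zero_mul] at this
  · intro θ
    have := tendsto_mul_cos (H := fun p => expr lam f p.1 p.2) (θ := θ) (inner_left ha hb) he hg.lim_left
    rwa [zero_mul] at this
  · intro θ
    have := tendsto_mul_cos (H := fun p => expr lam f p.1 p.2) (θ := θ) (inner_right ha hb) he hg.lim_right
    rwa [zero_mul] at this

/-- A solution of the profile equation gives a solution of the resolvent equation. -/
theorem IsMode.mem_range (h : IsFriction lam) (ha : a < 0) (hb : 0 < b) {F : C(Glued a b, ℝ)}
    {g p r H : ℝ → ℝ} {k : ℤ} {φ μ : ℝ} (hF : IsMode F H k φ)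
    (hgc : ContinuousOn g (Icc a b)) (h0 : k = 0 ∨ g 0 = 0)
    (hg : IsProfile a b lam k g p r fun y => μ * g y - H y) :
    F ∈ range fun f : (opA lam ha hb).domain => μ • (f : C(Glued a b, ℝ)) - opA lam ha hb f := by
  obtain ⟨f, hf⟩ := exists_mode hgc k φ h0
  obtain ⟨hm, he⟩ := hf.memDom h ha hb hg
  refine ⟨⟨f, hm⟩, ?_⟩
  change μ • f - ext ha hb hm = F
  refine ext_inner ha hb fun θ y hy => ?_
  have e : μ • f - ext ha hb hm = (-1 : ℝ) • ext ha hb hm + μ • f := by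
    rw [neg_one_smul]; abel
  have e2 : coord (μ • f) θ y = μ * coord f θ y := by
    simp [coord]
  rw [e, coord_comb, e2, coord_ext _ _ _ _ hy, he θ y hy, hf θ y (inner_subset hy),
    hF θ y (inner_subset hy)]
  ring

end Modes

/-! ### Density of the domain through Stone–Weierstrass. -/

section Density

variable {a b : ℝ} {lam : ℝ → ℝ}

/-- The function `K(x - c)²`, cut off at radius `ε`, is uniformly of size `ε²` while its second
derivative at `c` stays `2K`. This repairs a second-order boundary condition at negligible cost in
norm. -/
theorem exists_parabola_bump (c K : ℝ) {ε : ℝ} (hε : 0 < ε) : ∃ B : ℝ → ℝ, ContDiff ℝ 2 B ∧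
    (∀ x, |B x| ≤ |K| * ε ^ 2) ∧ (∀ x, ε ≤ |x - c| → B x = 0) ∧ B c = 0 ∧
    iteratedDeriv 2 B c = 2 * K := by
  let χ : ContDiffBump c := ⟨ε / 2, ε, half_pos hε, half_lt_self hε⟩
  have h0 : ∀ x, ε ≤ |x - c| → χ x = 0 := fun x hx =>
    χ.zero_of_le_dist (by rwa [Real.dist_eq])
  refine ⟨fun x => K * (x - c) ^ 2 * χ x, ?_, fun x => ?_, fun x hx => ?_, by simp, ?_⟩
  · have := χ.contDiff (n := 2)
    fun_prop
  · rcases le_or_gt ε |x - c| with hx | hx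
    · simp only [h0 x hx, mul_zero, abs_zero]
      positivity
    · rw [abs_mul, abs_mul, abs_of_nonneg χ.nonneg, abs_pow]
      calc _ ≤ |K| * ε ^ 2 * 1 := by
            gcongr
            all_goals first | exact χ.nonneg | exact χ.le_one
        _ = _ := mul_one _
  · simp only [h0 x hx, mul_zero]
  · have e : (fun x => K * (x - c) ^ 2 * χ x) =ᶠ[𝓝 c] fun x => K * (x - c) ^ 2 := by
      filter_upwards [χ.eventuallyEq_one] with x hx
      simp [hx]
    rw [e.iteratedDeriv_eq, iteratedDeriv_succ, iteratedDeriv_one]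
    have d1 : deriv (fun x => K * (x - c) ^ 2) = fun x => K * (2 * (x - c)) := by
      funext x
      refine HasDerivAt.deriv ?_
      have := (((hasDerivAt_id x).sub_const c).pow 2).const_mul K
      simpa using this
    rw [d1]
    refine HasDerivAt.deriv ?_
    have := (((hasDerivAt_id c).sub_const c).const_mul 2).const_mul K
    exact this.congr_deriv (by ring)

/-- Profiles that are `C²` functions of `u`. -/
theorem isProfile_comp (h : IsFriction lam) (ha : a < 0) (hb : 0 < b) {H : ℝ → ℝ} {k : ℤ}
    (hH : ContDiff ℝ 2 H) (h0 : k = 0 ∨ H =ᶠ[𝓝 0] 0)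
    (hla : iteratedDeriv 2 H (uTilde lam a) / 2
      = (k : ℝ) ^ 2 / lamTilde lam a ^ 2 * H (uTilde lam a))
    (hlb : iteratedDeriv 2 H (uTilde lam b) / 2
      = (k : ℝ) ^ 2 / lamTilde lam b ^ 2 * H (uTilde lam b)) :
    IsProfile a b lam k (fun y => H (uTilde lam y)) (fun y => deriv H (uTilde lam y))
      (fun y => iteratedDeriv 2 H (uTilde lam y))
      (fun y => iteratedDeriv 2 H (uTilde lam y) / 2
        - (k : ℝ) ^ 2 / lamTilde lam y ^ 2 * H (uTilde lam y)) := by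
  have hu := h.continuous_uTilde
  have h2 : Continuous (iteratedDeriv 2 H) := hH.continuous_iteratedDeriv 2 le_rfl
  have hH' : ContDiff ℝ 1 (deriv H) :=
    ((contDiff_succ_iff_deriv (n := 1)).1 (by simpa [one_add_one_eq_two] using hH)).2.2
  have hs : ∀ y, y ≠ 0 → ContinuousAt (fun y => iteratedDeriv 2 H (uTilde lam y) / 2
        - (k : ℝ) ^ 2 / lamTilde lam y ^ 2 * H (uTilde lam y)) y := fun y hy => by
    refine ((h2.comp hu).continuousAt.div_const 2).sub (ContinuousAt.mul
      (continuousAt_const.div (h.continuous_lamTilde.continuousAt.pow 2)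
        (pow_pos (h.lamTilde_pos hy) 2).ne') (hH.continuous.comp hu).continuousAt)
  refine ⟨fun y _ => ?_, fun y _ => ?_, (h2.comp hu).continuousOn, fun _ _ => rfl, ?_, ?_, ?_, ?_⟩
  · exact ((hH.differentiable (by norm_num)) _).hasDerivAt.comp y (h.hasDerivAt_uTilde y)
  · rw [iteratedDeriv_succ, iteratedDeriv_one]
    exact ((hH'.differentiable (by norm_num)) _).hasDerivAt.comp y (h.hasDerivAt_uTilde y)
  · have hp : Tendsto (fun y => deriv H (uTilde lam y)) (𝓝 0) (𝓝 (deriv H (uTilde lam 0))) :=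
      (hH'.continuous.comp hu).tendsto 0
    exact ⟨_, _, hp.mono_left nhdsWithin_le_nhds, hp.mono_left nhdsWithin_le_nhds, fun _ => rfl⟩
  · rcases h0 with rfl | h0
    · refine ⟨iteratedDeriv 2 H (uTilde lam 0) / 2, ?_, fun h => absurd rfl h⟩
      have := ((h2.comp hu).div_const 2).tendsto 0
      simpa using this.mono_left nhdsWithin_le_nhds
    · refine ⟨0, ?_, fun _ => rfl⟩
      have h3 : ∀ᶠ x in 𝓝 (0 : ℝ), iteratedDeriv 2 H x = 0 ∧ H x = 0 := by
        filter_upwards [h0.eventually_nhds, h0] with x hx hx0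
        refine ⟨?_, hx0⟩
        rw [EventuallyEq.iteratedDeriv_eq 2 hx]
        simp
      have h4 : Tendsto (uTilde lam) (𝓝 0) (𝓝 0) := by
        simpa [uTilde_zero] using hu.tendsto 0
      refine (tendsto_const_nhds.congr' ?_).mono_left nhdsWithin_le_nhds
      filter_upwards [h4.eventually h3] with y hy
      rw [hy.1, hy.2]
      simp
  · have := (hs a ha.ne).tendsto
    rw [hla, sub_self] at this
    exact this.mono_left nhdsWithin_le_nhds
  · have := (hs b hb.ne').tendsto
    rw [hlb, sub_self] at this
    exact this.mono_left nhdsWithin_le_nhds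

/-- Modes whose profile is a `C²` function of `u` that vanishes near the centre unless the mode
is rotationally symmetric. -/
def smoothModes (a b : ℝ) (lam : ℝ → ℝ) : Set C(Glued a b, ℝ) :=
  {f | ∃ (H : ℝ → ℝ) (k : ℤ) (φ : ℝ), ContDiff ℝ 2 H ∧ (k = 0 ∨ H =ᶠ[𝓝 0] 0) ∧
    IsMode f (fun y => H (uTilde lam y)) k φ}

theorem exists_smoothMode (h : IsFriction lam) {H : ℝ → ℝ} {k : ℤ} (φ : ℝ)
    (hH : ContDiff ℝ 2 H) (h0 : k = 0 ∨ H =ᶠ[𝓝 0] 0) :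
    ∃ f : C(Glued a b, ℝ), IsMode f (fun y => H (uTilde lam y)) k φ :=
  exists_mode (hH.continuous.comp h.continuous_uTilde).continuousOn k φ
    (h0.imp id fun h => by simpa [uTilde_zero] using h.self_of_nhds)

theorem coord_mul (f g : C(Glued a b, ℝ)) (θ y : ℝ) :
    coord (f * g) θ y = coord f θ y * coord g θ y := by
  unfold coord
  split_ifs <;> simp

theorem coord_add (f g : C(Glued a b, ℝ)) (θ y : ℝ) :
    coord (f + g) θ y = coord f θ y + coord g θ y := by
  unfold coord
  split_ifs <;> simp

/-- The identity `2 cos x cos y = cos(x + y) + cos(x - y)` yields modes with indices `k + l` and `k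
- l`. The profile product vanishes near `0` unless `k = l = 0`, so the side condition survives. -/
theorem smoothModes_mul (h : IsFriction lam) {f g : C(Glued a b, ℝ)}
    (hf : f ∈ smoothModes a b lam) (hg : g ∈ smoothModes a b lam) :
    f * g ∈ Submodule.span ℝ (smoothModes a b lam) := by
  obtain ⟨H, k, φ, hH, hH0, hf⟩ := hf
  obtain ⟨K, l, ψ, hK, hK0, hg⟩ := hg
  have hc : ContDiff ℝ 2 fun x => H x * K x / 2 := (hH.mul hK).div_const 2
  have h0 : (k = 0 ∧ l = 0) ∨ (fun x => H x * K x / 2) =ᶠ[𝓝 0] 0 := by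
    rcases hH0 with hk | hH0
    · rcases hK0 with hl | hK0
      · exact Or.inl ⟨hk, hl⟩
      · right; filter_upwards [hK0] with x hx; simp [hx]
    · right; filter_upwards [hH0] with x hx; simp [hx]
  obtain ⟨m, hm⟩ := exists_smoothMode (a := a) (b := b) h (k := k + l) (φ + ψ) hc
    (h0.imp (fun h => by omega) id)
  obtain ⟨n, hn⟩ := exists_smoothMode (a := a) (b := b) h (k := k - l) (φ - ψ) hc
    (h0.imp (fun h => by omega) id)
  have e : f * g = m + n := by
    refine ext_coord fun θ y hy => ?_
    rw [coord_mul, coord_add, hf θ y hy, hg θ y hy, hm θ y hy, hn θ y hy]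
    have h1 := Real.cos_add (k * θ + φ) (l * θ + ψ)
    have h2 := Real.cos_sub (k * θ + φ) (l * θ + ψ)
    rw [show ((k + l : ℤ) : ℝ) * θ + (φ + ψ) = (k * θ + φ) + (l * θ + ψ) by push_cast; ring,
      show ((k - l : ℤ) : ℝ) * θ + (φ - ψ) = (k * θ + φ) - (l * θ + ψ) by push_cast; ring, h1, h2]
    ring
  rw [e]
  exact Submodule.add_mem _
    (Submodule.subset_span ⟨_, _, _, hc, h0.imp (fun h => by omega) id, hm⟩)
    (Submodule.subset_span ⟨_, _, _, hc, h0.imp (fun h => by omega) id, hn⟩)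

theorem one_mem_smoothModes : (1 : C(Glued a b, ℝ)) ∈ smoothModes a b lam :=
  ⟨fun _ => 1, 0, 0, contDiff_const, Or.inl rfl, fun θ y hy => by simp [coord, hy.1, hy.2]⟩

/-- The algebra spanned by the smooth modes. -/
def smoothModesAlgebra (a b : ℝ) (h : IsFriction lam) : Subalgebra ℝ C(Glued a b, ℝ) :=
  (Submodule.span ℝ (smoothModes a b lam)).toSubalgebra
    (Submodule.subset_span one_mem_smoothModes) fun f g hf hg => by
      have h1 := Submodule.mul_mem_mul hf hg
      rw [Submodule.span_mul_span] at h1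
      refine Submodule.span_le.2 ?_ h1
      rintro _ ⟨f, hf, g, hg, rfl⟩
      exact smoothModes_mul h hf hg

theorem exists_mem_smoothModes (h : IsFriction lam) {H : ℝ → ℝ} {k : ℤ} (φ : ℝ)
    (hH : ContDiff ℝ 2 H) (h0 : k = 0 ∨ H =ᶠ[𝓝 0] 0) :
    ∃ f ∈ smoothModesAlgebra a b h, ∀ θ (y : Icc a b),
      f (pt θ y) = H (uTilde lam y) * Real.cos (k * θ + φ) := by
  obtain ⟨f, hf⟩ := exists_smoothMode (a := a) (b := b) h φ hH h0
  refine ⟨f, Submodule.subset_span ⟨H, k, φ, hH, h0, hf⟩, fun θ y => ?_⟩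
  rw [← coord_eq, hf θ y y.2]

theorem separatesPoints_smoothModesAlgebra (h : IsFriction lam) (ha : a < 0) (hb : 0 < b) :
    (smoothModesAlgebra a b h).SeparatesPoints := by
  intro x x' hne
  obtain ⟨θ, y, rfl⟩ := exists_pt x
  obtain ⟨θ', y', rfl⟩ := exists_pt x'
  have hinj := h.strictMono_uTilde.injective
  by_contra! hcon
  have key : ∀ {H : ℝ → ℝ} {k : ℤ} (φ : ℝ), ContDiff ℝ 2 H → (k = 0 ∨ H =ᶠ[𝓝 0] 0) →
      H (uTilde lam y) * Real.cos (k * θ + φ) = H (uTilde lam y') * Real.cos (k * θ' + φ) := by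
    intro H k φ hH h0
    obtain ⟨f, hf, e⟩ := exists_mem_smoothModes (a := a) (b := b) h φ hH h0
    rw [← e, ← e]
    exact hcon _ ⟨f, hf, rfl⟩
  -- The mode `ũ` itself separates heights.
  have h1 := key (H := fun x => x) (k := 0) 0 contDiff_id (Or.inl rfl)
  simp only [Int.cast_zero, zero_mul, zero_add, Real.cos_zero, mul_one] at h1
  obtain rfl : y = y' := Subtype.ext (hinj h1)
  have hy0 : (y : ℝ) ≠ 0 := by
    intro hy0
    have : y = ⟨0, ha.le, hb.le⟩ := Subtype.ext hy0
    exact hne (by rw [this]; exact pt_zero_eq ha hb θ θ')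
  have hc0 : uTilde lam y ≠ 0 := fun h0 => hy0 (hinj (h0.trans uTilde_zero.symm))
  have hpos : 0 < |uTilde lam y| := abs_pos.2 hc0
  -- A bump equal to `1` at the common height and zero near the centre, so that it is an admissible
  -- profile for `k = 1`.
  let χ : ContDiffBump (uTilde lam y) :=
    ⟨|uTilde lam y| / 3, |uTilde lam y| / 2, by positivity, by linarith⟩
  have hχ1 : χ (uTilde lam y) = 1 := χ.one_of_mem_closedBall (Metric.mem_closedBall_self χ.rIn_pos.le)
  have hχ0 : (χ : ℝ → ℝ) =ᶠ[𝓝 0] 0 := by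
    filter_upwards [Metric.ball_mem_nhds (0 : ℝ) (half_pos hpos)] with x hx
    refine χ.zero_of_le_dist ?_
    rw [Metric.mem_ball, dist_zero_right, Real.norm_eq_abs] at hx
    change |uTilde lam y| / 2 ≤ dist x (uTilde lam y)
    rw [dist_comm, Real.dist_eq]
    have := abs_sub_abs_le_abs_sub (uTilde lam y) x
    linarith
  have h2 := key (H := χ) (k := 1) 0 χ.contDiff (Or.inr hχ0)
  -- The phases `0` and `-π/2` recover `cos θ` and `sin θ`, which determine `θ` modulo `2π`.
  have h3 := key (H := χ) (k := 1) (-(Real.pi / 2)) χ.contDiff (Or.inr hχ0)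
  simp only [hχ1, Int.cast_one, one_mul, add_zero, ← sub_eq_add_neg, Real.cos_sub_pi_div_two]
    at h2 h3
  obtain ⟨n, hn⟩ := Real.Angle.angle_eq_iff_two_pi_dvd_sub.1 (Real.Angle.cos_sin_inj h2 h3)
  refine hne ?_
  have : (θ : AddCircle (2 * Real.pi)) = θ' := by
    refine QuotientAddGroup.eq.2 ⟨-n, ?_⟩
    simp only [zsmul_eq_mul, Int.cast_neg]
    linarith
  exact congrArg (fun t => Quotient.mk (glueSetoid a b) (t, y)) this

theorem dense_span_smoothModes (h : IsFriction lam) (ha : a < 0) (hb : 0 < b) :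
    Dense (Submodule.span ℝ (smoothModes a b lam) : Set C(Glued a b, ℝ)) := by
  have h1 := ContinuousMap.subalgebra_topologicalClosure_eq_top_of_separatesPoints _
    (separatesPoints_smoothModesAlgebra h ha hb)
  have h2 : ((smoothModesAlgebra a b h).topologicalClosure : Set C(Glued a b, ℝ)) = univ := by
    rw [h1]; rfl
  rw [Subalgebra.topologicalClosure_coe] at h2
  exact dense_iff_closure_eq.2 h2

theorem dense_of_smoothModes (h : IsFriction lam) (ha : a < 0) (hb : 0 < b)
    {S : Submodule ℝ C(Glued a b, ℝ)}
    (hS : smoothModes a b lam ⊆ closure (S : Set C(Glued a b, ℝ))) :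
    Dense (S : Set C(Glued a b, ℝ)) := by
  have h1 : Submodule.span ℝ (smoothModes a b lam) ≤ S.topologicalClosure :=
    Submodule.span_le.2 hS
  have h2 : Dense (closure (S : Set C(Glued a b, ℝ))) :=
    (dense_span_smoothModes h ha hb).mono h1
  exact dense_closure.1 h2

/-- A smooth mode can fail to belong to the domain only because `Af ≠ 0` at the ends; a bump in `ũ`
at each end cancels this defect. -/
theorem smoothModes_subset_closure_dom (h : IsFriction lam) (ha : a < 0) (hb : 0 < b) :
    smoothModes a b lam ⊆ closure (dom lam ha hb : Set C(Glued a b, ℝ)) := by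
  rintro f ⟨H, k, φ, hH, h0, hf⟩
  set α := uTilde lam a
  set β := uTilde lam b
  have hα : α < 0 := by simpa [uTilde_zero] using h.strictMono_uTilde ha
  have hβ : 0 < β := by simpa [uTilde_zero] using h.strictMono_uTilde hb
  -- The defect of the end condition `H''/2 = k² λ̃⁻² H`: a bump with zero value and second
  -- derivative `2Kα` at `α` cancels it.
  set Kα := (k : ℝ) ^ 2 / lamTilde lam a ^ 2 * H α - iteratedDeriv 2 H α / 2 with hKα
  set Kβ := (k : ℝ) ^ 2 / lamTilde lam b ^ 2 * H β - iteratedDeriv 2 H β / 2 with hKβ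
  have key : ∀ ε : ℝ, 0 < ε → ε < -α → ε < β →
      ∃ F ∈ dom lam ha hb, dist f F ≤ (|Kα| + |Kβ|) * ε ^ 2 := by
    intro ε hε h1 h2
    obtain ⟨A, hA, hA1, hA2, hA3, hA4⟩ := exists_parabola_bump α Kα hε
    obtain ⟨B, hB, hB1, hB2, hB3, hB4⟩ := exists_parabola_bump β Kβ hε
    have near : ∀ {c x : ℝ} {D : ℝ → ℝ}, (∀ x, ε ≤ |x - c| → D x = 0) → ε < |x - c| →
        D =ᶠ[𝓝 x] 0 := by
      intro c x D hD hx
      have : Continuous fun x => |x - c| := by fun_prop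
      filter_upwards [this.continuousAt.eventually (lt_mem_nhds hx)] with z hz using hD z hz.le
    have nA0 : A =ᶠ[𝓝 0] 0 := near hA2 (by rw [zero_sub, abs_of_pos (by linarith)]; exact h1)
    have nB0 : B =ᶠ[𝓝 0] 0 := near hB2 (by rw [zero_sub, abs_neg, abs_of_pos hβ]; exact h2)
    have nAβ : A =ᶠ[𝓝 β] 0 := near hA2 (by rw [abs_of_pos (by linarith)]; linarith)
    have nBα : B =ᶠ[𝓝 α] 0 := near hB2 (by rw [abs_sub_comm, abs_of_pos (by linarith)]; linarith)
    have hG : ContDiff ℝ 2 (H + (A + B)) := hH.add (hA.add hB)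
    have hG0 : k = 0 ∨ H + (A + B) =ᶠ[𝓝 0] 0 := h0.imp id fun h0 => by
      filter_upwards [h0, nA0, nB0] with x k1 k2 k3
      simp [k1, k2, k3]
    obtain ⟨F, hF⟩ := exists_smoothMode (a := a) (b := b) h φ hG hG0
    have d2 : ∀ x, iteratedDeriv 2 (H + (A + B)) x
        = iteratedDeriv 2 H x + (iteratedDeriv 2 A x + iteratedDeriv 2 B x) := fun x => by
      have hAB : ContDiff ℝ 2 (A + B) := hA.add hB
      rw [iteratedDeriv_add hH.contDiffAt hAB.contDiffAt,
        iteratedDeriv_add hA.contDiffAt hB.contDiffAt]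
    refine ⟨F, (hF.memDom h ha hb (isProfile_comp h ha hb hG hG0 ?_ ?_)).1, ?_⟩
    · change iteratedDeriv 2 (H + (A + B)) α / 2 = _ * (H α + (A α + B α))
      have e2 : iteratedDeriv 2 B α = 0 := by
        rw [EventuallyEq.iteratedDeriv_eq 2 nBα]; simp
      have e3 : B α = 0 := nBα.self_of_nhds
      rw [d2, hA4, e2, hA3, e3, hKα]
      ring
    · change iteratedDeriv 2 (H + (A + B)) β / 2 = _ * (H β + (A β + B β))
      have e2 : iteratedDeriv 2 A β = 0 := by
        rw [EventuallyEq.iteratedDeriv_eq 2 nAβ]; simp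
      have e3 : A β = 0 := nAβ.self_of_nhds
      rw [d2, hB4, e2, hB3, e3, hKβ]
      ring
    · rw [ContinuousMap.dist_le (by positivity)]
      intro x
      obtain ⟨θ, y, rfl⟩ := exists_pt x
      rw [← coord_eq, ← coord_eq, hf θ y y.2, hF θ y y.2, Real.dist_eq, ← sub_mul, abs_mul]
      have k1 := hA1 (uTilde lam y)
      have k2 := hB1 (uTilde lam y)
      have k3 : |H (uTilde lam y) - (H + (A + B)) (uTilde lam y)|
          ≤ |Kα| * ε ^ 2 + |Kβ| * ε ^ 2 := by
        simp only [Pi.add_apply, sub_add_cancel_left, abs_neg]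
        exact (abs_add_le _ _).trans (add_le_add k1 k2)
      calc _ ≤ (|Kα| * ε ^ 2 + |Kβ| * ε ^ 2) * 1 :=
            mul_le_mul k3 (Real.abs_cos_le_one _) (abs_nonneg _) (by positivity)
        _ = _ := by ring
  rw [Metric.mem_closure_iff]
  intro η hη
  have hlim : Tendsto (fun ε : ℝ => (|Kα| + |Kβ|) * ε ^ 2) (𝓝[>] 0) (𝓝 0) := by
    have : Continuous fun ε : ℝ => (|Kα| + |Kβ|) * ε ^ 2 := by fun_prop
    simpa using (this.tendsto 0).mono_left nhdsWithin_le_nhds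
  have hα' : ∀ᶠ ε : ℝ in 𝓝[>] 0, ε ∈ Ioo 0 (-α) := Ioo_mem_nhdsGT (neg_pos.2 hα)
  have hβ' : ∀ᶠ ε : ℝ in 𝓝[>] 0, ε ∈ Ioo 0 β := Ioo_mem_nhdsGT hβ
  obtain ⟨ε, e1, e2, e3⟩ := ((hlim.eventually (gt_mem_nhds hη)).and (hα'.and hβ')).exists
  obtain ⟨F, hF, hd⟩ := key ε e2.1 e2.2 e3.2
  exact ⟨F, hF, hd.trans_lt e1⟩

theorem dense_dom (h : IsFriction lam) (ha : a < 0) (hb : 0 < b) :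
    Dense (dom lam ha hb : Set C(Glued a b, ℝ)) :=
  dense_of_smoothModes h ha hb (smoothModes_subset_closure_dom h ha hb)

theorem one_mem_graph (h : IsFriction lam) (ha : a < 0) (hb : 0 < b) :
    ((1 : C(Glued a b, ℝ)), (0 : C(Glued a b, ℝ))) ∈ (opA lam ha hb).graph := by
  have hm : IsMode (1 : C(Glued a b, ℝ)) (fun y => (fun _ => (1 : ℝ)) (uTilde lam y)) 0 0 :=
    fun θ y hy => by simp [coord, hy.1, hy.2]
  have hp := isProfile_comp (k := 0) h ha hb (contDiff_const (c := (1 : ℝ))) (Or.inl rfl)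
    (by simp [iteratedDeriv_const]) (by simp [iteratedDeriv_const])
  obtain ⟨h1, h2⟩ := hm.memDom h ha hb hp
  have : opA lam ha hb ⟨1, h1⟩ = 0 := by
    refine ext_inner ha hb fun θ y hy => ?_
    change coord (ext ha hb h1) θ y = _
    rw [coord_ext _ _ _ _ hy, h2 θ y hy]
    simp [coord, iteratedDeriv_const]
  rw [LinearPMap.mem_graph_iff]
  exact ⟨⟨1, h1⟩, rfl, this⟩

/-- The range is a linear subspace, so solving the resolvent equation for the modes alone suffices,
their span being dense. -/
theorem dense_range_sub (h : IsFriction lam) (ha : a < 0) (hb : 0 < b) (μ : ℝ)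
    (hμ : smoothModes a b lam ⊆
      range fun f : (opA lam ha hb).domain => μ • (f : C(Glued a b, ℝ)) - opA lam ha hb f) :
    Dense (range fun f : (opA lam ha hb).domain =>
      μ • (f : C(Glued a b, ℝ)) - opA lam ha hb f) := by
  let R : (opA lam ha hb).domain →ₗ[ℝ] C(Glued a b, ℝ) :=
    μ • (opA lam ha hb).domain.subtype - (opA lam ha hb).toFun
  have e : (LinearMap.range R : Set C(Glued a b, ℝ)) = range fun f : (opA lam ha hb).domain =>
      μ • (f : C(Glued a b, ℝ)) - opA lam ha hb f := LinearMap.coe_range R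
  rw [← e] at hμ ⊢
  exact dense_of_smoothModes h ha hb (hμ.trans subset_closure)

end Density

/-! ### Linear differential equations on a half-line and with a singular endpoint. -/

section ODE

open scoped BoundedContinuousFunction

/-- Global forward solutions of equations with a locally bounded Lipschitz constant. -/
theorem exists_forward_solution {E : Type*} [NormedAddCommGroup E] [NormedSpace ℝ E]
    [CompleteSpace E] {f : ℝ → E → E} (hf : Continuous fun p : ℝ × E => f p.1 p.2)
    (hf0 : ∀ t, f t 0 = 0) {K : ℝ → ℝ} (hK : Continuous K) (hK0 : ∀ t, 0 ≤ K t)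
    (hlip : ∀ t x y, ‖f t x - f t y‖ ≤ K t * ‖x - y‖) (x₀ : E) :
    ∃ x : ℝ → E, Continuous x ∧ x 0 = x₀ ∧ ∀ t, 0 < t → HasDerivAt x (f t (x t)) t := by
  let κ : ℝ → ℝ := fun t => ∫ s in (0 : ℝ)..t, K s
  have hκ : ∀ t, HasDerivAt κ (K t) t := fun t =>
    intervalIntegral.integral_hasDerivAt_right (hK.intervalIntegrable _ _)
      (hK.stronglyMeasurableAtFilter _ _) hK.continuousAt
  -- Bielecki weight: for `ω = W⁻¹ x` the integral operator has Lipschitz constant `1/2` on all of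
  -- `[0, ∞)`, because `∫₀ᵗ W K = (W(t) - 1)/2`.
  let W : ℝ → ℝ := fun t => Real.exp (2 * κ t)
  have hW : ∀ t, HasDerivAt W (2 * (W t * K t)) t := fun t =>
    (((hκ t).const_mul 2).exp).congr_deriv (by ring)
  have hWc : Continuous W := continuous_iff_continuousAt.2 fun t => (hW t).continuousAt
  have hWpos : ∀ t, 0 < W t := fun t => Real.exp_pos _
  have hW0 : W 0 = 1 := by simp [W, κ]
  have hκ0 : ∀ t, 0 ≤ t → 1 ≤ W t := fun t ht =>
    Real.one_le_exp (mul_nonneg zero_le_two (intervalIntegral.integral_nonneg ht fun s _ => hK0 s))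
  have hWint : ∀ t, ∫ s in (0 : ℝ)..t, W s * K s = (W t - 1) / 2 := fun t => by
    have h1 := intervalIntegral.integral_eq_sub_of_hasDerivAt (a := 0) (b := t)
      (fun s _ => hW s) ((continuous_const.mul (hWc.mul hK)).intervalIntegrable _ _)
    rw [intervalIntegral.integral_const_mul, hW0] at h1
    linarith
  have hint : ∀ ω : ℝ → E, Continuous ω → Continuous fun s => f s (W s • ω s) := fun ω hω =>
    hf.comp (continuous_id.prodMk (hWc.smul hω))
  let P : (ℝ → E) → ℝ → E := fun ω t => x₀ + ∫ s in (0 : ℝ)..t, f s (W s • ω s)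
  have hP : ∀ ω : ℝ → E, Continuous ω → ∀ t, HasDerivAt (P ω) (f t (W t • ω t)) t :=
    fun ω hω t => (intervalIntegral.integral_hasDerivAt_right ((hint ω hω).intervalIntegrable _ _)
      ((hint ω hω).stronglyMeasurableAtFilter _ _) (hint ω hω).continuousAt).const_add x₀
  have hPc : ∀ ω : ℝ → E, Continuous ω → Continuous (P ω) := fun ω hω =>
    continuous_iff_continuousAt.2 fun t => (hP ω hω t).continuousAt
  -- Clamping time at `0` lets the fixed point live among bounded continuous functions on the whole
  -- line.
  let Q : (ℝ → E) → ℝ → E := fun ω t => (W (max t 0))⁻¹ • P ω (max t 0)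
  have hQc : ∀ ω : ℝ → E, Continuous ω → Continuous (Q ω) := fun ω hω =>
    Continuous.smul ((hWc.comp (by fun_prop)).inv₀ fun t => (hWpos _).ne')
      ((hPc ω hω).comp (by fun_prop))
  have hdiff : ∀ (ω η : ℝ → E) (C : ℝ), Continuous ω → Continuous η → 0 ≤ C →
      (∀ t, ‖ω t - η t‖ ≤ C) → ∀ t, ‖Q ω t - Q η t‖ ≤ C / 2 := by
    intro ω η C hω hη hC hb t
    set τ := max t 0
    have hτ : 0 ≤ τ := le_max_right _ _
    have e : Q ω t - Q η t
        = (W τ)⁻¹ • ∫ s in (0 : ℝ)..τ, (f s (W s • ω s) - f s (W s • η s)) := by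
      rw [intervalIntegral.integral_sub ((hint ω hω).intervalIntegrable _ _)
        ((hint η hη).intervalIntegrable _ _)]
      simp only [Q, P, ← smul_sub, add_sub_add_left_eq_sub, τ]
    have hb2 : ‖∫ s in (0 : ℝ)..τ, (f s (W s • ω s) - f s (W s • η s))‖
        ≤ ∫ s in (0 : ℝ)..τ, C * (W s * K s) := by
      refine intervalIntegral.norm_integral_le_of_norm_le hτ (Eventually.of_forall fun s _ => ?_)
        ((continuous_const.mul (hWc.mul hK)).intervalIntegrable _ _)
      refine (hlip s _ _).trans ?_
      rw [← smul_sub, norm_smul, Real.norm_of_nonneg (hWpos s).le]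
      have := mul_le_mul_of_nonneg_left (hb s) (mul_nonneg (hK0 s) (hWpos s).le)
      linarith
    rw [intervalIntegral.integral_const_mul, hWint] at hb2
    rw [e, norm_smul, norm_inv, Real.norm_of_nonneg (hWpos τ).le, inv_mul_le_iff₀ (hWpos τ)]
    refine hb2.trans ?_
    nlinarith
  have hbound : ∀ (ω : ℝ → E) (C : ℝ), Continuous ω → 0 ≤ C → (∀ t, ‖ω t‖ ≤ C) →
      ∀ t, ‖Q ω t‖ ≤ ‖x₀‖ + C / 2 := by
    intro ω C hω hC hb t
    have h1 := hdiff ω (fun _ => 0) C hω continuous_const hC (by simpa using hb) t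
    have h2 : ‖Q (fun _ => 0) t‖ ≤ ‖x₀‖ := by
      simp only [Q, P, smul_zero, hf0, intervalIntegral.integral_zero, add_zero]
      rw [norm_smul, norm_inv, Real.norm_of_nonneg (hWpos _).le]
      exact mul_le_of_le_one_left (norm_nonneg _) (inv_le_one_of_one_le₀ (hκ0 _ (le_max_right _ _)))
    have h3 := norm_add_le (Q ω t - Q (fun _ => 0) t) (Q (fun _ => 0) t)
    rw [sub_add_cancel] at h3
    linarith
  let T : (ℝ →ᵇ E) → (ℝ →ᵇ E) := fun ω => BoundedContinuousFunction.ofNormedAddCommGroup (Q ω)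
    (hQc ω ω.continuous) _ (hbound ω ‖ω‖ ω.continuous (norm_nonneg _) ω.norm_coe_le_norm)
  have hT : ContractingWith (1 / 2) T := by
    refine ⟨by norm_num, LipschitzWith.of_dist_le_mul fun ω η => ?_⟩
    rw [BoundedContinuousFunction.dist_le (by positivity)]
    intro t
    have h1 := hdiff ω η (dist ω η) ω.continuous η.continuous dist_nonneg
      (fun t => by rw [← dist_eq_norm]; exact BoundedContinuousFunction.dist_coe_le_dist t) t
    rw [dist_eq_norm]
    refine h1.trans (le_of_eq ?_)
    push_cast
    ring
  set ω := hT.fixedPoint T with hω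
  have hfix : ∀ t, 0 ≤ t → W t • ω t = P ω t := fun t ht => by
    have h1 : ω t = Q ω t := by
      conv_lhs => rw [hω, ← hT.fixedPoint_isFixedPt.eq]
      rfl
    rw [h1]
    simp only [Q, max_eq_left ht, smul_inv_smul₀ (hWpos t).ne']
  refine ⟨P ω, hPc ω ω.continuous, by simp [P], fun t ht => ?_⟩
  rw [← hfix t ht.le]
  exact hP ω ω.continuous t

/-- Starting from `(1, 0)`, the product `xy` is nondecreasing, hence nonnegative; then `(x²)' =
2a₁xy ≥ 0`, so `x² ≥ 1`. By continuity `x` cannot jump to negative values, so `x ≥ 1` and `y ≥ 0`.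
-/
theorem exists_positive_solution {a₁ a₂ : ℝ → ℝ} (h₁ : Continuous a₁) (h₂ : Continuous a₂)
    (p₁ : ∀ t, 0 ≤ a₁ t) (p₂ : ∀ t, 0 ≤ a₂ t) : ∃ x y : ℝ → ℝ,
    (∀ t, 0 < t → HasDerivAt x (a₁ t * y t) t) ∧ (∀ t, 0 < t → HasDerivAt y (a₂ t * x t) t) ∧
    (∀ t, 0 ≤ t → 1 ≤ x t) ∧ ∀ t, 0 ≤ t → 0 ≤ y t := by
  obtain ⟨z, hzc, hz0, hz⟩ := exists_forward_solution
    (f := fun t (p : ℝ × ℝ) => (a₁ t * p.2, a₂ t * p.1)) (by fun_prop) (by simp)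
    (K := fun t => a₁ t + a₂ t) (h₁.add h₂) (fun t => add_nonneg (p₁ t) (p₂ t))
    (fun t x y => by
      have e : ((a₁ t * x.2, a₂ t * x.1) : ℝ × ℝ) - (a₁ t * y.2, a₂ t * y.1)
          = (a₁ t * (x - y).2, a₂ t * (x - y).1) := by
        ext <;> simp [mul_sub]
      rw [e, Prod.norm_def]
      have n1 := norm_fst_le (x - y)
      have n2 := norm_snd_le (x - y)
      have n0 := norm_nonneg (x - y)
      refine max_le ?_ ?_
      · rw [norm_mul, Real.norm_of_nonneg (p₁ t)]
        exact mul_le_mul (by linarith [p₂ t]) n2 (norm_nonneg _) (add_nonneg (p₁ t) (p₂ t))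
      · rw [norm_mul, Real.norm_of_nonneg (p₂ t)]
        exact mul_le_mul (by linarith [p₁ t]) n1 (norm_nonneg _) (add_nonneg (p₁ t) (p₂ t)))
    ((1, 0) : ℝ × ℝ)
  have hx : ∀ t, 0 < t → HasDerivAt (fun t => (z t).1) (a₁ t * (z t).2) t := fun t ht =>
    (hasFDerivAt_fst (𝕜 := ℝ) (E := ℝ) (F := ℝ)).comp_hasDerivAt t (hz t ht)
  have hy : ∀ t, 0 < t → HasDerivAt (fun t => (z t).2) (a₂ t * (z t).1) t := fun t ht =>
    (hasFDerivAt_snd (𝕜 := ℝ) (E := ℝ) (F := ℝ)).comp_hasDerivAt t (hz t ht)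
  have hxc : Continuous fun t => (z t).1 := hzc.fst
  have hyc : Continuous fun t => (z t).2 := hzc.snd
  have hxy : ∀ t, 0 ≤ t → 0 ≤ (z t).1 * (z t).2 := by
    have : MonotoneOn (fun t => (z t).1 * (z t).2) (Ici 0) := by
      refine monotoneOn_of_deriv_nonneg (convex_Ici 0) (hxc.mul hyc).continuousOn
        (fun t ht => ?_) fun t ht => ?_
      · rw [interior_Ici] at ht
        exact ((hx t ht).mul (hy t ht)).differentiableAt.differentiableWithinAt
      · rw [interior_Ici] at ht
        have hd : HasDerivAt (fun t => (z t).1 * (z t).2)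
            (a₁ t * (z t).2 * (z t).2 + (z t).1 * (a₂ t * (z t).1)) t := (hx t ht).mul (hy t ht)
        rw [hd.deriv]
        nlinarith [mul_nonneg (p₁ t) (sq_nonneg (z t).2), mul_nonneg (p₂ t) (sq_nonneg (z t).1)]
    intro t ht
    have := this (mem_Ici.2 le_rfl) ht ht
    simpa [hz0] using this
  have hsq : ∀ t, 0 ≤ t → 1 ≤ (z t).1 ^ 2 := by
    have : MonotoneOn (fun t => (z t).1 ^ 2) (Ici 0) := by
      refine monotoneOn_of_deriv_nonneg (convex_Ici 0) (hxc.pow 2).continuousOn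
        (fun t ht => ?_) fun t ht => ?_
      · rw [interior_Ici] at ht
        exact ((hx t ht).pow 2).differentiableAt.differentiableWithinAt
      · rw [interior_Ici] at ht
        have hd : HasDerivAt (fun t => (z t).1 ^ 2) (2 * (a₁ t * ((z t).1 * (z t).2))) t :=
          ((hx t ht).pow 2).congr_deriv (by norm_num; ring)
        rw [hd.deriv]
        exact mul_nonneg zero_le_two (mul_nonneg (p₁ t) (hxy t (le_of_lt ht)))
    intro t ht
    have := this (mem_Ici.2 le_rfl) ht ht
    simpa [hz0] using this
  have hx1 : ∀ t, 0 ≤ t → 1 ≤ (z t).1 := by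
    intro t ht
    by_contra! hlt
    have hneg : (z t).1 ≤ 0 := by nlinarith [hsq t ht]
    obtain ⟨s, hs, hs0⟩ := intermediate_value_Icc' ht hxc.continuousOn
      (show (0 : ℝ) ∈ Icc (z t).1 (z 0).1 from ⟨hneg, by simp [hz0]⟩)
    have := hsq s hs.1
    simp only at hs0
    rw [hs0] at this
    norm_num at this
  exact ⟨_, _, hx, hy, hx1, fun t ht =>
    nonneg_of_mul_nonneg_right (hxy t ht) (zero_lt_one.trans_le (hx1 t ht))⟩

/-- The substitution `y = d e^{-t}` sends the singular endpoint `0` to `t = ∞`, and the solution is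
started at `y = d`. Time reversal turns the nonnegative second component into `-π`. -/
theorem exists_decreasing_solution {w Q : ℝ → ℝ} (hw : ContinuousOn w (Ioi 0))
    (hQ : ContinuousOn Q (Ioi 0)) (pw : ∀ y, 0 < y → 0 ≤ w y) (pQ : ∀ y, 0 < y → 0 ≤ Q y)
    {d : ℝ} (hd : 0 < d) : ∃ ψ π : ℝ → ℝ,
    (∀ y ∈ Ioo 0 d, HasDerivAt ψ (π y * w y) y) ∧ (∀ y ∈ Ioo 0 d, HasDerivAt π (Q y * ψ y) y) ∧
    (∀ y ∈ Ioo 0 d, 1 ≤ ψ y) ∧ ∀ y ∈ Ioo 0 d, π y ≤ 0 := by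
  have hpos : ∀ t, 0 < d * Real.exp (-t) := fun t => mul_pos hd (Real.exp_pos _)
  have hexp : Continuous fun t => d * Real.exp (-t) := by fun_prop
  obtain ⟨x, y, hx, hy, hx1, hy0⟩ := exists_positive_solution
    (a₁ := fun t => d * Real.exp (-t) * w (d * Real.exp (-t)))
    (a₂ := fun t => d * Real.exp (-t) * Q (d * Real.exp (-t)))
    (hexp.mul (hw.comp_continuous hexp hpos)) (hexp.mul (hQ.comp_continuous hexp hpos))
    (fun t => mul_nonneg (hpos t).le (pw _ (hpos t)))
    (fun t => mul_nonneg (hpos t).le (pQ _ (hpos t)))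
  have hlog : ∀ s ∈ Ioo 0 d, 0 < Real.log (d / s) := fun s hs =>
    Real.log_pos ((one_lt_div hs.1).2 hs.2)
  have hback : ∀ s ∈ Ioo 0 d, d * Real.exp (-Real.log (d / s)) = s := fun s hs => by
    rw [Real.exp_neg, Real.exp_log (div_pos hd hs.1)]
    have := hs.1
    field_simp
  have hdlog : ∀ s ∈ Ioo 0 d, HasDerivAt (fun s => Real.log (d / s)) (-s⁻¹) s := fun s hs => by
    have h1 : HasDerivAt (fun s => Real.log d - Real.log s) (-s⁻¹) s :=
      (Real.hasDerivAt_log hs.1.ne').const_sub _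
    refine h1.congr_of_eventuallyEq ?_
    filter_upwards [isOpen_Ioo.mem_nhds hs] with z hz
    rw [Real.log_div hd.ne' hz.1.ne']
  refine ⟨fun s => x (Real.log (d / s)), fun s => -y (Real.log (d / s)), fun s hs => ?_,
    fun s hs => ?_, fun s hs => hx1 _ (hlog s hs).le,
    fun s hs => neg_nonpos.2 (hy0 _ (hlog s hs).le)⟩
  · refine ((hx _ (hlog s hs)).comp s (hdlog s hs)).congr_deriv ?_
    rw [hback s hs]
    have := hs.1
    field_simp
  · refine ((hy _ (hlog s hs)).comp s (hdlog s hs)).neg.congr_deriv ?_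
    rw [hback s hs]
    have := hs.1
    field_simp

theorem hasDerivAt_primitive {F : ℝ → ℝ} {S : Set ℝ} (hS : IsOpen S) (hc : S.OrdConnected)
    (hF : ContinuousOn F S) {x₀ y : ℝ} (hx : x₀ ∈ S) (hy : y ∈ S) :
    HasDerivAt (fun y => ∫ s in x₀..y, F s) (F y) y :=
  intervalIntegral.integral_hasDerivAt_right
    (hF.mono (hc.uIcc_subset hx hy)).intervalIntegrable
    (hF.stronglyMeasurableAtFilter hS y hy) (hF.continuousAt (hS.mem_nhds hy))

/-- A fundamental system on `(0, d)` whose first member vanishes at `0`. -/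
theorem exists_fundamental_system {w Q : ℝ → ℝ} (hw : Continuous w) (hw0 : w 0 = 0)
    (hQ : ContinuousOn Q (Ioi 0)) (pw : ∀ y, 0 < y → 0 < w y) (pQ : ∀ y, 0 < y → 0 ≤ Q y)
    {d : ℝ} (hd : 0 < d) : ∃ φ ρ ψ π : ℝ → ℝ,
    (∀ y ∈ Ioo 0 d, HasDerivAt φ (ρ y * w y) y) ∧ (∀ y ∈ Ioo 0 d, HasDerivAt ρ (Q y * φ y) y) ∧
    (∀ y ∈ Ioo 0 d, HasDerivAt ψ (π y * w y) y) ∧ (∀ y ∈ Ioo 0 d, HasDerivAt π (Q y * ψ y) y) ∧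
    (∀ y ∈ Ioo 0 d, ρ y * ψ y - π y * φ y = 1) ∧ (∀ y ∈ Ioo 0 d, 0 < φ y) ∧
    Tendsto φ (𝓝[>] 0) (𝓝 0) ∧ ∃ l, Tendsto ρ (𝓝[>] 0) (𝓝 l) := by
  obtain ⟨ψ, π, hψ, hπ, hψ1, hπ0⟩ := exists_decreasing_solution hw.continuousOn hQ
    (fun y hy => (pw y hy).le) pQ hd
  have ψpos : ∀ y ∈ Ioo 0 d, 0 < ψ y := fun y hy => zero_lt_one.trans_le (hψ1 y hy)
  have ψanti : AntitoneOn ψ (Ioo 0 d) := by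
    refine antitoneOn_of_deriv_nonpos (convex_Ioo 0 d)
      (fun y hy => (hψ y hy).continuousAt.continuousWithinAt) (fun y hy => ?_) fun y hy => ?_
    · rw [interior_Ioo] at hy
      exact (hψ y hy).differentiableAt.differentiableWithinAt
    · rw [interior_Ioo] at hy
      rw [(hψ y hy).deriv]
      exact mul_nonpos_of_nonpos_of_nonneg (hπ0 y hy) (pw y hy.1).le
  -- Reduction of order: the second solution is `φ = ψ ∫₀ w/ψ²`. The integrand extends continuously
  -- by `0` past the origin because `0 ≤ j ≤ w` and `w 0 = 0`.
  let j : ℝ → ℝ := fun s => if 0 < s then w s / ψ s ^ 2 else 0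
  have hj : ∀ s, 0 < s → j s = w s / ψ s ^ 2 := fun s hs => if_pos hs
  have hjw : ∀ s ∈ Ioo 0 d, j s ≤ w s := fun s hs => by
    rw [hj s hs.1]
    exact div_le_self (pw s hs.1).le (one_le_pow₀ (hψ1 s hs))
  have hj0 : ∀ s ∈ Ioo 0 d, 0 < j s := fun s hs => by
    rw [hj s hs.1]
    exact div_pos (pw s hs.1) (pow_pos (ψpos s hs) 2)
  have hjc : ContinuousOn j (Ioo (-1) d) := by
    intro s hs
    refine ContinuousAt.continuousWithinAt ?_
    rcases lt_trichotomy s 0 with h | rfl | h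
    · refine (continuousAt_const (y := (0 : ℝ))).congr ?_
      filter_upwards [Iio_mem_nhds h] with z hz
      exact (if_neg (not_lt.2 (le_of_lt hz))).symm
    · rw [ContinuousAt, show j 0 = 0 from if_neg (lt_irrefl _)]
      have h1 : Tendsto (fun s => |w s|) (𝓝 0) (𝓝 0) := by
        simpa [hw0] using (hw.abs.tendsto 0)
      refine squeeze_zero_norm' ?_ h1
      filter_upwards [Iio_mem_nhds hd] with z hz
      rcases le_or_gt z 0 with h | h
      · simp [j, not_lt.2 h]
      · rw [Real.norm_of_nonneg (hj0 z ⟨h, hz⟩).le]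
        exact (hjw z ⟨h, hz⟩).trans (le_abs_self _)
    · refine ContinuousAt.congr (f := fun s => w s / ψ s ^ 2) ?_ ?_
      · exact hw.continuousAt.div ((hψ s ⟨h, hs.2⟩).continuousAt.pow 2)
          (pow_pos (ψpos s ⟨h, hs.2⟩) 2).ne'
      · filter_upwards [Ioi_mem_nhds h] with z hz using (hj z hz).symm
  have m0 : (0 : ℝ) ∈ Ioo (-1) d := ⟨by norm_num, hd⟩
  have mI : ∀ y ∈ Ioo 0 d, y ∈ Ioo (-1) d := fun y hy => ⟨by linarith [hy.1], hy.2⟩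
  let I : ℝ → ℝ := fun y => ∫ s in (0 : ℝ)..y, j s
  have hI : ∀ y ∈ Ioo 0 d, HasDerivAt I (w y / ψ y ^ 2) y := fun y hy => by
    rw [← hj y hy.1]
    exact hasDerivAt_primitive isOpen_Ioo ordConnected_Ioo hjc m0 (mI y hy)
  have hji : ∀ y ∈ Ioo 0 d, IntervalIntegrable j MeasureTheory.volume 0 y := fun y hy =>
    (hjc.mono (ordConnected_Ioo.uIcc_subset m0 (mI y hy))).intervalIntegrable
  have hIpos : ∀ y ∈ Ioo 0 d, 0 < I y := fun y hy =>
    intervalIntegral.intervalIntegral_pos_of_pos_on (hji y hy)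
      (fun s hs => hj0 s ⟨hs.1, hs.2.trans hy.2⟩) hy.1
  have φpos : ∀ y ∈ Ioo 0 d, 0 < ψ y * I y := fun y hy => mul_pos (ψpos y hy) (hIpos y hy)
  have hφ : ∀ y ∈ Ioo 0 d, HasDerivAt (fun y => ψ y * I y) ((π y * I y + (ψ y)⁻¹) * w y) y :=
    fun y hy => ((hψ y hy).mul (hI y hy)).congr_deriv (by
      have := (ψpos y hy).ne'
      field_simp)
  have hρ : ∀ y ∈ Ioo 0 d, HasDerivAt (fun y => π y * I y + (ψ y)⁻¹) (Q y * (ψ y * I y)) y :=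
    fun y hy => (((hπ y hy).mul (hI y hy)).add ((hψ y hy).inv (ψpos y hy).ne')).congr_deriv (by
      have := (ψpos y hy).ne'
      field_simp
      ring)
  have φ0 : Tendsto (fun y => ψ y * I y) (𝓝[>] 0) (𝓝 0) := by
    have h1 : Tendsto (fun y => ∫ s in (0 : ℝ)..y, w s) (𝓝[>] 0) (𝓝 0) := by
      have := (hasDerivAt_primitive isOpen_univ ordConnected_univ hw.continuousOn (mem_univ 0)
        (mem_univ 0)).continuousAt.tendsto
      rw [intervalIntegral.integral_same] at this
      exact this.mono_left nhdsWithin_le_nhds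
    refine squeeze_zero' ?_ ?_ h1
    · filter_upwards [Ioo_mem_nhdsGT hd] with y hy using (φpos y hy).le
    · filter_upwards [Ioo_mem_nhdsGT hd] with y hy
      simp only [I]
      rw [← intervalIntegral.integral_const_mul]
      refine intervalIntegral.integral_mono_on hy.1.le ((hji y hy).const_mul _)
        (hw.intervalIntegrable _ _) fun s hs => ?_
      rcases hs.1.eq_or_lt with rfl | hs0
      · simp [j, hw0]
      · have ms : s ∈ Ioo 0 d := ⟨hs0, hs.2.trans_lt hy.2⟩
        have k1 := ψanti ms hy hs.2
        -- From `ψ(y) ≤ ψ(s)` and `ψ(s) ≥ 1`; hence `φ(y) ≤ ∫₀^y w`, which tends to `0`.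
        have k2 : ψ y ≤ ψ s ^ 2 := by nlinarith [hψ1 s ms]
        rw [hj s hs0, mul_div_assoc', div_le_iff₀ (pow_pos (ψpos s ms) 2), mul_comm]
        exact mul_le_mul_of_nonneg_left k2 (pw s hs0).le
  have ρmono : MonotoneOn (fun y => π y * I y + (ψ y)⁻¹) (Ioo 0 d) := by
    refine monotoneOn_of_deriv_nonneg (convex_Ioo 0 d)
      (fun y hy => (hρ y hy).continuousAt.continuousWithinAt) (fun y hy => ?_) fun y hy => ?_
    · rw [interior_Ioo] at hy
      exact (hρ y hy).differentiableAt.differentiableWithinAt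
    · rw [interior_Ioo] at hy
      rw [(hρ y hy).deriv]
      exact mul_nonneg (pQ y hy.1) (φpos y hy).le
  -- If `ρ(y) < 0`, then by monotonicity `ρ < 0` on `(0, y]`, so `φ` is nonincreasing there; as
  -- `φ(0+) = 0`, this contradicts `φ(y) > 0`. Being monotone and bounded below, `ρ` has a finite
  -- limit at `0`.
  have ρnn : ∀ y ∈ Ioo 0 d, 0 ≤ π y * I y + (ψ y)⁻¹ := by
    intro y hy
    by_contra! hneg
    have anti : AntitoneOn (fun y => ψ y * I y) (Ioc 0 y) := by
      have m : ∀ z ∈ Ioc 0 y, z ∈ Ioo 0 d := fun z hz => ⟨hz.1, hz.2.trans_lt hy.2⟩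
      refine antitoneOn_of_deriv_nonpos (convex_Ioc 0 y)
        (fun z hz => (hφ z (m z hz)).continuousAt.continuousWithinAt) (fun z hz => ?_)
        fun z hz => ?_
      · rw [interior_Ioc] at hz
        exact (hφ z (m z (Ioo_subset_Ioc_self hz))).differentiableAt.differentiableWithinAt
      · rw [interior_Ioc] at hz
        have mz := m z (Ioo_subset_Ioc_self hz)
        rw [(hφ z mz).deriv]
        exact mul_nonpos_of_nonpos_of_nonneg ((ρmono mz hy hz.2.le).trans hneg.le) (pw z mz.1).le
    have : ψ y * I y ≤ 0 := by
      refine ge_of_tendsto φ0 ?_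
      filter_upwards [Ioo_mem_nhdsGT hy.1] with z hz
      exact anti ⟨hz.1, hz.2.le⟩ ⟨hy.1, le_rfl⟩ hz.2.le
    exact absurd (φpos y hy) (not_lt.2 this)
  refine ⟨fun y => ψ y * I y, fun y => π y * I y + (ψ y)⁻¹, ψ, π, hφ, hρ, hψ, hπ, fun y hy => ?_,
    φpos, φ0, _, ρmono.tendsto_nhdsWithin_Ioo_right (nonempty_Ioo.2 hd) ⟨0, ?_⟩⟩
  · have := (ψpos y hy).ne'
    field_simp
    ring
  · rintro _ ⟨y, hy, rfl⟩
    exact ρnn y hy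

/-- The one-sided boundary value problem for a profile. -/
theorem exists_halfProfile {w h : ℝ → ℝ} (hw : Continuous w) (hw0 : w 0 = 0)
    (pw : ∀ y, 0 < y → 0 < w y) (hh : Continuous h) (hh0 : h =ᶠ[𝓝 0] 0) {μ K c : ℝ} (hμ : 0 < μ)
    (hK : 0 ≤ K) (hc : 0 < c) : ∃ (g p : ℝ → ℝ) (l : ℝ),
    (∀ y ∈ Ioc 0 c, HasDerivAt g (p y * w y) y) ∧
    (∀ y ∈ Ioc 0 c, HasDerivAt p (2 * (μ * g y - h y + K / w y ^ 2 * g y) * w y) y) ∧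
    Tendsto g (𝓝[>] 0) (𝓝 0) ∧ Tendsto p (𝓝[>] 0) (𝓝 l) ∧ μ * g c = h c := by
  set Q : ℝ → ℝ := fun y => 2 * (μ + K / w y ^ 2) * w y
  have hQ : ContinuousOn Q (Ioi 0) := by
    refine ContinuousOn.mul (continuousOn_const.mul (continuousOn_const.add
      (continuousOn_const.div (hw.continuousOn.pow 2) fun y hy => ?_))) hw.continuousOn
    exact (pow_pos (pw y hy) 2).ne'
  -- The system is solved slightly beyond `c`, so that two-sided derivatives exist at `c` itself.
  set d := c + 1
  have hd : 0 < d := by positivity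
  have hcd : c < d := lt_add_one c
  obtain ⟨φ, ρ, ψ, π, hφ, hρ, hψ, hπ, hWr, φpos, φ0, l, hl⟩ := exists_fundamental_system hw hw0 hQ
    pw (fun y hy => mul_nonneg (mul_nonneg zero_le_two
      (add_nonneg hμ.le (div_nonneg hK (sq_nonneg _)))) (pw y hy).le) hd
  obtain ⟨δ, hδ, hδ0⟩ := Metric.eventually_nhds_iff.1 hh0
  -- On `(0, x₀]` the inhomogeneity vanishes. Starting the variation-of-constants integrals at `x₀`
  -- makes `U = V = 0` near `0`, so there the solution is just `Cφ`.
  set x₀ := min (δ / 2) (c / 2)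
  have hx₀ : 0 < x₀ := lt_min (half_pos hδ) (half_pos hc)
  have hx₀d : x₀ ∈ Ioo 0 d := ⟨hx₀, (min_le_right _ _).trans_lt (by linarith)⟩
  have hz : ∀ s ∈ Ioc 0 x₀, h s = 0 := fun s hs => hδ0 (by
    rw [Real.dist_eq, sub_zero, abs_of_pos hs.1]
    have := hs.2.trans (min_le_left _ _)
    linarith)
  have cφ : ContinuousOn φ (Ioo 0 d) := fun y hy => (hφ y hy).continuousAt.continuousWithinAt
  have cψ : ContinuousOn ψ (Ioo 0 d) := fun y hy => (hψ y hy).continuousAt.continuousWithinAt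
  let U : ℝ → ℝ := fun y => ∫ s in x₀..y, -(2 * h s * ψ s * w s)
  let V : ℝ → ℝ := fun y => ∫ s in x₀..y, 2 * h s * φ s * w s
  have hU : ∀ y ∈ Ioo 0 d, HasDerivAt U (-(2 * h y * ψ y * w y)) y := fun y hy =>
    hasDerivAt_primitive isOpen_Ioo ordConnected_Ioo
      (((hh.const_mul 2).continuousOn.mul cψ).mul hw.continuousOn).neg hx₀d hy
  have hV : ∀ y ∈ Ioo 0 d, HasDerivAt V (2 * h y * φ y * w y) y := fun y hy =>
    hasDerivAt_primitive isOpen_Ioo ordConnected_Ioo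
      (((hh.const_mul 2).continuousOn.mul cφ).mul hw.continuousOn) hx₀d hy
  have hU0 : ∀ y ∈ Ioc 0 x₀, U y = 0 := fun y hy => by
    refine intervalIntegral.integral_zero_ae (Eventually.of_forall fun s hs => ?_)
    rw [uIoc_of_ge hy.2] at hs
    simp [hz s ⟨hy.1.trans hs.1, hs.2⟩]
  have hV0 : ∀ y ∈ Ioc 0 x₀, V y = 0 := fun y hy => by
    refine intervalIntegral.integral_zero_ae (Eventually.of_forall fun s hs => ?_)
    rw [uIoc_of_ge hy.2] at hs
    simp [hz s ⟨hy.1.trans hs.1, hs.2⟩]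
  have hcI : c ∈ Ioo 0 d := ⟨hc, hcd⟩
  -- The free multiple of `φ` is fixed by the end condition `μ g c = h c`, using `φ c > 0`.
  set C := (h c / μ - φ c * U c - ψ c * V c) / φ c with hC
  have sub : ∀ y ∈ Ioc 0 c, y ∈ Ioo 0 d := fun y hy => ⟨hy.1, hy.2.trans_lt hcd⟩
  have near : ∀ᶠ y in 𝓝[>] (0 : ℝ), y ∈ Ioc 0 x₀ :=
    mem_of_superset (Ioo_mem_nhdsGT hx₀) Ioo_subset_Ioc_self
  refine ⟨fun y => φ y * (U y + C) + ψ y * V y, fun y => ρ y * (U y + C) + π y * V y, l * C,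
    fun y hy => ?_, fun y hy => ?_, ?_, ?_, ?_⟩
  · have m := sub y hy
    refine (((hφ y m).mul ((hU y m).add_const C)).add ((hψ y m).mul (hV y m))).congr_deriv ?_
    ring
  · have m := sub y hy
    refine (((hρ y m).mul ((hU y m).add_const C)).add ((hπ y m).mul (hV y m))).congr_deriv ?_
    have k := hWr y m
    simp only [Q]
    linear_combination (-2 * h y * w y) * k
  · have := φ0.mul_const C
    rw [zero_mul] at this
    refine this.congr' ?_
    filter_upwards [near] with y hy
    rw [hU0 y hy, hV0 y hy]
    ring
  · refine (hl.mul_const C).congr' ?_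
    filter_upwards [near] with y hy
    rw [hU0 y hy, hV0 y hy]
    ring
  · have := (φpos c hcI).ne'
    rw [hC]
    field_simp
    ring

end ODE

/-! ### Solving `μf - Af = F` mode by mode. -/

section Resolvent

variable {a b : ℝ} {lam : ℝ → ℝ}

theorem lamTilde_zero : lamTilde lam 0 = 0 := by simp [lamTilde, shift]

/-- The resolvent equation for profiles of modes that are not rotationally symmetric. -/
theorem exists_profile_of_ne_zero (h : IsFriction lam) (ha : a < 0) (hb : 0 < b) {k : ℤ}
    (hk : k ≠ 0) {F : ℝ → ℝ} (hF : Continuous F) (hF0 : F =ᶠ[𝓝 0] 0) {μ : ℝ} (hμ : 0 < μ) :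
    ∃ g p r : ℝ → ℝ, ContinuousOn g (Icc a b) ∧ g 0 = 0 ∧
      IsProfile a b lam k g p r fun y => μ * g y - F y := by
  have hw := h.continuous_lamTilde
  obtain ⟨g₁, p₁, l₁, dg₁, dp₁, lg₁, lp₁, e₁⟩ := exists_halfProfile hw lamTilde_zero
    (fun y hy => h.lamTilde_pos hy.ne') hF hF0 hμ (sq_nonneg (k : ℝ)) hb
  -- The left side is the reflected right-hand problem; reflection changes the sign of the first
  -- derivative, whence `-p₂` below.
  obtain ⟨g₂, p₂, l₂, dg₂, dp₂, lg₂, lp₂, e₂⟩ := exists_halfProfile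
    (w := fun y => lamTilde lam (-y)) (h := fun y => F (-y)) (hw.comp continuous_neg)
    (by rw [neg_zero, lamTilde_zero]) (fun y hy => h.lamTilde_pos (neg_neg_of_pos hy).ne)
    (hF.comp continuous_neg)
    (by
      have : Tendsto (fun y : ℝ => -y) (𝓝 0) (𝓝 0) := by
        simpa using (continuous_neg (G := ℝ)).tendsto 0
      exact this.eventually hF0) hμ (sq_nonneg (k : ℝ)) (neg_pos.2 ha)
  let g : ℝ → ℝ := fun y => if 0 < y then g₁ y else if y < 0 then g₂ (-y) else 0
  let p : ℝ → ℝ := fun y => if 0 < y then p₁ y else -p₂ (-y)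
  let r : ℝ → ℝ := fun y => 2 * (μ * g y - F y + (k : ℝ) ^ 2 / lamTilde lam y ^ 2 * g y)
  have gpos : ∀ y, 0 < y → g y = g₁ y := fun y hy => if_pos hy
  have gneg : ∀ y, y < 0 → g y = g₂ (-y) := fun y hy => by simp [g, hy, hy.not_gt]
  have ppos : ∀ y, 0 < y → p y = p₁ y := fun y hy => if_pos hy
  have pneg : ∀ y, y < 0 → p y = -p₂ (-y) := fun y hy => if_neg hy.not_gt
  have dg : ∀ y ∈ Icc a b, y ≠ 0 → HasDerivAt g (p y * lamTilde lam y) y := by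
    intro y hy h0
    rcases lt_or_gt_of_ne h0 with hlt | hgt
    · rw [pneg y hlt]
      have h1 := (dg₂ (-y) ⟨neg_pos.2 hlt, neg_le_neg hy.1⟩).comp y (hasDerivAt_neg y)
      rw [neg_neg] at h1
      refine (h1.congr_deriv (by ring)).congr_of_eventuallyEq ?_
      filter_upwards [Iio_mem_nhds hlt] with z hz using gneg z hz
    · rw [ppos y hgt]
      refine (dg₁ y ⟨hgt, hy.2⟩).congr_of_eventuallyEq ?_
      filter_upwards [Ioi_mem_nhds hgt] with z hz using gpos z hz
  have dp : ∀ y ∈ Icc a b, y ≠ 0 → HasDerivAt p (r y * lamTilde lam y) y := by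
    intro y hy h0
    rcases lt_or_gt_of_ne h0 with hlt | hgt
    · have h1 := ((dp₂ (-y) ⟨neg_pos.2 hlt, neg_le_neg hy.1⟩).comp y (hasDerivAt_neg y)).neg
      rw [neg_neg] at h1
      refine (h1.congr_deriv ?_).congr_of_eventuallyEq ?_
      · simp only [r, gneg y hlt]
        ring
      · filter_upwards [Iio_mem_nhds hlt] with z hz using pneg z hz
    · simp only [r, gpos y hgt]
      refine (dp₁ y ⟨hgt, hy.2⟩).congr_of_eventuallyEq ?_
      filter_upwards [Ioi_mem_nhds hgt] with z hz using ppos z hz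
  have g0 : g 0 = 0 := by simp [g]
  have negT : Tendsto (fun y : ℝ => -y) (𝓝[<] 0) (𝓝[>] 0) := by
    simpa using tendsto_neg_nhdsLT (a := (0 : ℝ))
  have lg : Tendsto g (𝓝[≠] 0) (𝓝 0) := by
    rw [← nhdsLT_sup_nhdsGT]
    refine Tendsto.sup ((lg₂.comp negT).congr' ?_) (lg₁.congr' ?_)
    · filter_upwards [self_mem_nhdsWithin] with y hy using (gneg y hy).symm
    · filter_upwards [self_mem_nhdsWithin] with y hy using (gpos y hy).symm
  have gca : ∀ y ∈ Icc a b, ContinuousAt g y := by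
    intro y hy
    rcases eq_or_ne y 0 with rfl | h0
    · rw [continuousAt_iff_punctured_nhds, g0]
      exact lg
    · exact (dg y hy h0).continuousAt
  have hF00 : F 0 = 0 := hF0.self_of_nhds
  have sca : ∀ y ∈ Icc a b, Tendsto (fun y => μ * g y - F y) (𝓝 y) (𝓝 (μ * g y - F y)) :=
    fun y hy => ((gca y hy).const_mul μ).sub hF.continuousAt
  refine ⟨g, p, r, fun y hy => (gca y hy).continuousWithinAt, g0,
    fun y hy => dg y (inner_subset hy) hy.2, fun y hy => dp y (inner_subset hy) hy.2,
    fun y hy => ?_, fun y _ => ?_, ⟨-l₂, l₁, ?_, ?_, fun h => absurd h hk⟩,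
    ⟨0, ?_, fun _ => rfl⟩, ?_, ?_⟩
  · have hg := gca y (inner_subset hy)
    have hl : ContinuousAt (fun y => (k : ℝ) ^ 2 / lamTilde lam y ^ 2) y :=
      continuousAt_const.div (hw.continuousAt.pow 2) (pow_pos (h.lamTilde_pos hy.2) 2).ne'
    exact ((((hg.const_mul μ).sub hF.continuousAt).add (hl.mul hg)).const_mul
      2).continuousWithinAt
  · simp only [r]
    ring
  · refine (lp₂.comp negT).neg.congr' ?_
    filter_upwards [self_mem_nhdsWithin] with y hy using (pneg y hy).symm
  · refine lp₁.congr' ?_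
    filter_upwards [self_mem_nhdsWithin] with y hy using (ppos y hy).symm
  · have := sca 0 ⟨ha.le, hb.le⟩
    rw [g0, hF00, mul_zero, sub_zero] at this
    exact this.mono_left nhdsWithin_le_nhds
  · have := sca a ⟨le_rfl, (ha.trans hb).le⟩
    rw [gneg a ha, e₂, neg_neg, sub_self] at this
    exact this.mono_left nhdsWithin_le_nhds
  · have := sca b ⟨(ha.trans hb).le, le_rfl⟩
    rw [gpos b hb, e₁, sub_self] at this
    exact this.mono_left nhdsWithin_le_nhds

/-- The resolvent equation for rotationally symmetric functions. -/
theorem exists_profile_zero (h : IsFriction lam) (ha : a < 0) (hb : 0 < b) {F : ℝ → ℝ}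
    (hF : Continuous F) {μ : ℝ} (hμ : 0 < μ) :
    ∃ g p r : ℝ → ℝ, Continuous g ∧ IsProfile a b lam 0 g p r fun y => μ * g y - F y := by
  -- In the coordinate `ũ` the equation is `g''/2 = μg - F`, with homogeneous solutions `exp(±κũ)`.
  set κ := Real.sqrt (2 * μ)
  have hκ : 0 < κ := Real.sqrt_pos.2 (by positivity)
  have hκ2 : κ ^ 2 = 2 * μ := Real.sq_sqrt (by positivity)
  have hw := h.continuous_lamTilde
  have hu := h.continuous_uTilde
  let P : ℝ → ℝ := fun y => Real.exp (κ * uTilde lam y)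
  let N : ℝ → ℝ := fun y => Real.exp (-(κ * uTilde lam y))
  have hP : ∀ y, HasDerivAt P (κ * P y * lamTilde lam y) y := fun y =>
    ((h.hasDerivAt_uTilde y).const_mul κ).exp.congr_deriv (by ring)
  have hN : ∀ y, HasDerivAt N (-(κ * N y * lamTilde lam y)) y := fun y =>
    (((h.hasDerivAt_uTilde y).const_mul κ).fun_neg.exp).congr_deriv (by ring)
  have hPN : ∀ y, P y * N y = 1 := fun y => by
    rw [← Real.exp_add, add_neg_cancel, Real.exp_zero]
  have cP : Continuous P := continuous_iff_continuousAt.2 fun y => (hP y).continuousAt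
  have cN : Continuous N := continuous_iff_continuousAt.2 fun y => (hN y).continuousAt
  let U : ℝ → ℝ := fun y => ∫ s in (0 : ℝ)..y, F s * N s * lamTilde lam s
  let V : ℝ → ℝ := fun y => ∫ s in (0 : ℝ)..y, F s * P s * lamTilde lam s
  have hU : ∀ y, HasDerivAt U (F y * N y * lamTilde lam y) y := fun y =>
    hasDerivAt_primitive isOpen_univ ordConnected_univ ((hF.mul cN).mul hw).continuousOn
      (mem_univ _) (mem_univ _)
  have hV : ∀ y, HasDerivAt V (F y * P y * lamTilde lam y) y := fun y =>
    hasDerivAt_primitive isOpen_univ ordConnected_univ ((hF.mul cP).mul hw).continuousOn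
      (mem_univ _) (mem_univ _)
  -- A particular solution by variation of constants; no condition at `0` is needed because it is
  -- regular across the centre.
  let g₀ : ℝ → ℝ := fun y => -(κ⁻¹ * (P y * U y - N y * V y))
  have hD : P a * N b - P b * N a ≠ 0 := by
    have hab := h.strictMono_uTilde (ha.trans hb)
    have h1 : P a < P b := Real.exp_lt_exp.2 (by gcongr)
    have h2 : N b < N a := Real.exp_lt_exp.2 (neg_lt_neg (by gcongr))
    have h3 : P a * N b < P b * N a :=
      mul_lt_mul h1 h2.le (Real.exp_pos _) (Real.exp_pos _).le
    exact (sub_neg.2 h3).ne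
  set D := P a * N b - P b * N a with hDdef
  -- Cramer's rule for the homogeneous part that makes `μg = F` at both ends; the determinant `D` is
  -- nonzero because `ũ(a) < ũ(b)`.
  set ca := F a / μ - g₀ a with hca
  set cb := F b / μ - g₀ b with hcb
  set A := (ca * N b - cb * N a) / D with hA
  set B := (cb * P a - ca * P b) / D with hB
  let g : ℝ → ℝ := fun y => g₀ y + (A * P y + B * N y)
  let p : ℝ → ℝ := fun y => -(P y * U y + N y * V y) + κ * (A * P y - B * N y)
  have hg : ∀ y, HasDerivAt g (p y * lamTilde lam y) y := fun y => by
    refine (((((hP y).mul (hU y)).sub ((hN y).mul (hV y))).const_mul κ⁻¹).neg.add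
      (((hP y).const_mul A).add ((hN y).const_mul B))).congr_deriv ?_
    simp only [p]
    field_simp
    ring
  have hp : ∀ y, HasDerivAt p (2 * (μ * g y - F y) * lamTilde lam y) y := fun y => by
    refine ((((hP y).mul (hU y)).add ((hN y).mul (hV y))).neg.add
      ((((hP y).const_mul A).sub ((hN y).const_mul B)).const_mul κ)).congr_deriv ?_
    have e : 2 * (μ * g y - F y) = κ ^ 2 * g y - 2 * F y * (P y * N y) := by
      rw [hκ2, hPN]; ring
    rw [e]
    simp only [g, g₀]
    field_simp
    ring
  have cg : Continuous g := continuous_iff_continuousAt.2 fun y => (hg y).continuousAt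
  have cp : Continuous p := continuous_iff_continuousAt.2 fun y => (hp y).continuousAt
  have cs : Continuous fun y => μ * g y - F y := (cg.const_mul μ).sub hF
  have ga : μ * g a - F a = 0 := by
    have : A * P a + B * N a = ca := by
      rw [hA, hB]
      field_simp
      rw [hDdef]
      ring
    simp only [g, this, hca]
    field_simp
    ring
  have gb : μ * g b - F b = 0 := by
    have : A * P b + B * N b = cb := by
      rw [hA, hB]
      field_simp
      rw [hDdef]
      ring
    simp only [g, this, hcb]
    field_simp
    ring
  refine ⟨g, p, fun y => 2 * (μ * g y - F y), cg, fun y _ => hg y, fun y _ => hp y,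
    (cs.const_mul 2).continuousOn, fun y _ => by simp, ⟨p 0, p 0, ?_, ?_, fun _ => rfl⟩,
    ⟨_, (cs.tendsto 0).mono_left nhdsWithin_le_nhds, fun h => absurd rfl h⟩, ?_, ?_⟩
  · exact (cp.tendsto 0).mono_left nhdsWithin_le_nhds
  · exact (cp.tendsto 0).mono_left nhdsWithin_le_nhds
  · rw [← ga]
    exact (cs.tendsto a).mono_left nhdsWithin_le_nhds
  · rw [← gb]
    exact (cs.tendsto b).mono_left nhdsWithin_le_nhds

theorem smoothModes_subset_range (h : IsFriction lam) (ha : a < 0) (hb : 0 < b) {μ : ℝ}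
    (hμ : 0 < μ) : smoothModes a b lam ⊆
      range fun f : (opA lam ha hb).domain => μ • (f : C(Glued a b, ℝ)) - opA lam ha hb f := by
  rintro f ⟨H, k, φ, hH, h0, hf⟩
  have hc : Continuous fun y => H (uTilde lam y) := hH.continuous.comp h.continuous_uTilde
  rcases eq_or_ne k 0 with rfl | hk
  · obtain ⟨g, p, r, hg, hprof⟩ := exists_profile_zero h ha hb hc hμ
    exact hf.mem_range h ha hb hg.continuousOn (Or.inl rfl) hprof
  · have hF0 : (fun y => H (uTilde lam y)) =ᶠ[𝓝 0] 0 := by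
      have h1 : Tendsto (uTilde lam) (𝓝 0) (𝓝 0) := by
        simpa [uTilde_zero] using h.continuous_uTilde.tendsto 0
      exact h1.eventually (h0.resolve_left hk)
    obtain ⟨g, p, r, hg, hg0, hprof⟩ := exists_profile_of_ne_zero h ha hb hk hc hF0 hμ
    exact hf.mem_range h ha hb hg (Or.inr hg0) hprof

end Resolvent

end VanishingFriction

end

theorem lemma3p1 (a b : ℝ) (ha : a < 0) (hb : 0 < b) (lam : ℝ → ℝ)
    (hsmooth : ContDiff ℝ 1 lam)
    (hzero : ∀ y ∈ Set.Icc (-1 : ℝ) 1, lam y = 0)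
    (hpos : ∀ y, y ∉ Set.Icc (-1 : ℝ) 1 → 0 < lam y)
    (hdivm : ∀ ε : ℝ, 0 < ε →
      ∫⁻ y in Set.Ioo (-ε - 1) (-1), ENNReal.ofReal (1 / lam y) = ⊤)
    (hdivp : ∀ ε : ℝ, 0 < ε →
      ∫⁻ y in Set.Ioo 1 (1 + ε), ENNReal.ofReal (1 / lam y) = ⊤) :
    (VanishingFriction.opA lam ha hb).IsClosable ∧
      ∃ T : NNReal → C(VanishingFriction.Glued a b, ℝ) →L[ℝ]
          C(VanishingFriction.Glued a b, ℝ),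
        VanishingFriction.IsMarkovSemigroup T ∧
          VanishingFriction.IsInfinitesimalOperator T (VanishingFriction.opA lam ha hb).closure := by
  have h : VanishingFriction.IsFriction lam := ⟨hsmooth.continuous, hzero, hpos⟩
  exact VanishingFriction.exists_markovSemigroup _ (VanishingFriction.opA_min h ha hb)
    (VanishingFriction.one_mem_graph h ha hb) (VanishingFriction.dense_dom h ha hb)
    fun μ hμ => VanishingFriction.dense_range_sub h ha hb μ
      (VanishingFriction.smoothModes_subset_range h ha hb hμ)
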